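/- Let $G$ be a compact Hausdorff group with normalized Haar measure $m_G$. Let $\Phi:[0,\infty]\to[0,\infty]$ be a Young function (convex, $\Phi(0)=0$, $\Phi(x)\to\infty$ as $x\to\infty$) with complementary function $\Psi(y)=\sup\{xy-\Phi(x):0\le x<\infty\}$. Assume that $\Phi$ and $\Psi$ are finite on $[0,\infty)$ and both satisfy the $\Delta_2$-condition: there are $K>0$ and $x_0>0$ with $\Phi(2x)\le K\Phi(x)$ for all real $x\ge x_0$, and similarly for $\Psi$. Let $L^\Phi(G)$ be the Banach space of (classes of $m_G$-a.e. equal) complex measurable functions $f$ on $G$ with finite Luxemburg norm $\|f\|_\Phi=\inf\{k>0:\int_G\Phi(|f|/k)\,dm_G\le1\}$. Let $\mu\neq0$ be a complex Radon measure on $G$, and let $\nu=\nu_{\Phi,\mu}$ be the $L^\Phi(G)$-valued vector measure $\nu(A)=\mu*\chi_A$ on the Borel sets, where $(\mu*f)(t)=\int_G f(s^{-1}t)\,d\mu(s)$. Write $|\nu|$ for its variation and $\langle\nu,x'\rangle(A)=\langle\nu(A),x'\rangle$ for $x'\in L^\Phi(G)'$. Let $L^1(\nu)$ be the space of (classes of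 $\nu$-a.e. equal) Borel functions $f:G\to\mathbb C$ which are integrable with respect to $|\langle\nu,x'\rangle|$ for every $x'$ and such that for every Borel set $A$ there is a unique $\int_Af\,d\nu\in L^\Phi(G)$ with $\langle\int_Af\,d\nu,x'\rangle=\int_Af\,d\langle\nu,x'\rangle$ for all $x'$; its norm is $\|f\|_\nu=\sup_{\|x'\|\le1}\int_G|f|\,d|\langle\nu,x'\rangle|$. Let $I_\nu:L^1(\nu)\to L^\Phi(G)$, $I_\nu(f)=\int_Gf\,d\nu$. Then the following are equivalent: (i) the operator $I_\nu$ is compact; (ii) $\nu$ has finite variation, i.e. $|\nu|(G)<\infty$; (iii) there is a Bochner integrable $F_1:G\to L^\Phi(G)$ with $\nu(A)=\int_AF_1\,dm_G$ for every Borel set $A$; (iv) there is a Pettis integrable $F_2:G\to L^\Phi(G)$ with $\nu(A)=\int_AF_2\,dm_G$ (Pettis integral) for every Borel set $A$; (v) there is a Borel set $A$ with $0<|\nu|(A)<\infty$; (vi) there is $f\in L^\Phi(G)$ with $d\mu=f\,dm_G$. Here $F:G\to X$ is Pettis integrable if $\langle F,x'\rangle\in L^1(G)$ for every $x'\in X'$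 and for every Borel set $A$ there is a unique $x_A\in X$ with $\langle x_A,x'\rangle=\int_A\langle F,x'\rangle\,dm_G$ for all $x'\in X'$; then $\int_AF\,dm_G:=x_A$. -/

import Mathlib

open MeasureTheory Filter Topology
open scoped ENNReal NNReal

/-- A Young function: a convex function `Φ : [0, ∞] → [0, ∞]` with `Φ 0 = 0` and
`Φ x → ∞` as `x → ∞` (in particular `Φ ∞ = ∞`). -/
structure YoungFunction where
  toFun : ℝ≥0∞ → ℝ≥0∞
  convex' : ConvexOn ℝ≥0 Set.univ toFun
  map_zero' : toFun 0 = 0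
  tendsto_top' : Tendsto toFun (𝓝 ∞) (𝓝 ∞)

instance YoungFunction.instCoeFun : CoeFun YoungFunction (fun _ => ℝ≥0∞ → ℝ≥0∞) :=
  ⟨YoungFunction.toFun⟩

/-- The complementary function `Ψ y = sup {x y - Φ x : x ≥ 0}`, the supremum being over real `x`.
The term for `x = 0` is `0`, so truncating negative differences at `0` changes nothing. -/
noncomputable def YoungFunction.complementary (Φ : YoungFunction) (y : ℝ≥0∞) : ℝ≥0∞ :=
  ⨆ x : ℝ≥0, ((x : ℝ≥0∞) * y - Φ x)

/-- The `Δ₂`-condition: `Φ` takes finite values at finite arguments, and there are `K > 0` and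
`x₀ > 0` with `Φ (2 x) ≤ K Φ x` for all `x ≥ x₀`. -/
structure IsDeltaTwo (Φ : ℝ≥0∞ → ℝ≥0∞) : Prop where
  finite : ∀ x : ℝ≥0, Φ x ≠ ∞
  doubling : ∃ K x₀ : ℝ≥0, 0 < K ∧ 0 < x₀ ∧ ∀ x : ℝ≥0, x₀ ≤ x → Φ (2 * x) ≤ K * Φ x

namespace YoungFunction

variable (Φ : YoungFunction)

theorem map_zero : Φ 0 = 0 := Φ.map_zero'

theorem map_top : Φ ∞ = ∞ :=
  tendsto_nhds_unique (tendsto_pure_nhds Φ.toFun ∞) (Φ.tendsto_top'.mono_left (pure_le_nhds ∞))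

theorem map_convex_le (a b : ℝ≥0) (hab : a + b = 1) (x y : ℝ≥0∞) :
    Φ (a * x + b * y) ≤ a * Φ x + b * Φ y :=
  Φ.convex'.2 (Set.mem_univ x) (Set.mem_univ y) zero_le zero_le hab

theorem map_mul_le (a : ℝ≥0) (ha : a ≤ 1) (x : ℝ≥0∞) : Φ (a * x) ≤ a * Φ x := by
  have h := Φ.map_convex_le a (1 - a) (add_tsub_cancel_of_le ha) x 0
  simpa [Φ.map_zero] using h

theorem mono : Monotone Φ.toFun := by
  intro x y hxy
  by_cases hy : y = ∞
  · rw [hy, Φ.map_top]; exact le_top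
  by_cases hy0 : y = 0
  · rw [hy0] at hxy ⊢; rw [nonpos_iff_eq_zero.1 hxy]
  lift y to ℝ≥0 using hy
  lift x to ℝ≥0 using ne_top_of_le_ne_top ENNReal.coe_ne_top hxy
  have hy1 : y ≠ 0 := by simpa using hy0
  have hxy1 : x ≤ y := by simpa using hxy
  have ha : x / y ≤ 1 := div_le_one_of_le₀ hxy1 zero_le
  have h := Φ.map_mul_le (x / y) ha y
  rw [← ENNReal.coe_mul, div_mul_cancel₀ x hy1] at h
  refine h.trans ?_
  calc ((x / y : ℝ≥0) : ℝ≥0∞) * Φ y ≤ 1 * Φ y := by gcongr; exact_mod_cast ha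
    _ = Φ y := one_mul _

theorem measurable : Measurable Φ.toFun := Φ.mono.measurable

theorem tendsto_zero (h : ∃ x : ℝ≥0, 0 < x ∧ Φ x ≠ ∞) : Tendsto Φ.toFun (𝓝 0) (𝓝 0) := by
  obtain ⟨c, hc, hΦ⟩ := h
  have hc0 : (c : ℝ≥0∞) ≠ 0 := by simpa using hc.ne'
  have h1 : Tendsto (fun x : ℝ≥0∞ => x / c * Φ c) (𝓝 0) (𝓝 0) := by
    have : Continuous (fun x : ℝ≥0∞ => x / c * Φ c) := by
      simp_rw [div_eq_mul_inv, mul_assoc]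
      exact ENNReal.continuous_mul_const (ENNReal.mul_ne_top (by simp [hc.ne']) hΦ)
    simpa using this.tendsto 0
  refine tendsto_of_tendsto_of_tendsto_of_le_of_le' tendsto_const_nhds h1
    (Eventually.of_forall fun _ => zero_le) ?_
  have : ∀ᶠ x : ℝ≥0∞ in 𝓝 0, x < c := eventually_lt_nhds (by simpa using hc)
  filter_upwards [this] with x hx
  lift x to ℝ≥0 using (hx.trans ENNReal.coe_lt_top).ne
  have hx1 : x ≤ c := by exact_mod_cast hx.le
  have := Φ.map_mul_le (x / c) (div_le_one_of_le₀ hx1 zero_le) c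
  rwa [← ENNReal.coe_mul, div_mul_cancel₀ x hc.ne', ENNReal.coe_div hc.ne'] at this

end YoungFunction

/-- The Luxemburg functional `inf {k > 0 : ∫ Φ (u / k) dm ≤ 1}` (the infimum over finite `k`,
equal to `∞` if there is no such `k`). -/
noncomputable def luxemburg {α : Type*} [MeasurableSpace α] (Φ : YoungFunction) (m : Measure α)
    (u : α → ℝ≥0∞) : ℝ≥0∞ :=
  sInf {k : ℝ≥0∞ | 0 < k ∧ k ≠ ∞ ∧ ∫⁻ x, Φ (u x / k) ∂m ≤ 1}

namespace luxemburg

variable {α : Type*} [MeasurableSpace α] {Φ : YoungFunction} {m : Measure α} {u v : α → ℝ≥0∞}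

theorem aemeasurable_comp_div (hu : AEMeasurable u m) (k : ℝ≥0∞) :
    AEMeasurable (fun x => Φ (u x / k)) m :=
  Φ.measurable.comp_aemeasurable (hu.div_const k)

theorem le_of_lintegral {k : ℝ≥0∞} (hk : 0 < k) (hk' : k ≠ ∞)
    (h : ∫⁻ x, Φ (u x / k) ∂m ≤ 1) : luxemburg Φ m u ≤ k :=
  sInf_le ⟨hk, hk', h⟩

theorem lintegral_le_one {k : ℝ≥0∞} (hk : luxemburg Φ m u < k) :
    ∫⁻ x, Φ (u x / k) ∂m ≤ 1 := by
  obtain ⟨l, ⟨_, _, hl⟩, hlk⟩ := sInf_lt_iff.1 hk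
  refine (lintegral_mono fun x => Φ.mono ?_).trans hl
  exact ENNReal.div_le_div_left hlk.le _

theorem mono_ae (h : u ≤ᵐ[m] v) : luxemburg Φ m u ≤ luxemburg Φ m v := by
  refine sInf_le_sInf fun k hk => ⟨hk.1, hk.2.1, le_trans (lintegral_mono_ae ?_) hk.2.2⟩
  filter_upwards [h] with x hx
  exact Φ.mono (ENNReal.div_le_div_right hx _)

theorem congr_ae (h : u =ᵐ[m] v) : luxemburg Φ m u = luxemburg Φ m v :=
  le_antisymm (mono_ae h.le) (mono_ae h.symm.le)

theorem zero : luxemburg Φ m (fun _ => 0) = 0 := by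
  refine le_antisymm (ENNReal.le_of_forall_pos_le_add fun ε hε _ => ?_) zero_le
  rw [zero_add]
  exact le_of_lintegral (by simpa using hε) ENNReal.coe_ne_top (by simp [Φ.map_zero])

theorem add_le (hu : AEMeasurable u m) :
    luxemburg Φ m (fun x => u x + v x) ≤ luxemburg Φ m u + luxemburg Φ m v := by
  refine ENNReal.le_of_forall_pos_le_add fun ε hε hfin => ?_
  have hU : luxemburg Φ m u ≠ ∞ := (ENNReal.add_ne_top.1 hfin.ne).1
  have hV : luxemburg Φ m v ≠ ∞ := (ENNReal.add_ne_top.1 hfin.ne).2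
  have hε2 : (0 : ℝ≥0) < ε / 2 := half_pos hε
  generalize hU' : luxemburg Φ m u = U at *
  generalize hV' : luxemburg Φ m v = V at *
  lift U to ℝ≥0 using hU
  lift V to ℝ≥0 using hV
  set k : ℝ≥0 := U + ε / 2 with hk
  set l : ℝ≥0 := V + ε / 2 with hl
  have hk0 : 0 < k := by positivity
  have hl0 : 0 < l := by positivity
  have hkl : k + l ≠ 0 := (add_pos hk0 hl0).ne'
  have h1 : ∫⁻ x, Φ (u x / k) ∂m ≤ 1 := lintegral_le_one (by
    rw [hU']; exact_mod_cast lt_add_of_pos_right U hε2)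
  have h2 : ∫⁻ x, Φ (v x / l) ∂m ≤ 1 := lintegral_le_one (by
    rw [hV']; exact_mod_cast lt_add_of_pos_right V hε2)
  have hsum : ((U : ℝ≥0∞) + V + ε) = ((k + l : ℝ≥0) : ℝ≥0∞) := by
    rw [hk, hl]; norm_cast; rw [add_add_add_comm, add_halves]
  rw [hsum]
  refine le_of_lintegral (by simpa using (add_pos hk0 hl0)) ENNReal.coe_ne_top ?_
  have hab : k / (k + l) + l / (k + l) = 1 := by rw [← add_div, div_self hkl]
  have key : ∀ x, Φ ((u x + v x) / ((k + l : ℝ≥0) : ℝ≥0∞)) ≤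
      ((k / (k + l) : ℝ≥0) : ℝ≥0∞) * Φ (u x / k) + ((l / (k + l) : ℝ≥0) : ℝ≥0∞) * Φ (v x / l) := by
    intro x
    refine le_trans (le_of_eq ?_) (Φ.map_convex_le _ _ hab _ _)
    congr 1
    have aux : ∀ (a : ℝ≥0) (w : ℝ≥0∞), 0 < a →
        ((a / (k + l) : ℝ≥0) : ℝ≥0∞) * (w / a) = w / ((k + l : ℝ≥0) : ℝ≥0∞) := by
      intro a w ha
      rw [ENNReal.coe_div hkl, div_eq_mul_inv, div_eq_mul_inv, div_eq_mul_inv]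
      have : (a : ℝ≥0∞) * (a : ℝ≥0∞)⁻¹ = 1 :=
        ENNReal.mul_inv_cancel (by simpa using ha.ne') ENNReal.coe_ne_top
      calc (a : ℝ≥0∞) * ((k + l : ℝ≥0) : ℝ≥0∞)⁻¹ * (w * (a : ℝ≥0∞)⁻¹)
          = ((a : ℝ≥0∞) * (a : ℝ≥0∞)⁻¹) * (w * ((k + l : ℝ≥0) : ℝ≥0∞)⁻¹) := by ring
        _ = _ := by rw [this, one_mul]
    rw [aux k _ hk0, aux l _ hl0, ENNReal.add_div]
  calc ∫⁻ x, Φ ((u x + v x) / ((k + l : ℝ≥0) : ℝ≥0∞)) ∂m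
      ≤ ∫⁻ x, (((k / (k + l) : ℝ≥0) : ℝ≥0∞) * Φ (u x / k) +
          ((l / (k + l) : ℝ≥0) : ℝ≥0∞) * Φ (v x / l)) ∂m := lintegral_mono key
    _ = ((k / (k + l) : ℝ≥0) : ℝ≥0∞) * ∫⁻ x, Φ (u x / k) ∂m +
          ((l / (k + l) : ℝ≥0) : ℝ≥0∞) * ∫⁻ x, Φ (v x / l) ∂m := by
        rw [lintegral_add_left' ((aemeasurable_comp_div hu _).const_mul _),
          lintegral_const_mul' _ _ ENNReal.coe_ne_top, lintegral_const_mul' _ _ ENNReal.coe_ne_top]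
    _ ≤ ((k / (k + l) : ℝ≥0) : ℝ≥0∞) * 1 + ((l / (k + l) : ℝ≥0) : ℝ≥0∞) * 1 := by gcongr
    _ = 1 := by rw [mul_one, mul_one]; exact_mod_cast hab

theorem const_mul_le (c : ℝ≥0) : luxemburg Φ m (fun x => c * u x) ≤ c * luxemburg Φ m u := by
  by_cases hc : c = 0
  · simp [hc, zero]
  have hc' : (c : ℝ≥0∞) ≠ 0 := by simpa using hc
  rw [mul_comm, ← ENNReal.div_le_iff_le_mul (Or.inl hc') (Or.inl ENNReal.coe_ne_top)]
  refine le_sInf fun k hk => ?_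
  rw [ENNReal.div_le_iff_le_mul (Or.inl hc') (Or.inl ENNReal.coe_ne_top), mul_comm]
  refine le_of_lintegral (ENNReal.mul_pos hc' hk.1.ne')
    (ENNReal.mul_ne_top ENNReal.coe_ne_top hk.2.1) ?_
  have : ∀ x, (c : ℝ≥0∞) * u x / (c * k) = u x / k := fun x =>
    ENNReal.mul_div_mul_left _ _ hc' ENNReal.coe_ne_top
  simpa only [this] using hk.2.2

theorem const_mul (c : ℝ≥0) : luxemburg Φ m (fun x => c * u x) = c * luxemburg Φ m u := by
  by_cases hc : c = 0
  · simp [hc, zero]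
  refine le_antisymm (const_mul_le c) ?_
  have hc' : (c : ℝ≥0∞) ≠ 0 := by simpa using hc
  have h := const_mul_le (Φ := Φ) (m := m) (u := fun x => c * u x) c⁻¹
  have h2 : ∀ x, ((c⁻¹ : ℝ≥0) : ℝ≥0∞) * (c * u x) = u x := fun x => by
    rw [← mul_assoc, ← ENNReal.coe_mul, inv_mul_cancel₀ hc]; simp
  simp only [h2] at h
  calc (c : ℝ≥0∞) * luxemburg Φ m u
      ≤ c * (((c⁻¹ : ℝ≥0) : ℝ≥0∞) * luxemburg Φ m (fun x => c * u x)) := by gcongr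
    _ = _ := by rw [← mul_assoc, ← ENNReal.coe_mul, mul_inv_cancel₀ hc]; simp

theorem ae_eq_zero (hu : AEMeasurable u m) (h : luxemburg Φ m u = 0) : u =ᵐ[m] 0 := by
  have h1 : ∀ n : ℕ, ∫⁻ x, Φ (u x * (n + 1)) ∂m ≤ 1 := by
    intro n
    have := lintegral_le_one (Φ := Φ) (m := m) (u := u) (k := ((n + 1 : ℕ) : ℝ≥0∞)⁻¹)
      (by rw [h]; exact ENNReal.inv_pos.2 (ENNReal.natCast_ne_top _))
    simpa [div_eq_mul_inv] using this
  have hm : ∀ n : ℕ, AEMeasurable (fun x => Φ (u x * (n + 1))) m := fun n =>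
    Φ.measurable.comp_aemeasurable (hu.mul_const _)
  have h2 : ∫⁻ x, (⨆ n : ℕ, Φ (u x * (n + 1))) ∂m ≤ 1 := by
    rw [lintegral_iSup' hm]
    · exact iSup_le h1
    · refine Eventually.of_forall fun x => fun i j hij => Φ.mono ?_
      gcongr
  have h3 : ∀ᵐ x ∂m, (⨆ n : ℕ, Φ (u x * (n + 1))) < ∞ :=
    ae_lt_top' (AEMeasurable.iSup hm) (ne_top_of_le_ne_top ENNReal.one_ne_top h2)
  filter_upwards [h3] with x hx
  by_contra hne
  have hne' : u x ≠ 0 := hne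
  have ht : Tendsto (fun n : ℕ => u x * ((n : ℝ≥0∞) + 1)) atTop (𝓝 ∞) := by
    have h4 : Tendsto (fun n : ℕ => ((n : ℝ≥0∞) + 1)) atTop (𝓝 ∞) := by
      refine tendsto_nhds_top_mono ENNReal.tendsto_nat_nhds_top (Eventually.of_forall fun n => ?_)
      exact le_self_add
    have := ENNReal.Tendsto.const_mul (a := u x) h4 (Or.inl ENNReal.top_ne_zero)
    rwa [ENNReal.mul_top hne'] at this
  have h5 := le_of_tendsto' (Φ.tendsto_top'.comp ht)
    (fun n => le_iSup (fun n : ℕ => Φ (u x * (n + 1))) n)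
  exact absurd (top_le_iff.1 h5) hx.ne

theorem ae_lt_top (hu : AEMeasurable u m) (h : luxemburg Φ m u ≠ ∞) : ∀ᵐ x ∂m, u x < ∞ := by
  obtain ⟨k, ⟨hk0, hk1, hk⟩, _⟩ := sInf_lt_iff.1 (lt_top_iff_ne_top.2 h)
  have := ae_lt_top' (aemeasurable_comp_div hu k)
    (ne_top_of_le_ne_top ENNReal.one_ne_top hk)
  filter_upwards [this] with x hx
  refine lt_top_iff_ne_top.2 fun hx' => ?_
  rw [hx', ENNReal.top_div_of_ne_top hk1, Φ.map_top] at hx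
  exact lt_irrefl _ hx

theorem iSup_le_of_monotone {w : ℕ → α → ℝ≥0∞} (hw : ∀ n, AEMeasurable (w n) m)
    (hmono : ∀ x, Monotone fun n => w n x) {C : ℝ≥0∞} (hC : ∀ n, luxemburg Φ m (w n) ≤ C) :
    luxemburg Φ m (fun x => ⨆ n, w n x) ≤ C := by
  refine ENNReal.le_of_forall_pos_le_add fun ε hε hfin => ?_
  lift C to ℝ≥0 using hfin.ne
  have hε2 : (0 : ℝ≥0) < ε / 2 := half_pos hε
  set k : ℝ≥0 := C + ε / 2 with hk
  have hkpos : 0 < k := by positivity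
  have hlt : k < C + ε := by rw [hk]; gcongr; exact half_lt_self hε
  have h1 : ∀ n, ∫⁻ x, Φ (w n x / k) ∂m ≤ 1 := fun n => lintegral_le_one
    ((hC n).trans_lt (by exact_mod_cast lt_add_of_pos_right C hε2))
  have h2 : ∫⁻ x, ⨆ n, Φ (w n x / k) ∂m ≤ 1 := by
    rw [lintegral_iSup' (fun n => aemeasurable_comp_div (hw n) _)]
    · exact iSup_le h1
    · exact Eventually.of_forall fun x i j hij => Φ.mono (ENNReal.div_le_div_right (hmono x hij) _)
  have hpos : (0 : ℝ≥0) < C + ε := hkpos.trans hlt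
  rw [← ENNReal.coe_add]
  refine le_of_lintegral (by simpa using hpos) ENNReal.coe_ne_top
    (le_trans (lintegral_mono fun x => ?_) h2)
  by_cases h0 : (⨆ n, w n x) = 0
  · simp [h0, Φ.map_zero]
  by_cases htop : (⨆ n, w n x) = ∞
  · rw [htop, ENNReal.top_div_of_ne_top ENNReal.coe_ne_top, Φ.map_top]
    have ht : Tendsto (fun n => w n x / (k : ℝ≥0∞)) atTop (𝓝 ∞) := by
      have := (tendsto_atTop_iSup (hmono x))
      rw [htop] at this
      have h3 := ENNReal.Tendsto.div_const (b := (k : ℝ≥0∞)) this (Or.inl ENNReal.top_ne_zero)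
      rwa [ENNReal.top_div_of_ne_top ENNReal.coe_ne_top] at h3
    exact le_of_tendsto' (Φ.tendsto_top'.comp ht) (fun n => le_iSup (fun n => Φ (w n x / k)) n)
  · have h3 : (⨆ n, w n x) / ((C + ε : ℝ≥0) : ℝ≥0∞) * k < ⨆ n, w n x := by
      rw [mul_comm, ← mul_div_assoc]
      refine ENNReal.div_lt_of_lt_mul' ?_
      refine ENNReal.mul_lt_mul_left h0 htop ?_ 
      exact_mod_cast hlt
    obtain ⟨n, hn⟩ := lt_iSup_iff.1 h3
    refine le_trans (Φ.mono ?_) (le_iSup (fun n => Φ (w n x / k)) n)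
    rw [ENNReal.le_div_iff_mul_le (Or.inl (by simpa using hkpos.ne')) (Or.inl ENNReal.coe_ne_top)]
    exact hn.le

theorem tsum_le {w : ℕ → α → ℝ≥0∞} (hw : ∀ n, AEMeasurable (w n) m) :
    luxemburg Φ m (fun x => ∑' n, w n x) ≤ ∑' n, luxemburg Φ m (w n) := by
  have hS : ∀ n, AEMeasurable (fun x => ∑ i ∈ Finset.range n, w i x) m := fun n =>
    Finset.aemeasurable_fun_sum _ fun i _ => hw i
  have h1 : ∀ n, luxemburg Φ m (fun x => ∑ i ∈ Finset.range n, w i x) ≤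
      ∑ i ∈ Finset.range n, luxemburg Φ m (w i) := by
    intro n
    induction n with
    | zero => simp [zero]
    | succ n ih =>
      simp only [Finset.sum_range_succ]
      exact (add_le (hS n)).trans (by gcongr)
  simp_rw [ENNReal.tsum_eq_iSup_nat]
  refine iSup_le_of_monotone hS (fun x i j hij => ?_) (fun n => (h1 n).trans ?_)
  · exact Finset.sum_le_sum_of_subset (Finset.range_mono hij)
  · exact le_iSup (fun n => ∑ i ∈ Finset.range n, luxemburg Φ m (w i)) n

end luxemburg

/-- The Orlicz space `L^Φ(m)` of (classes of almost everywhere equal) complex measurable functions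
with finite Luxemburg norm. -/
noncomputable def OrliczSpace {α : Type*} [MeasurableSpace α] (Φ : YoungFunction) (m : Measure α) :
    Submodule ℂ (α →ₘ[m] ℂ) where
  carrier := {f | luxemburg Φ m (fun x => ‖f x‖ₑ) ≠ ∞}
  zero_mem' := by
    have : luxemburg Φ m (fun x => ‖(0 : α →ₘ[m] ℂ) x‖ₑ) = 0 := by
      rw [← luxemburg.zero (Φ := Φ) (m := m)]
      refine luxemburg.congr_ae ?_
      filter_upwards [AEEqFun.coeFn_zero (μ := m) (β := ℂ)] with x hx
      simp [hx]
    simp [this]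
  add_mem' := by
    intro f g hf hg
    refine ne_top_of_le_ne_top (ENNReal.add_ne_top.2 ⟨hf, hg⟩) (le_trans (luxemburg.mono_ae ?_)
      (luxemburg.add_le f.aestronglyMeasurable.enorm))
    filter_upwards [AEEqFun.coeFn_add f g] with x hx
    rw [hx]
    exact enorm_add_le _ _
  smul_mem' := by
    intro c f hf
    have : luxemburg Φ m (fun x => ‖(c • f) x‖ₑ) = ‖c‖₊ * luxemburg Φ m (fun x => ‖f x‖ₑ) := by
      rw [← luxemburg.const_mul]
      refine luxemburg.congr_ae ?_
      filter_upwards [AEEqFun.coeFn_smul c f] with x hx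
      rw [hx, Pi.smul_apply, enorm_smul, enorm_eq_nnnorm c]
    change _ ≠ _
    rw [this]
    exact ENNReal.mul_ne_top ENNReal.coe_ne_top hf

namespace OrliczSpace

variable {α : Type*} [MeasurableSpace α] {Φ : YoungFunction} {m : Measure α}

/-- The Luxemburg norm. -/
noncomputable instance instNorm : Norm (OrliczSpace Φ m) :=
  ⟨fun f => (luxemburg Φ m (fun x => ‖(f : α →ₘ[m] ℂ) x‖ₑ)).toReal⟩

theorem norm_def (f : OrliczSpace Φ m) :
    ‖f‖ = (luxemburg Φ m (fun x => ‖(f : α →ₘ[m] ℂ) x‖ₑ)).toReal := rfl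

theorem ofReal_norm (f : OrliczSpace Φ m) :
    ENNReal.ofReal ‖f‖ = luxemburg Φ m (fun x => ‖(f : α →ₘ[m] ℂ) x‖ₑ) :=
  ENNReal.ofReal_toReal f.2

theorem normCore : NormedSpace.Core ℂ (OrliczSpace Φ m) where
  norm_nonneg f := ENNReal.toReal_nonneg
  norm_smul c f := by
    have : luxemburg Φ m (fun x => ‖((c • f : OrliczSpace Φ m) : α →ₘ[m] ℂ) x‖ₑ) =
        ‖c‖₊ * luxemburg Φ m (fun x => ‖(f : α →ₘ[m] ℂ) x‖ₑ) := by
      rw [← luxemburg.const_mul]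
      refine luxemburg.congr_ae ?_
      filter_upwards [AEEqFun.coeFn_smul c (f : α →ₘ[m] ℂ)] with x hx
      rw [Submodule.coe_smul, hx, Pi.smul_apply, enorm_smul, enorm_eq_nnnorm c]
    rw [norm_def, this, ENNReal.toReal_mul, norm_def]
    simp
  norm_triangle f g := by
    rw [norm_def, norm_def, norm_def, ← ENNReal.toReal_add f.2 g.2]
    refine ENNReal.toReal_mono (ENNReal.add_ne_top.2 ⟨f.2, g.2⟩) (le_trans (luxemburg.mono_ae ?_)
      (luxemburg.add_le (f : α →ₘ[m] ℂ).aestronglyMeasurable.enorm))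
    filter_upwards [AEEqFun.coeFn_add (f : α →ₘ[m] ℂ) (g : α →ₘ[m] ℂ)] with x hx
    rw [Submodule.coe_add, hx]
    exact enorm_add_le _ _
  norm_eq_zero_iff f := by
    constructor
    · intro h
      rw [norm_def, ENNReal.toReal_eq_zero_iff, or_iff_left f.2] at h
      have h1 := luxemburg.ae_eq_zero (f : α →ₘ[m] ℂ).aestronglyMeasurable.enorm h
      refine Subtype.ext (AEEqFun.ext ?_)
      filter_upwards [h1, AEEqFun.coeFn_zero (μ := m) (β := ℂ)] with x hx hx0
      rw [Submodule.coe_zero, hx0]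
      simpa using hx
    · rintro rfl
      have : luxemburg Φ m (fun x => ‖((0 : OrliczSpace Φ m) : α →ₘ[m] ℂ) x‖ₑ) = 0 := by
        rw [← luxemburg.zero (Φ := Φ) (m := m)]
        refine luxemburg.congr_ae ?_
        filter_upwards [AEEqFun.coeFn_zero (μ := m) (β := ℂ)] with x hx
        simp [hx]
      rw [norm_def, this, ENNReal.toReal_zero]

noncomputable instance instNormedAddCommGroup : NormedAddCommGroup (OrliczSpace Φ m) :=
  NormedAddCommGroup.ofCore normCore

noncomputable instance instNormedSpace : NormedSpace ℂ (OrliczSpace Φ m) :=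
  NormedSpace.ofCore normCore

/-- The element of `L^Φ(m)` given by a function with finite Luxemburg norm. -/
noncomputable def mk (f : α → ℂ) (hf : AEStronglyMeasurable f m)
    (h : luxemburg Φ m (fun x => ‖f x‖ₑ) ≠ ∞) : OrliczSpace Φ m :=
  ⟨AEEqFun.mk f hf, by
    have : luxemburg Φ m (fun x => ‖AEEqFun.mk f hf x‖ₑ) = luxemburg Φ m (fun x => ‖f x‖ₑ) := by
      refine luxemburg.congr_ae ?_
      filter_upwards [AEEqFun.coeFn_mk f hf] with x hx
      rw [hx]
    change _ ≠ _
    rwa [this]⟩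

theorem coe_mk (f : α → ℂ) (hf : AEStronglyMeasurable f m)
    (h : luxemburg Φ m (fun x => ‖f x‖ₑ) ≠ ∞) :
    ((mk f hf h : OrliczSpace Φ m) : α →ₘ[m] ℂ) =ᵐ[m] f :=
  AEEqFun.coeFn_mk f hf

theorem coe_sum {ι : Type*} (s : Finset ι) (u : ι → OrliczSpace Φ m) :
    ((∑ i ∈ s, u i : OrliczSpace Φ m) : α →ₘ[m] ℂ) =ᵐ[m]
      fun x => ∑ i ∈ s, (u i : α →ₘ[m] ℂ) x := by
  classical
  induction s using Finset.induction_on with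
  | empty =>
    filter_upwards [AEEqFun.coeFn_zero (μ := m) (β := ℂ)] with x hx
    simp [hx]
  | insert i s hi ih =>
    filter_upwards [ih, AEEqFun.coeFn_add (u i : α →ₘ[m] ℂ)
      ((∑ i ∈ s, u i : OrliczSpace Φ m) : α →ₘ[m] ℂ)] with x hx hx2
    rw [Finset.sum_insert hi, Finset.sum_insert hi, Submodule.coe_add, hx2, Pi.add_apply, hx]

theorem ofReal_norm_sub_le {f g : OrliczSpace Φ m} {w : α → ℝ≥0∞}
    (h : ∀ᵐ x ∂m, ‖(f : α →ₘ[m] ℂ) x - (g : α →ₘ[m] ℂ) x‖ₑ ≤ w x) :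
    ENNReal.ofReal ‖f - g‖ ≤ luxemburg Φ m w := by
  rw [ofReal_norm]
  refine luxemburg.mono_ae ?_
  filter_upwards [h, AEEqFun.coeFn_sub (f : α →ₘ[m] ℂ) (g : α →ₘ[m] ℂ)] with x hx hx2
  rw [Submodule.coe_sub, hx2]
  exact hx

instance instCompleteSpace : CompleteSpace (OrliczSpace Φ m) := by
  refine NormedAddCommGroup.completeSpace_of_summable_imp_tendsto fun u hu => ?_
  set w : ℕ → α → ℝ≥0∞ := fun n x => ‖(u n : α →ₘ[m] ℂ) x‖ₑ with hw
  have hwm : ∀ n, AEMeasurable (w n) m := fun n =>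
    (u n : α →ₘ[m] ℂ).aestronglyMeasurable.enorm
  have hN : ∑' n, luxemburg Φ m (w n) ≠ ∞ := by
    have := hu.tsum_ofReal_ne_top
    simpa only [ofReal_norm] using this
  have htop : luxemburg Φ m (fun x => ∑' n, w n x) ≠ ∞ :=
    ne_top_of_le_ne_top hN (luxemburg.tsum_le hwm)
  have hae : ∀ᵐ x ∂m, ∑' n, w n x < ∞ :=
    luxemburg.ae_lt_top (AEMeasurable.tsum hwm) htop
  have hsum : ∀ᵐ x ∂m, Summable fun n => (u n : α →ₘ[m] ℂ) x := by
    filter_upwards [hae] with x hx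
    refine Summable.of_norm ?_
    have := ENNReal.summable_toReal hx.ne
    simpa [hw] using this
  have hgm : AEStronglyMeasurable (fun x => ∑' n, (u n : α →ₘ[m] ℂ) x) m := by
    refine aestronglyMeasurable_of_tendsto_ae atTop
      (f := fun n x => ∑ i ∈ Finset.range n, (u i : α →ₘ[m] ℂ) x) (fun n => ?_) ?_
    · exact Finset.aestronglyMeasurable_fun_sum _ fun i _ =>
        (u i : α →ₘ[m] ℂ).aestronglyMeasurable
    · filter_upwards [hsum] with x hx
      exact hx.hasSum.tendsto_sum_nat
  have hgle : ∀ᵐ x ∂m, ‖∑' n, (u n : α →ₘ[m] ℂ) x‖ₑ ≤ ∑' n, w n x :=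
    Eventually.of_forall fun x => enorm_tsum_le_tsum_enorm
  refine ⟨mk _ hgm (ne_top_of_le_ne_top htop (luxemburg.mono_ae hgle)), ?_⟩
  have htail : Tendsto (fun n => ∑' i, luxemburg Φ m (w (i + n))) atTop (𝓝 0) :=
    ENNReal.tendsto_sum_nat_add _ hN
  rw [tendsto_iff_norm_sub_tendsto_zero]
  have h0 : Tendsto (fun n => ENNReal.ofReal ‖(∑ i ∈ Finset.range n, u i) - mk _ hgm
      (ne_top_of_le_ne_top htop (luxemburg.mono_ae hgle))‖) atTop (𝓝 0) := by
    refine tendsto_of_tendsto_of_tendsto_of_le_of_le tendsto_const_nhds htail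
      (fun _ => zero_le) (fun n => ?_)
    refine le_trans (ofReal_norm_sub_le (w := fun x => ∑' i, w (i + n) x) ?_)
      (luxemburg.tsum_le fun i => hwm _)
    filter_upwards [hsum, coe_sum (Finset.range n) u, coe_mk _ hgm
      (ne_top_of_le_ne_top htop (luxemburg.mono_ae hgle))] with x hx hx1 hx2
    rw [hx1, hx2, ← hx.sum_add_tsum_nat_add n, sub_add_cancel_left, enorm_neg]
    exact enorm_tsum_le_tsum_enorm
  have := (ENNReal.tendsto_toReal ENNReal.zero_ne_top).comp h0
  simpa [Function.comp_def] using this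

end OrliczSpace

/-- The integral `∫ f dσ` of a complex function against a complex measure. -/
noncomputable def complexIntegral {Ω : Type*} [MeasurableSpace Ω] (σ : ComplexMeasure Ω)
    (f : Ω → ℂ) : ℂ :=
  VectorMeasure.integral σ f (ContinuousLinearMap.mul ℝ ℂ)

namespace VectorIntegration

variable {Ω : Type*} [MeasurableSpace Ω]

theorem complexIntegral_add {σ : ComplexMeasure Ω} {f g : Ω → ℂ} (hf : σ.Integrable f)
    (hg : σ.Integrable g) :
    complexIntegral σ (f + g) = complexIntegral σ f + complexIntegral σ g :=
  VectorMeasure.integral_add hf hg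

theorem complexIntegral_smul {σ : ComplexMeasure Ω} {f : Ω → ℂ} (hf : σ.Integrable f) (c : ℂ) :
    complexIntegral σ (c • f) = c * complexIntegral σ f := by
  have h1 := VectorMeasure.integral_continuousLinearMap_comp (μ := σ) (f := f)
    (B := ContinuousLinearMap.mul ℝ ℂ) (C := ContinuousLinearMap.mul ℝ ℂ c) hf
  have h2 := VectorMeasure.continuousLinearMap_apply_integral (μ := σ) (f := f)
    (B := ContinuousLinearMap.mul ℝ ℂ) (C := ContinuousLinearMap.mul ℝ ℂ c) hf
  refine (h1.trans ?_).trans h2.symm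
  congr 1
  ext x y
  exact mul_assoc c x y

theorem enorm_integral_le {E F G : Type*} [NormedAddCommGroup E] [NormedSpace ℝ E] [Nontrivial E]
    [NormedAddCommGroup F] [NormedSpace ℝ F] [NormedAddCommGroup G] [NormedSpace ℝ G]
    (B : E →L[ℝ] F →L[ℝ] G) (hB : ∀ x y, ‖B x y‖₊ = ‖x‖₊ * ‖y‖₊) (σ : VectorMeasure Ω F)
    (f : Ω → E) : ‖VectorMeasure.integral σ f B‖ₑ ≤ ∫⁻ ω, ‖f ω‖ₑ ∂σ.variation := by
  have := VectorMeasure.enorm_integral_le_lintegral_enorm_transpose (μ := σ) (f := f) (B := B)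
  rwa [VectorMeasure.variation_transpose_eq _ _ hB] at this

theorem variation_withDensity_eq {E F G : Type*} [NormedAddCommGroup E] [NormedSpace ℝ E]
    [Nontrivial E] [NormedAddCommGroup F] [NormedSpace ℝ F] [NormedAddCommGroup G] [NormedSpace ℝ G]
    [CompleteSpace G] (B : E →L[ℝ] F →L[ℝ] G) (hB : ∀ x y, ‖B x y‖₊ = ‖x‖₊ * ‖y‖₊)
    {σ : VectorMeasure Ω F} {f : Ω → E} (hf : σ.Integrable f) :
    (σ.withDensity f B).variation = σ.variation.withDensity (fun x => ‖f x‖ₑ) := by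
  rw [VectorMeasure.variation_withDensity hf hB, VectorMeasure.variation_transpose_eq _ _ hB]

theorem enorm_complexIntegral_le (σ : ComplexMeasure Ω) (f : Ω → ℂ) :
    ‖complexIntegral σ f‖ₑ ≤ ∫⁻ ω, ‖f ω‖ₑ ∂σ.variation :=
  enorm_integral_le _ (fun x y => by simp [nnnorm_mul]) σ f

theorem signed_variation_univ_le {σ : SignedMeasure Ω} {C : ℝ≥0∞}
    (h : ∀ A, MeasurableSet A → ‖σ A‖ₑ ≤ C) : σ.variation Set.univ ≤ 2 * C := by
  refine le_of_forall_lt fun a ha => ?_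
  obtain ⟨t, _, ht, hat⟩ :=
    SignedMeasure.exists_subset_lt_enorm_apply_of_lt_variation σ MeasurableSet.univ ha
  exact hat.trans_le (by gcongr; exact h t ht)

theorem complex_variation_le (σ : ComplexMeasure Ω) :
    σ.variation ≤ (ComplexMeasure.re σ).variation + (ComplexMeasure.im σ).variation := by
  refine VectorMeasure.variation_le_of_forall_enorm_le fun A hA => ?_
  have h1 : ‖σ A‖ₑ ≤ ‖(ComplexMeasure.re σ) A‖ₑ + ‖(ComplexMeasure.im σ) A‖ₑ := by
    have h0 : ‖σ A‖ ≤ |(σ A).re| + |(σ A).im| := Complex.norm_le_abs_re_add_abs_im _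
    rw [← ofReal_norm, ← ofReal_norm, ← ofReal_norm,
      ← ENNReal.ofReal_add (norm_nonneg _) (norm_nonneg _)]
    exact ENNReal.ofReal_le_ofReal h0
  refine h1.trans ?_
  rw [Measure.add_apply]
  exact add_le_add (VectorMeasure.enorm_measure_le_variation _ _)
    (VectorMeasure.enorm_measure_le_variation _ _)

theorem complex_variation_univ_le {σ : ComplexMeasure Ω} {C : ℝ≥0∞}
    (h : ∀ A, MeasurableSet A → ‖σ A‖ₑ ≤ C) : σ.variation Set.univ ≤ 2 * C + 2 * C := by
  refine (complex_variation_le σ Set.univ).trans ?_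
  rw [Measure.add_apply]
  refine add_le_add (signed_variation_univ_le fun A hA => le_trans ?_ (h A hA))
    (signed_variation_univ_le fun A hA => le_trans ?_ (h A hA))
  · rw [← ofReal_norm, ← ofReal_norm]
    exact ENNReal.ofReal_le_ofReal (Complex.abs_re_le_norm _)
  · rw [← ofReal_norm, ← ofReal_norm]
    exact ENNReal.ofReal_le_ofReal (Complex.abs_im_le_norm _)

theorem lintegral_variation_le {σ : ComplexMeasure Ω} {f : Ω → ℂ} (hf : σ.Integrable f) {C : ℝ≥0∞}
    (h : ∀ A, MeasurableSet A → ‖complexIntegral (σ.restrict A) f‖ₑ ≤ C) :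
    ∫⁻ ω, ‖f ω‖ₑ ∂σ.variation ≤ 2 * C + 2 * C := by
  have h1 : (σ.withDensity f (ContinuousLinearMap.mul ℝ ℂ)).variation Set.univ ≤ 2 * C + 2 * C :=
    complex_variation_univ_le fun A hA => by
      rw [VectorMeasure.withDensity_apply hf]
      exact h A hA
  rwa [variation_withDensity_eq _ (fun x y => by simp [nnnorm_mul]) hf,
    withDensity_apply _ MeasurableSet.univ, Measure.restrict_univ] at h1

variable {X : Type*} [NormedAddCommGroup X] [NormedSpace ℂ X]

/-- The scalar measure `⟨ν, x'⟩ : A ↦ ⟨ν A, x'⟩` of a vector measure `ν` and a functional `x'`. -/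
noncomputable def scalarMeasure (ν : VectorMeasure Ω X) (x' : StrongDual ℂ X) : ComplexMeasure Ω :=
  ν.mapRange (x' : X →ₗ[ℂ] ℂ).toAddMonoidHom x'.continuous

/-- `x` is the integral of `f` over `A` with respect to the vector measure `ν`, in the weak sense:
`∫_A f d⟨ν, x'⟩ = ⟨x, x'⟩` for every functional `x'`. -/
def HasVectorIntegral (ν : VectorMeasure Ω X) (f : Ω → ℂ) (A : Set Ω) (x : X) : Prop :=
  ∀ x' : StrongDual ℂ X, complexIntegral ((scalarMeasure ν x').restrict A) f = x' x

/-- Integrability of a scalar function with respect to a vector measure: `f` belongs to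
`L¹(|⟨ν, x'⟩|)` for every functional `x'`, and has a unique integral over every measurable set. -/
structure IsVectorIntegrable (ν : VectorMeasure Ω X) (f : Ω → ℂ) : Prop where
  measurable : Measurable f
  weakly : ∀ x' : StrongDual ℂ X, Integrable f (scalarMeasure ν x').variation
  existsUnique : ∀ A : Set Ω, MeasurableSet A → ∃! x : X, HasVectorIntegral ν f A x

/-- `‖f‖_ν = sup {∫ |f| d|⟨ν, x'⟩| : ‖x'‖ ≤ 1}`. -/
noncomputable def vectorL1Norm (ν : VectorMeasure Ω X) (f : Ω → ℂ) : ℝ≥0∞ :=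
  ⨆ x' : {x' : StrongDual ℂ X // ‖x'‖ ≤ 1}, ∫⁻ ω, ‖f ω‖ₑ ∂(scalarMeasure ν x').variation

variable {ν : VectorMeasure Ω X}

theorem HasVectorIntegral.unique {f : Ω → ℂ} {A : Set Ω} {x y : X}
    (hx : HasVectorIntegral ν f A x) (hy : HasVectorIntegral ν f A y) : x = y :=
  (SeparatingDual.eq_iff_forall_dual_eq (R := ℂ)).2 fun x' => (hx x').symm.trans (hy x')

theorem isVectorIntegrable_zero : IsVectorIntegrable ν 0 where
  measurable := measurable_zero
  weakly _ := integrable_zero _ _ _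
  existsUnique A _ := by
    have h : HasVectorIntegral ν (0 : Ω → ℂ) A 0 := fun x' => by
      rw [_root_.map_zero]
      exact VectorMeasure.integral_zero
    exact ⟨0, h, fun y hy => hy.unique h⟩

theorem HasVectorIntegral.add {f g : Ω → ℂ} (hf : IsVectorIntegrable ν f)
    (hg : IsVectorIntegrable ν g) {A : Set Ω} {x y : X} (hx : HasVectorIntegral ν f A x)
    (hy : HasVectorIntegral ν g A y) : HasVectorIntegral ν (f + g) A (x + y) := fun x' => by
  rw [complexIntegral_add (VectorMeasure.Integrable.restrict (hf.weakly x'))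
    (VectorMeasure.Integrable.restrict (hg.weakly x')), hx x', hy x', _root_.map_add]

theorem HasVectorIntegral.smul {f : Ω → ℂ} (hf : IsVectorIntegrable ν f) (c : ℂ) {A : Set Ω}
    {x : X} (hx : HasVectorIntegral ν f A x) : HasVectorIntegral ν (c • f) A (c • x) := fun x' => by
  rw [complexIntegral_smul (VectorMeasure.Integrable.restrict (hf.weakly x')), hx x', map_smul,
    smul_eq_mul]

theorem IsVectorIntegrable.add {f g : Ω → ℂ} (hf : IsVectorIntegrable ν f)
    (hg : IsVectorIntegrable ν g) : IsVectorIntegrable ν (f + g) where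
  measurable := hf.measurable.add hg.measurable
  weakly x' := (hf.weakly x').add (hg.weakly x')
  existsUnique A hA := by
    obtain ⟨x, hx, _⟩ := hf.existsUnique A hA
    obtain ⟨y, hy, _⟩ := hg.existsUnique A hA
    exact ⟨x + y, hx.add hf hg hy, fun z hz => HasVectorIntegral.unique hz (hx.add hf hg hy)⟩

theorem IsVectorIntegrable.smul {f : Ω → ℂ} (hf : IsVectorIntegrable ν f) (c : ℂ) :
    IsVectorIntegrable ν (c • f) where
  measurable := hf.measurable.const_smul c
  weakly x' := (hf.weakly x').smul c
  existsUnique A hA := by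
    obtain ⟨x, hx, _⟩ := hf.existsUnique A hA
    exact ⟨c • x, hx.smul hf c, fun z hz => HasVectorIntegral.unique hz (hx.smul hf c)⟩

theorem vectorL1Norm_ne_top {f : Ω → ℂ} (hf : IsVectorIntegrable ν f) : vectorL1Norm ν f ≠ ∞ := by
  choose x hx _ using fun A : {A : Set Ω // MeasurableSet A} => hf.existsUnique A.1 A.2
  obtain ⟨C, hC⟩ := banach_steinhaus (g := fun A => NormedSpace.inclusionInDoubleDual ℂ X (x A))
    (fun x' => by
      refine ⟨(∫⁻ ω, ‖f ω‖ₑ ∂(scalarMeasure ν x').variation).toReal, fun A => ?_⟩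
      have h1 := enorm_complexIntegral_le ((scalarMeasure ν x').restrict A) f
      have h2 : ‖x' (x A)‖ₑ ≤ ∫⁻ ω, ‖f ω‖ₑ ∂(scalarMeasure ν x').variation := by
        rw [← hx A x']
        refine h1.trans (lintegral_mono' ?_ le_rfl)
        exact VectorMeasure.variation_restrict_le.trans Measure.restrict_le_self
      have h3 := ENNReal.toReal_mono (hf.weakly x').2.ne h2
      simpa using h3)
  refine ne_top_of_le_ne_top (b := 2 * ENNReal.ofReal C + 2 * ENNReal.ofReal C) ?_
    (iSup_le fun x' => lintegral_variation_le (hf.weakly x') fun A hA => ?_)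
  · simp [ENNReal.mul_eq_top]
  · rw [hx ⟨A, hA⟩ x', ← ofReal_norm]
    refine ENNReal.ofReal_le_ofReal ?_
    have h4 := (NormedSpace.inclusionInDoubleDual ℂ X (x ⟨A, hA⟩)).le_opNorm x'
    have h5 : ‖NormedSpace.inclusionInDoubleDual ℂ X (x ⟨A, hA⟩)‖ * ‖(x' : StrongDual ℂ X)‖ ≤ C :=
      (mul_le_of_le_one_right (norm_nonneg _) x'.2).trans (hC _)
    exact h4.trans h5

theorem vectorL1Norm_add_le {f g : Ω → ℂ} (hf : Measurable f) :
    vectorL1Norm ν (f + g) ≤ vectorL1Norm ν f + vectorL1Norm ν g := by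
  refine iSup_le fun x' => ?_
  calc ∫⁻ ω, ‖(f + g) ω‖ₑ ∂(scalarMeasure ν x').variation
      ≤ ∫⁻ ω, (‖f ω‖ₑ + ‖g ω‖ₑ) ∂(scalarMeasure ν x').variation :=
        lintegral_mono fun ω => enorm_add_le _ _
    _ = ∫⁻ ω, ‖f ω‖ₑ ∂(scalarMeasure ν x').variation +
          ∫⁻ ω, ‖g ω‖ₑ ∂(scalarMeasure ν x').variation := lintegral_add_left hf.enorm _
    _ ≤ _ := add_le_add (le_iSup (fun x' : {x' : StrongDual ℂ X // ‖x'‖ ≤ 1} =>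
          ∫⁻ ω, ‖f ω‖ₑ ∂(scalarMeasure ν x').variation) x')
          (le_iSup (fun x' : {x' : StrongDual ℂ X // ‖x'‖ ≤ 1} =>
          ∫⁻ ω, ‖g ω‖ₑ ∂(scalarMeasure ν x').variation) x')

theorem vectorL1Norm_smul (c : ℂ) (f : Ω → ℂ) :
    vectorL1Norm ν (c • f) = ‖c‖ₑ * vectorL1Norm ν f := by
  rw [vectorL1Norm, vectorL1Norm, ENNReal.mul_iSup]
  refine iSup_congr fun x' => ?_
  rw [← lintegral_const_mul' _ _ enorm_ne_top]
  simp [enorm_mul]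

theorem scalarMeasure_smul (ν : VectorMeasure Ω X) (c : ℂ) (x' : StrongDual ℂ X) :
    scalarMeasure ν (c • x') = c • scalarMeasure ν x' := by
  ext A _
  rfl

/-- The `ν`-integrable functions. -/
def integrableFunctions (ν : VectorMeasure Ω X) : Submodule ℂ (Ω → ℂ) where
  carrier := {f | IsVectorIntegrable ν f}
  zero_mem' := isVectorIntegrable_zero
  add_mem' hf hg := IsVectorIntegrable.add hf hg
  smul_mem' c _ hf := IsVectorIntegrable.smul hf c

/-- The space of `ν`-integrable functions with the seminorm `‖·‖_ν`, before functions that are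
equal `ν`-almost everywhere are identified. -/
def PreL1 (ν : VectorMeasure Ω X) : Type _ := integrableFunctions ν

noncomputable instance PreL1.instAddCommGroup : AddCommGroup (PreL1 ν) :=
  inferInstanceAs (AddCommGroup (integrableFunctions ν))

noncomputable instance PreL1.instModule : Module ℂ (PreL1 ν) :=
  inferInstanceAs (Module ℂ (integrableFunctions ν))

noncomputable instance PreL1.instNorm : Norm (PreL1 ν) :=
  ⟨fun f => (vectorL1Norm ν f.1).toReal⟩

theorem PreL1.seminormCore : SeminormedSpace.Core ℂ (PreL1 ν) where
  norm_nonneg _ := ENNReal.toReal_nonneg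
  norm_smul c f := by
    change (vectorL1Norm ν (c • f.1)).toReal = ‖c‖ * (vectorL1Norm ν f.1).toReal
    rw [vectorL1Norm_smul, ENNReal.toReal_mul, toReal_enorm]
  norm_triangle f g := by
    change (vectorL1Norm ν (f.1 + g.1)).toReal ≤
      (vectorL1Norm ν f.1).toReal + (vectorL1Norm ν g.1).toReal
    rw [← ENNReal.toReal_add (vectorL1Norm_ne_top f.2) (vectorL1Norm_ne_top g.2)]
    exact ENNReal.toReal_mono (ENNReal.add_ne_top.2 ⟨vectorL1Norm_ne_top f.2,
      vectorL1Norm_ne_top g.2⟩) (vectorL1Norm_add_le f.2.measurable)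

noncomputable instance PreL1.instSeminormedAddCommGroup : SeminormedAddCommGroup (PreL1 ν) :=
  SeminormedAddCommGroup.ofCore PreL1.seminormCore

noncomputable instance PreL1.instNormedSpace : NormedSpace ℂ (PreL1 ν) where
  norm_smul_le c f := (PreL1.seminormCore.norm_smul c f).le

/-- The integral `∫ f dν` over the whole space. -/
noncomputable def PreL1.integral (f : PreL1 ν) : X :=
  (f.2.existsUnique Set.univ MeasurableSet.univ).choose

theorem PreL1.hasVectorIntegral_integral (f : PreL1 ν) :
    HasVectorIntegral ν f.1 Set.univ (PreL1.integral f) :=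
  (f.2.existsUnique Set.univ MeasurableSet.univ).choose_spec.1

theorem PreL1.norm_integral_le (f : PreL1 ν) : ‖PreL1.integral f‖ ≤ ‖f‖ := by
  obtain ⟨x', hx', hx⟩ := exists_dual_vector'' ℂ (PreL1.integral f)
  have h1 := PreL1.hasVectorIntegral_integral f x'
  have h2 := enorm_complexIntegral_le ((scalarMeasure ν x').restrict Set.univ) f.1
  rw [h1, hx, VectorMeasure.restrict_univ] at h2
  have h3 : ∫⁻ ω, ‖f.1 ω‖ₑ ∂(scalarMeasure ν x').variation ≤ vectorL1Norm ν f.1 :=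
    le_iSup (fun x' : {x' : StrongDual ℂ X // ‖x'‖ ≤ 1} =>
      ∫⁻ ω, ‖f.1 ω‖ₑ ∂(scalarMeasure ν x').variation) ⟨x', hx'⟩
  have h4 := ENNReal.toReal_mono (vectorL1Norm_ne_top f.2) (h2.trans h3)
  rw [toReal_enorm, RCLike.norm_ofReal, abs_norm] at h4
  exact h4

/-- The integration operator on `ν`-integrable functions. -/
noncomputable def PreL1.integralCLM (ν : VectorMeasure Ω X) : PreL1 ν →L[ℂ] X :=
  LinearMap.mkContinuous
    { toFun := PreL1.integral
      map_add' := fun f g => (PreL1.hasVectorIntegral_integral (f + g)).unique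
        ((PreL1.hasVectorIntegral_integral f).add f.2 g.2 (PreL1.hasVectorIntegral_integral g))
      map_smul' := fun c f => (PreL1.hasVectorIntegral_integral (c • f)).unique
        ((PreL1.hasVectorIntegral_integral f).smul f.2 c) } 1
    (fun f => by rw [one_mul]; exact PreL1.norm_integral_le f)

/-- The normed space `L¹(ν)` of classes of `ν`-integrable functions: two functions are identified
when their difference has norm `0`, that is, when they are equal `ν`-almost everywhere. -/
abbrev L1 (ν : VectorMeasure Ω X) : Type _ := SeparationQuotient (PreL1 ν)

/-- The integration operator `I_ν : L¹(ν) → X`, `I_ν f = ∫ f dν`. -/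
noncomputable def integrationOperator (ν : VectorMeasure Ω X) : L1 ν →L[ℂ] X :=
  SeparationQuotient.liftCLM (PreL1.integralCLM ν)
    fun _ _ h => (h.map (PreL1.integralCLM ν).continuous).eq

end VectorIntegration

theorem luxemburg.ne_top_of_bounded {α : Type*} [MeasurableSpace α] {Φ : YoungFunction}
    (hΦ : IsDeltaTwo Φ) {m : Measure α} [IsProbabilityMeasure m] {u : α → ℝ≥0∞} {M : ℝ≥0∞}
    (hM : M ≠ ∞) (hu : ∀ x, u x ≤ M) : luxemburg Φ m u ≠ ∞ := by
  have h0 := Φ.tendsto_zero ⟨1, one_pos, hΦ.finite 1⟩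
  have h1 : ∀ᶠ y : ℝ≥0∞ in 𝓝 0, Φ y < 1 := h0.eventually (eventually_lt_nhds one_pos)
  have h2 : Tendsto (fun n : ℕ => M / (n + 1 : ℕ)) atTop (𝓝 0) := by
    have h3 : Tendsto (fun n : ℕ => ((n : ℝ≥0∞))⁻¹) atTop (𝓝 0) :=
      ENNReal.tendsto_inv_nat_nhds_zero
    have := ENNReal.Tendsto.const_mul (a := M) (h3.comp (tendsto_add_atTop_nat 1)) (Or.inr hM)
    simpa [div_eq_mul_inv] using this
  obtain ⟨n, hn⟩ := (h2.eventually h1).exists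
  refine ne_top_of_le_ne_top (ENNReal.natCast_ne_top (n + 1)) (luxemburg.le_of_lintegral
    (by positivity) (ENNReal.natCast_ne_top _) ?_)
  calc ∫⁻ x, Φ (u x / (n + 1 : ℕ)) ∂m ≤ ∫⁻ _, 1 ∂m :=
        lintegral_mono fun x => (Φ.mono (ENNReal.div_le_div_right (hu x) _)).trans hn.le
    _ = 1 := by simp

theorem luxemburg.tendsto_zero_of_bounded {α ι : Type*} [MeasurableSpace α] {Φ : YoungFunction}
    (hΦ : IsDeltaTwo Φ) {m : Measure α} [IsProbabilityMeasure m] {l : Filter ι}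
    [l.IsCountablyGenerated] {u : ι → α → ℝ≥0∞} {M : ℝ≥0∞} (hM : M ≠ ∞)
    (hm : ∀ i, AEMeasurable (u i) m) (hu : ∀ i x, u i x ≤ M)
    (hlim : ∀ x, Tendsto (fun i => u i x) l (𝓝 0)) :
    Tendsto (fun i => luxemburg Φ m (u i)) l (𝓝 0) := by
  rw [ENNReal.tendsto_nhds_zero]
  intro ε' hε'
  set ε := min ε' 1 with hε
  have hε0 : 0 < ε := lt_min hε' one_pos
  have hε1 : ε ≠ ∞ := ne_top_of_le_ne_top ENNReal.one_ne_top (min_le_right _ _)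
  have hMε : M / ε ≠ ∞ := ENNReal.div_ne_top hM hε0.ne'
  have hfin : Φ (M / ε) ≠ ∞ := by
    have := hΦ.finite (M / ε).toNNReal
    rwa [ENNReal.coe_toNNReal hMε] at this
  have h1 : Tendsto (fun i => ∫⁻ x, Φ (u i x / ε) ∂m) l (𝓝 (∫⁻ _, 0 ∂m)) := by
    refine tendsto_lintegral_filter_of_dominated_convergence' (fun _ => Φ (M / ε))
      (Eventually.of_forall fun i => luxemburg.aemeasurable_comp_div (hm i) ε)
      (Eventually.of_forall fun i => Eventually.of_forall fun x =>
        Φ.mono (ENNReal.div_le_div_right (hu i x) _)) (by simpa using hfin)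
      (Eventually.of_forall fun x => ?_)
    have h2 : Tendsto (fun i => u i x / ε) l (𝓝 0) := by
      have := ENNReal.Tendsto.div_const (b := ε) (hlim x) (Or.inr hε0.ne')
      rwa [ENNReal.zero_div] at this
    exact (Φ.tendsto_zero ⟨1, one_pos, hΦ.finite 1⟩).comp h2
  rw [lintegral_zero] at h1
  filter_upwards [h1.eventually (eventually_lt_nhds one_pos)] with i hi
  exact (luxemburg.le_of_lintegral hε0 hε1 hi.le).trans (min_le_left _ _)

theorem complexMeasure_variation_univ_ne_top {Ω : Type*} [MeasurableSpace Ω]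
    (σ : ComplexMeasure Ω) : σ.variation Set.univ ≠ ∞ := by
  refine ne_top_of_le_ne_top ?_ (VectorIntegration.complex_variation_le σ Set.univ)
  rw [Measure.add_apply, ← SignedMeasure.totalVariation_eq_variation,
    ← SignedMeasure.totalVariation_eq_variation]
  exact ENNReal.add_ne_top.2 ⟨measure_ne_top _ _, measure_ne_top _ _⟩

theorem signedMeasure_variation_le {Ω : Type*} [MeasurableSpace Ω] (σ : ComplexMeasure Ω) :
    (ComplexMeasure.re σ).variation ≤ σ.variation ∧
      (ComplexMeasure.im σ).variation ≤ σ.variation := by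
  constructor <;> refine VectorMeasure.variation_le_of_forall_enorm_le fun A _ =>
    le_trans ?_ (VectorMeasure.enorm_measure_le_variation σ A)
  · rw [← ofReal_norm, ← ofReal_norm]
    exact ENNReal.ofReal_le_ofReal (Complex.abs_re_le_norm _)
  · rw [← ofReal_norm, ← ofReal_norm]
    exact ENNReal.ofReal_le_ofReal (Complex.abs_im_le_norm _)

namespace CompactGroup

variable {G : Type*} [Group G] [TopologicalSpace G] [IsTopologicalGroup G] [CompactSpace G]
  [MeasurableSpace G] [BorelSpace G]

/-- The normalized Haar measure `m_G` of a compact group. -/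
noncomputable def haarProb (G : Type*) [Group G] [TopologicalSpace G] [IsTopologicalGroup G]
    [CompactSpace G] [MeasurableSpace G] [BorelSpace G] : Measure G :=
  Measure.haarMeasure (⊤ : TopologicalSpace.PositiveCompacts G)

instance instIsProbabilityMeasureHaarProb : IsProbabilityMeasure (haarProb G) :=
  ⟨Measure.haarMeasure_self (K₀ := (⊤ : TopologicalSpace.PositiveCompacts G))⟩

/-- The convolution `(μ * f)(t) = ∫ f (s⁻¹ t) dμ(s)`. -/
noncomputable def convolution (μ : ComplexMeasure G) (f : G → ℂ) (t : G) : ℂ :=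
  complexIntegral μ (fun s => f (s⁻¹ * t))

theorem measurableSet_translate {A : Set G} (hA : MeasurableSet A) (t : G) :
    MeasurableSet {s : G | s⁻¹ * t ∈ A} :=
  (continuous_inv.mul continuous_const).measurable hA

theorem convolution_indicator (μ : ComplexMeasure G) {A : Set G} (hA : MeasurableSet A) (t : G) :
    convolution μ (A.indicator 1) t = μ {s : G | s⁻¹ * t ∈ A} := by
  have : IsFiniteMeasure μ.variation := ⟨(complexMeasure_variation_univ_ne_top μ).lt_top⟩
  have h := VectorMeasure.integral_indicator_const (μ := μ) (B := ContinuousLinearMap.mul ℝ ℂ)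
    (1 : ℂ) (measurableSet_translate hA t)
  rw [ContinuousLinearMap.mul_apply', one_mul] at h
  exact h

theorem lowerSemicontinuous_translate {p q : Measure G} [IsFiniteMeasure q] (hq : q.Regular)
    (hpq : p ≤ q) {U : Set G} (hU : IsOpen U) :
    LowerSemicontinuous fun t : G => p {s : G | s⁻¹ * t ∈ U} := by
  intro t y hy
  have hpfin : IsFiniteMeasure p := isFiniteMeasure_of_le q hpq
  have hS : IsOpen {s : G | s⁻¹ * t ∈ U} := hU.preimage (continuous_inv.mul continuous_const)
  obtain ⟨K, hKS, hK, hKlt⟩ : ∃ K ⊆ {s : G | s⁻¹ * t ∈ U}, IsCompact K ∧ y < p K := by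
    by_cases h0 : q {s : G | s⁻¹ * t ∈ U} = 0
    · exact absurd hy (by simp [le_antisymm ((hpq _).trans h0.le) zero_le])
    have hε : p {s : G | s⁻¹ * t ∈ U} - y ≠ 0 := (tsub_pos_of_lt hy).ne'
    obtain ⟨K, hKS, hK, hlt⟩ := hS.exists_lt_isCompact
      (ENNReal.sub_lt_self (measure_ne_top q _) h0 hε)
    refine ⟨closure K, ?_, isClosed_closure.isCompact, ?_⟩
    · exact hK.closure_subset_of_isOpen hS hKS
    have hKm : MeasurableSet (closure K) := isClosed_closure.measurableSet
    have hKS' : closure K ⊆ {s : G | s⁻¹ * t ∈ U} := hK.closure_subset_of_isOpen hS hKS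
    have h1 : p {s : G | s⁻¹ * t ∈ U} ≤ p (closure K) + q ({s : G | s⁻¹ * t ∈ U} \ closure K) := by
      rw [← measure_inter_add_sdiff {s : G | s⁻¹ * t ∈ U} hKm, Set.inter_eq_self_of_subset_right hKS']
      gcongr
    have h2 : q ({s : G | s⁻¹ * t ∈ U} \ closure K) < p {s : G | s⁻¹ * t ∈ U} - y := by
      rw [measure_sdiff hKS' hKm.nullMeasurableSet (measure_ne_top q _)]
      have h3 : q {s : G | s⁻¹ * t ∈ U} < q (closure K) + (p {s : G | s⁻¹ * t ∈ U} - y) := by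
        refine (ENNReal.sub_lt_iff_lt_right (ne_top_of_le_ne_top (measure_ne_top p _) tsub_le_self)
          (tsub_le_self.trans (hpq _))).1 (hlt.trans_le (measure_mono subset_closure))
      exact (ENNReal.sub_lt_iff_lt_left (measure_ne_top q _) (measure_mono hKS')).2 h3
    by_contra hle
    have h4 : p {s : G | s⁻¹ * t ∈ U} < y + (p {s : G | s⁻¹ * t ∈ U} - y) :=
      h1.trans_lt (ENNReal.add_lt_add_of_le_of_lt (ne_top_of_le_ne_top (ne_top_of_lt hy)
        (not_lt.1 hle)) (not_lt.1 hle) h2)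
    rw [add_tsub_cancel_of_le hy.le] at h4
    exact lt_irrefl _ h4
  have h5 : ∀ᶠ t' in 𝓝 t, ∀ s ∈ K, s⁻¹ * t' ∈ U := by
    refine hK.eventually_forall_of_forall_eventually fun s hs => ?_
    have hc : Continuous fun z : G × G => z.2⁻¹ * z.1 := continuous_snd.inv.mul continuous_fst
    exact hc.continuousAt.eventually_mem (hU.mem_nhds (hKS hs))
  filter_upwards [h5] with t' ht'
  exact hKlt.trans_le (measure_mono fun s hs => ht' s hs)

theorem measurable_translate {p q : Measure G} [IsFiniteMeasure q] (hq : q.Regular)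
    (hpq : p ≤ q) {A : Set G} (hA : MeasurableSet A) :
    Measurable fun t : G => p {s : G | s⁻¹ * t ∈ A} := by
  have hpfin : IsFiniteMeasure p := isFiniteMeasure_of_le q hpq
  induction A, hA using MeasurableSpace.induction_on_inter (BorelSpace.measurable_eq (α := G))
    isPiSystem_isOpen with
  | empty => simp
  | basic U hU => exact (lowerSemicontinuous_translate hq hpq hU).measurable
  | compl A hA ih =>
    have : (fun t : G => p {s : G | s⁻¹ * t ∈ Aᶜ}) =
        fun t => p Set.univ - p {s : G | s⁻¹ * t ∈ A} := by
      funext t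
      rw [← measure_compl (measurableSet_translate hA t) (measure_ne_top p _)]
      rfl
    rw [this]
    exact measurable_const.sub ih
  | iUnion f hd hf ih =>
    have : (fun t : G => p {s : G | s⁻¹ * t ∈ ⋃ i, f i}) =
        fun t => ∑' i, p {s : G | s⁻¹ * t ∈ f i} := by
      funext t
      have hU : {s : G | s⁻¹ * t ∈ ⋃ i, f i} = ⋃ i, {s : G | s⁻¹ * t ∈ f i} := by
        ext s; simp
      rw [hU]
      exact measure_iUnion (fun i j hij => (hd hij).preimage fun s : G => s⁻¹ * t)
        (fun i => measurableSet_translate (hf i) t)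
    rw [this]
    exact Measurable.tsum ih

theorem measurable_translate_signed {σ : SignedMeasure G} {q : Measure G} [IsFiniteMeasure q]
    (hq : q.Regular) (h : σ.variation ≤ q) {A : Set G} (hA : MeasurableSet A) :
    Measurable fun t : G => σ {s : G | s⁻¹ * t ∈ A} := by
  rw [← SignedMeasure.totalVariation_eq_variation] at h
  have h1 := measurable_translate hq ((Measure.le_add_right le_rfl).trans h :
    σ.toJordanDecomposition.posPart ≤ q) hA
  have h2 := measurable_translate hq ((Measure.le_add_left le_rfl).trans h :
    σ.toJordanDecomposition.negPart ≤ q) hA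
  have : (fun t : G => σ {s : G | s⁻¹ * t ∈ A}) = fun t =>
      (σ.toJordanDecomposition.posPart {s : G | s⁻¹ * t ∈ A}).toReal -
        (σ.toJordanDecomposition.negPart {s : G | s⁻¹ * t ∈ A}).toReal := by
    funext t
    exact σ.apply_eq_posPart_real_sub_negPart_real (measurableSet_translate hA t)
  rw [this]
  exact h1.ennreal_toReal.sub h2.ennreal_toReal

theorem measurable_convolution_indicator {μ : ComplexMeasure G} (hμ : μ.variation.Regular)
    {A : Set G} (hA : MeasurableSet A) : Measurable (convolution μ (A.indicator 1)) := by
  have : IsFiniteMeasure μ.variation := ⟨(complexMeasure_variation_univ_ne_top μ).lt_top⟩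
  have h1 := measurable_translate_signed hμ (signedMeasure_variation_le μ).1 hA
  have h2 := measurable_translate_signed hμ (signedMeasure_variation_le μ).2 hA
  have : convolution μ (A.indicator 1) = fun t : G =>
      (((ComplexMeasure.re μ) {s : G | s⁻¹ * t ∈ A} : ℝ) : ℂ) +
        (((ComplexMeasure.im μ) {s : G | s⁻¹ * t ∈ A} : ℝ) : ℂ) * Complex.I := by
    funext t
    rw [convolution_indicator μ hA]
    exact (Complex.re_add_im _).symm
  rw [this]
  exact (Complex.measurable_ofReal.comp h1).add
    ((Complex.measurable_ofReal.comp h2).mul_const _)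

theorem enorm_convolution_indicator_le (μ : ComplexMeasure G) {A : Set G} (hA : MeasurableSet A)
    (t : G) : ‖convolution μ (A.indicator 1) t‖ₑ ≤ μ.variation Set.univ := by
  rw [convolution_indicator μ hA]
  exact (VectorMeasure.enorm_measure_le_variation μ _).trans (measure_mono (Set.subset_univ _))

variable {Φ : YoungFunction} (hΦ : IsDeltaTwo Φ) {μ : ComplexMeasure G}
  (hμ : μ.variation.Regular)

/-- The element `μ * χ_A` of `L^Φ(G)`, for a Borel set `A`. -/
noncomputable def convolutionIndicator {A : Set G} (hA : MeasurableSet A) :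
    OrliczSpace Φ (haarProb G) :=
  OrliczSpace.mk (convolution μ (A.indicator 1))
    (measurable_convolution_indicator hμ hA).aestronglyMeasurable
    (luxemburg.ne_top_of_bounded hΦ (complexMeasure_variation_univ_ne_top μ)
      (enorm_convolution_indicator_le μ hA))

theorem hasSum_convolutionIndicator {f : ℕ → Set G} (hf : ∀ i, MeasurableSet (f i))
    (hd : Pairwise (Function.onFun Disjoint f)) :
    HasSum (fun i => convolutionIndicator hΦ hμ (hf i))
      (convolutionIndicator hΦ hμ (MeasurableSet.iUnion hf)) := by
  have hS : ∀ t : G, {s : G | s⁻¹ * t ∈ ⋃ i, f i} = ⋃ i, {s : G | s⁻¹ * t ∈ f i} := by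
    intro t; ext s; simp
  have hSd : ∀ t : G, Pairwise (Function.onFun Disjoint fun i => {s : G | s⁻¹ * t ∈ f i}) :=
    fun t i j hij => (hd hij).preimage fun s : G => s⁻¹ * t
  set u : Finset ℕ → G → ℝ≥0∞ := fun S t =>
    ‖(∑ i ∈ S, convolution μ ((f i).indicator 1) t) -
      convolution μ ((⋃ i, f i).indicator 1) t‖ₑ with hu
  have hum : ∀ S, AEMeasurable (u S) (haarProb G) := fun S =>
    ((Finset.measurable_fun_sum S fun i _ => measurable_convolution_indicator hμ (hf i)).sub
      (measurable_convolution_indicator hμ (MeasurableSet.iUnion hf))).enorm.aemeasurable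
  have hM := complexMeasure_variation_univ_ne_top μ
  have hbd : ∀ S t, u S t ≤ μ.variation Set.univ + μ.variation Set.univ := by
    intro S t
    refine enorm_sub_le.trans (add_le_add ?_
      (enorm_convolution_indicator_le μ (MeasurableSet.iUnion hf) t))
    refine (enorm_sum_le _ _).trans ?_
    calc ∑ i ∈ S, ‖convolution μ ((f i).indicator 1) t‖ₑ
        ≤ ∑ i ∈ S, μ.variation {s : G | s⁻¹ * t ∈ f i} := by
          refine Finset.sum_le_sum fun i _ => ?_
          rw [convolution_indicator μ (hf i)]
          exact VectorMeasure.enorm_measure_le_variation μ _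
      _ = μ.variation (⋃ i ∈ S, {s : G | s⁻¹ * t ∈ f i}) :=
          (measure_biUnion_finset (fun i _ j _ hij => hSd t hij)
            (fun i _ => measurableSet_translate (hf i) t)).symm
      _ ≤ _ := measure_mono (Set.subset_univ _)
  have hlim : ∀ t, Tendsto (fun S => u S t) atTop (𝓝 0) := by
    intro t
    have h1 := μ.m_iUnion (fun i => measurableSet_translate (hf i) t) (hSd t)
    rw [← hS t, ← convolution_indicator μ (MeasurableSet.iUnion hf)] at h1
    simp only [← convolution_indicator μ (hf _)] at h1
    have h2 := (tendsto_iff_norm_sub_tendsto_zero.1 h1)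
    have h3 := ENNReal.tendsto_ofReal h2
    simpa [hu] using h3
  have h0 := luxemburg.tendsto_zero_of_bounded hΦ (ENNReal.add_ne_top.2 ⟨hM, hM⟩) hum hbd hlim
  change Tendsto _ _ _
  rw [tendsto_iff_norm_sub_tendsto_zero]
  have h1 : Tendsto (fun S : Finset ℕ => ENNReal.ofReal
      ‖(∑ i ∈ S, convolutionIndicator hΦ hμ (hf i)) -
        convolutionIndicator hΦ hμ (MeasurableSet.iUnion hf)‖) atTop (𝓝 0) := by
    refine tendsto_of_tendsto_of_tendsto_of_le_of_le tendsto_const_nhds h0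
      (fun _ => zero_le) (fun S => OrliczSpace.ofReal_norm_sub_le ?_)
    have hall : ∀ᵐ t ∂haarProb G, ∀ i, ((convolutionIndicator hΦ hμ (hf i) :
        OrliczSpace Φ (haarProb G)) : G →ₘ[haarProb G] ℂ) t =
          convolution μ ((f i).indicator 1) t :=
      ae_all_iff.2 fun i => OrliczSpace.coe_mk _ _ _
    have hun : ((convolutionIndicator hΦ hμ (MeasurableSet.iUnion hf) :
        OrliczSpace Φ (haarProb G)) : G →ₘ[haarProb G] ℂ) =ᵐ[haarProb G]
          convolution μ ((⋃ i, f i).indicator 1) := OrliczSpace.coe_mk _ _ _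
    filter_upwards [hall, hun, OrliczSpace.coe_sum S fun i => convolutionIndicator hΦ hμ (hf i)]
      with t ht1 ht2 ht3
    rw [ht3, ht2]
    simp only [ht1]
    exact le_rfl
  have := (ENNReal.tendsto_toReal ENNReal.zero_ne_top).comp h1
  simpa [Function.comp_def] using this

open scoped Classical in
/-- The `L^Φ(G)`-valued vector measure `ν_{Φ,μ} : A ↦ μ * χ_A` associated with the convolution
operator `f ↦ μ * f` on `L^Φ(G)`. -/
noncomputable def convolutionMeasure : VectorMeasure G (OrliczSpace Φ (haarProb G)) where
  measureOf' A := if hA : MeasurableSet A then convolutionIndicator hΦ hμ hA else 0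
  empty' := by
    rw [dif_pos MeasurableSet.empty]
    have h : ∀ᵐ t ∂haarProb G, ‖((convolutionIndicator hΦ hμ MeasurableSet.empty :
        OrliczSpace Φ (haarProb G)) : G →ₘ[haarProb G] ℂ) t -
          ((0 : OrliczSpace Φ (haarProb G)) : G →ₘ[haarProb G] ℂ) t‖ₑ ≤ 0 := by
      have h1 : ((convolutionIndicator hΦ hμ MeasurableSet.empty :
        OrliczSpace Φ (haarProb G)) : G →ₘ[haarProb G] ℂ) =ᵐ[haarProb G]
          convolution μ ((∅ : Set G).indicator 1) := OrliczSpace.coe_mk _ _ _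
      filter_upwards [h1, AEEqFun.coeFn_zero (μ := haarProb G) (β := ℂ)] with t ht1 ht2
      rw [ht1, Submodule.coe_zero, ht2, convolution_indicator μ MeasurableSet.empty]
      simp
    have h2 := OrliczSpace.ofReal_norm_sub_le (w := fun _ => 0) h
    rw [luxemburg.zero, sub_zero] at h2
    exact norm_le_zero_iff.1 (ENNReal.ofReal_eq_zero.1 (le_antisymm h2 zero_le))
  not_measurable' A hA := dif_neg hA
  m_iUnion' f hf hd := by
    rw [dif_pos (MeasurableSet.iUnion hf)]
    simp only [dif_pos (hf _)]
    exact hasSum_convolutionIndicator hΦ hμ hf hd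

end CompactGroup

/-- `x` is the Pettis integral of `F` over `A`: `∫_A ⟨F, x'⟩ dm = ⟨x, x'⟩` for every functional
`x'`. -/
def HasPettisIntegral {Ω X : Type*} [MeasurableSpace Ω] [NormedAddCommGroup X] [NormedSpace ℂ X]
    (m : Measure Ω) (F : Ω → X) (A : Set Ω) (x : X) : Prop :=
  ∀ x' : StrongDual ℂ X, ∫ ω in A, x' (F ω) ∂m = x' x

/-- Pettis integrability: every `⟨F, x'⟩` is integrable, and `F` has a unique Pettis integral over
every measurable set. -/
def IsPettisIntegrable {Ω X : Type*} [MeasurableSpace Ω] [NormedAddCommGroup X] [NormedSpace ℂ X]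
    (m : Measure Ω) (F : Ω → X) : Prop :=
  (∀ x' : StrongDual ℂ X, Integrable (fun ω => x' (F ω)) m) ∧
    ∀ A : Set Ω, MeasurableSet A → ∃! x : X, HasPettisIntegral m F A x

/-!
Write `m` for the normalized Haar measure and `ν A = μ * χ_A`. Everything rests on two facts: right
translations of `G` are isometries of the Orlicz space which permute the values of `ν`, and the
`Δ₂`-condition makes continuous functions dense in the Orlicz space. No Radon–Nikodym property of
the Orlicz space and no description of its dual are needed.

*From (i) to (ii)*. If the integration operator is compact, then, on the integrals of functions of
the unit ball of `L¹(ν)`, every functional of the dual unit ball is close to one of finitely many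
functionals `z`. The variation over `A` of the difference of the corresponding scalar measures is
at most half of `‖χ_A‖_ν`; absorbing this half gives `‖ν A‖ ≤ 2 ∑_z |⟨ν, z⟩|(A)`, a finite measure
(`VectorIntegration.variation_lt_top_of_isCompactOperator`).

*From (v) or (iv) to (vi)*. A finite variation on a set, or a Pettis density, yields a constant `a`
and a set `B` of positive measure such that `‖ν C‖ ≤ a m(C)` for measurable `C ⊆ B`. Since the
translates of `B` exhaust `G` up to a null set, this domination holds on all of `G`
(`CompactGroup.dominatedOn_univ`). In particular the averages `t ↦ μ(t U⁻¹) / m(U)` lie in the ball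
of radius `a` of the Orlicz space for every neighbourhood `U` of `1`. By Young's inequality and the
finiteness of `Ψ` they are uniformly integrable, so `μ` charges no null set
(`CompactGroup.signed_apply_eq_zero`) and has a density `f` with respect to `m`. The averages
converge to `f` in `L¹`, and Fatou's lemma puts `f` into the ball of radius `a`
(`CompactGroup.exists_density_of_dominatedOn`). The case `a = 0` shows that `ν ≠ 0`, so that (ii)
implies (v).

*From (vi) to (iii)*. If `μ` has density `f`, then `ν` has the density `F u = f (· u⁻¹)`, which is
continuous because continuous functions are dense
(`CompactGroup.convolutionMeasure_eq_integral_translate`). A Bochner density is a Pettis density, so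
(iv) follows.

*From (vi) to (i)*. The density `F` is continuous and vanishes nowhere, so by compactness of `G`
finitely many functionals detect its size, and `‖g‖_{L¹(m)} ≤ C ‖g‖_ν`. Hence the integrals of the
unit ball of `L¹(ν)` lie in the closed convex hull of the compact set of all `z F u`, `|z| ≤ C`
(`VectorIntegration.isCompactOperator_integrationOperator`).
-/

/-! ### Haar measure of a compact group -/

namespace CompactGroup

variable {G : Type*} [Group G] [TopologicalSpace G] [IsTopologicalGroup G] [CompactSpace G]
  [MeasurableSpace G] [BorelSpace G]

instance instIsHaarMeasureHaarProb : (haarProb G).IsHaarMeasure :=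
  inferInstanceAs (Measure.haarMeasure (⊤ : TopologicalSpace.PositiveCompacts G)).IsHaarMeasure

instance instRegularHaarProb : (haarProb G).Regular :=
  inferInstanceAs (Measure.haarMeasure (⊤ : TopologicalSpace.PositiveCompacts G)).Regular

/-- Uniqueness of Haar measure on a compact group. No regularity of `p` is needed. -/
theorem eq_smul_haarProb_of_left (p : Measure G) [IsFiniteMeasure p] [p.IsMulLeftInvariant] :
    p = p Set.univ • haarProb G := by
  have h := Measure.isMulInvariant_eq_smul_of_compactSpace p (haarProb G)
  have h1 : p Set.univ = (Measure.haarScalarFactor p (haarProb G) : ℝ≥0∞) := by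
    conv_lhs => rw [h]
    simp
  rw [h1]
  exact h

instance instRightInvariantHaarProb : (haarProb G).IsMulRightInvariant where
  map_mul_right_eq_self g := by
    have : IsProbabilityMeasure ((haarProb G).map (· * g)) :=
      Measure.isProbabilityMeasure_map (measurable_mul_const g).aemeasurable
    have h := eq_smul_haarProb_of_left ((haarProb G).map (· * g))
    rwa [measure_univ, one_smul] at h

instance instInvInvariantHaarProb : (haarProb G).IsInvInvariant where
  inv_eq_self := by
    have : IsProbabilityMeasure (haarProb G).inv :=
      Measure.isProbabilityMeasure_map measurable_inv.aemeasurable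
    have h := eq_smul_haarProb_of_left (haarProb G).inv
    rwa [measure_univ, one_smul] at h

theorem eq_smul_haarProb_of_right (p : Measure G) [IsFiniteMeasure p] [p.IsMulRightInvariant] :
    p = p Set.univ • haarProb G := by
  have : IsFiniteMeasure p.inv := Measure.isFiniteMeasure_map p _
  have h := eq_smul_haarProb_of_left p.inv
  have h2 := congrArg Measure.inv h
  rw [Measure.inv_inv] at h2
  rw [h2]
  simp [Measure.inv, Measure.map_smul]

/-- The measure `A ↦ ∫ q (t A⁻¹) dm(t)` is right invariant, hence a multiple of Haar measure. -/
theorem lintegral_translate {q : Measure G} [IsFiniteMeasure q] (hq : q.Regular) {A : Set G}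
    (hA : MeasurableSet A) :
    ∫⁻ t, q {s : G | s⁻¹ * t ∈ A} ∂haarProb G = q Set.univ * haarProb G A := by
  set p : Measure G := Measure.ofMeasurable
    (fun A _ => ∫⁻ t, q {s : G | s⁻¹ * t ∈ A} ∂haarProb G) (by simp) (by
      intro f hf hd
      rw [← lintegral_tsum fun i => (measurable_translate hq le_rfl (hf i)).aemeasurable]
      refine lintegral_congr fun t => ?_
      have : {s : G | s⁻¹ * t ∈ ⋃ i, f i} = ⋃ i, {s : G | s⁻¹ * t ∈ f i} := by ext s; simp
      rw [this]
      exact measure_iUnion (fun i j hij => (hd hij).preimage fun s : G => s⁻¹ * t)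
        (fun i => measurableSet_translate (hf i) t)) with hp
  have hpA : ∀ B, MeasurableSet B → p B = ∫⁻ t, q {s : G | s⁻¹ * t ∈ B} ∂haarProb G :=
    fun B hB => Measure.ofMeasurable_apply B hB
  have hpu : p Set.univ = q Set.univ := by
    rw [hpA _ MeasurableSet.univ]
    simp
  have : IsFiniteMeasure p := ⟨by rw [hpu]; exact measure_lt_top q _⟩
  have : p.IsMulRightInvariant := by
    refine ⟨fun g => Measure.ext fun B hB => ?_⟩
    rw [Measure.map_apply (measurable_mul_const g) hB, hpA _ (measurable_mul_const g hB), hpA _ hB,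
      ← lintegral_mul_right_eq_self (fun t => q {s : G | s⁻¹ * t ∈ B}) g]
    simp only [Set.mem_preimage, mul_assoc]
  rw [← hpA A hA, eq_smul_haarProb_of_right p, hpu]
  simp

/-- Some right translate of `A` meets `C` in at least the average proportion. -/
theorem exists_mul_le_measure_inter {A C : Set G} (hA : MeasurableSet A) (hC : MeasurableSet C) :
    ∃ u : G, haarProb G A * haarProb G C ≤ haarProb G ({x | x * u ∈ A} ∩ C) := by
  have hC' : MeasurableSet C⁻¹ := hC.inv
  have : Measure.Regular ((haarProb G).restrict C⁻¹) := inferInstance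
  have h := lintegral_translate this hA
  rw [Measure.restrict_apply_univ, Measure.measure_inv, mul_comm] at h
  obtain ⟨t, ht⟩ := exists_lintegral_le (μ := haarProb G)
    (f := fun t => ((haarProb G).restrict C⁻¹) {s : G | s⁻¹ * t ∈ A})
    (by rw [h]; exact ENNReal.mul_ne_top (by finiteness) (by finiteness))
  refine ⟨t, ?_⟩
  rw [h, Measure.restrict_apply (measurableSet_translate hA t),
    ← Measure.measure_inv _ (_ ∩ _)] at ht
  refine ht.trans (measure_mono ?_)
  intro x hx
  simpa using hx

end CompactGroup

/-! ### Domination of the convolution measure by Haar measure -/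

/-- The vector measure `ν` is dominated by `a` times the measure `m` on measurable subsets
of `D`. -/
def DominatedOn {Ω X : Type*} [MeasurableSpace Ω] [NormedAddCommGroup X] (ν : VectorMeasure Ω X)
    (m : Measure Ω) (a : ℝ≥0∞) (D : Set Ω) : Prop :=
  ∀ C ⊆ D, MeasurableSet C → ‖ν C‖ₑ ≤ a * m C

theorem DominatedOn.iUnion {Ω X : Type*} [MeasurableSpace Ω] [NormedAddCommGroup X]
    {ν : VectorMeasure Ω X} {m : Measure Ω} {a : ℝ≥0∞} {D : ℕ → Set Ω}
    (hD : ∀ n, MeasurableSet (D n)) (h : ∀ n, DominatedOn ν m a (D n)) :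
    DominatedOn ν m a (⋃ n, D n) := by
  intro C hC hCm
  have hm : ∀ n, MeasurableSet (C ∩ disjointed D n) := fun n =>
    hCm.inter (MeasurableSet.disjointed hD n)
  have hd : Pairwise (Function.onFun Disjoint fun n => C ∩ disjointed D n) := fun i j hij =>
    (disjoint_disjointed D hij).mono Set.inter_subset_right Set.inter_subset_right
  have hU : C = ⋃ n, C ∩ disjointed D n := by
    rw [← Set.inter_iUnion, iUnion_disjointed, Set.inter_eq_self_of_subset_left hC]
  have h1 : ‖ν C‖ₑ ≤ ∑' n, ‖ν (C ∩ disjointed D n)‖ₑ := by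
    conv_lhs => rw [hU, VectorMeasure.of_disjoint_iUnion hm hd]
    exact enorm_tsum_le_tsum_enorm
  calc ‖ν C‖ₑ ≤ ∑' n, ‖ν (C ∩ disjointed D n)‖ₑ := h1
    _ ≤ ∑' n, a * m (C ∩ disjointed D n) := ENNReal.tsum_le_tsum fun n =>
        h n _ (Set.inter_subset_right.trans (disjointed_subset D n)) (hm n)
    _ = a * m C := by
        rw [ENNReal.tsum_mul_left, ← measure_iUnion hd hm, ← hU]

theorem DominatedOn.union {Ω X : Type*} [MeasurableSpace Ω] [NormedAddCommGroup X]
    {ν : VectorMeasure Ω X} {m : Measure Ω} {a : ℝ≥0∞} {D E : Set Ω}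
    (hD : MeasurableSet D) (hE : MeasurableSet E) (h : DominatedOn ν m a D)
    (h' : DominatedOn ν m a E) : DominatedOn ν m a (D ∪ E) := by
  have := DominatedOn.iUnion (ν := ν) (m := m) (a := a) (D := fun n : ℕ => if n = 0 then D else E)
    (fun n => by split_ifs <;> assumption) (fun n => by split_ifs <;> assumption)
  intro C hC
  refine this C (hC.trans (Set.union_subset ?_ ?_))
  · exact Set.subset_iUnion_of_subset 0 (by simp)
  · exact Set.subset_iUnion_of_subset 1 (by simp)

theorem OrliczSpace.enorm_eq {α : Type*} [MeasurableSpace α] {Φ : YoungFunction} {m : Measure α}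
    (f : OrliczSpace Φ m) : ‖f‖ₑ = luxemburg Φ m (fun x => ‖(f : α →ₘ[m] ℂ) x‖ₑ) := by
  rw [← OrliczSpace.ofReal_norm, _root_.ofReal_norm]

namespace CompactGroup

variable {G : Type*} [Group G] [TopologicalSpace G] [IsTopologicalGroup G] [CompactSpace G]
  [MeasurableSpace G] [BorelSpace G]

theorem luxemburg_mul_right (Φ : YoungFunction) (w : G → ℝ≥0∞) (g : G) :
    luxemburg Φ (haarProb G) (fun t => w (t * g)) = luxemburg Φ (haarProb G) w := by
  unfold luxemburg
  congr 1
  ext k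
  rw [Set.mem_ofPred_eq, Set.mem_ofPred_eq,
    lintegral_mul_right_eq_self (fun t => Φ (w t / k)) g]

variable {Φ : YoungFunction} (hΦ : IsDeltaTwo Φ) {μ : ComplexMeasure G}
  (hμ : μ.variation.Regular)

theorem coe_convolutionMeasure {A : Set G} (hA : MeasurableSet A) :
    ((convolutionMeasure hΦ hμ A : OrliczSpace Φ (haarProb G)) : G →ₘ[haarProb G] ℂ)
      =ᵐ[haarProb G] fun t => μ {s : G | s⁻¹ * t ∈ A} := by
  have h : convolutionMeasure hΦ hμ A = convolutionIndicator hΦ hμ hA := dif_pos hA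
  rw [h]
  refine (OrliczSpace.coe_mk _ _ _).trans (Eventually.of_forall fun t => ?_)
  exact convolution_indicator μ hA t

theorem enorm_convolutionMeasure {A : Set G} (hA : MeasurableSet A) :
    ‖convolutionMeasure hΦ hμ A‖ₑ =
      luxemburg Φ (haarProb G) fun t => ‖μ {s : G | s⁻¹ * t ∈ A}‖ₑ := by
  rw [OrliczSpace.enorm_eq]
  refine luxemburg.congr_ae ?_
  filter_upwards [coe_convolutionMeasure hΦ hμ hA] with t ht
  rw [ht]

theorem convolutionMeasure_eq_zero {A : Set G} (h0 : haarProb G A = 0) :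
    convolutionMeasure hΦ hμ A = 0 := by
  by_cases hA : MeasurableSet A
  swap
  · exact VectorMeasure.not_measurable _ hA
  have : IsFiniteMeasure μ.variation := ⟨(complexMeasure_variation_univ_ne_top μ).lt_top⟩
  have h := lintegral_translate hμ hA
  rw [h0, mul_zero, lintegral_eq_zero_iff (measurable_translate hμ le_rfl hA)] at h
  rw [← enorm_eq_zero, enorm_convolutionMeasure hΦ hμ hA,
    ← luxemburg.zero (Φ := Φ) (m := haarProb G)]
  refine luxemburg.congr_ae ?_
  filter_upwards [h] with t ht
  exact le_antisymm ((VectorMeasure.enorm_measure_le_variation μ _).trans ht.le) zero_le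

theorem enorm_convolutionMeasure_mul_right {A : Set G} (hA : MeasurableSet A) (g : G) :
    ‖convolutionMeasure hΦ hμ {x | x * g ∈ A}‖ₑ = ‖convolutionMeasure hΦ hμ A‖ₑ := by
  rw [enorm_convolutionMeasure hΦ hμ (A := {x | x * g ∈ A}) (measurable_mul_const g hA),
    enorm_convolutionMeasure hΦ hμ hA,
    ← luxemburg_mul_right _ (fun t => ‖μ {s : G | s⁻¹ * t ∈ A}‖ₑ) g]
  simp [mul_assoc]

/-- Translates of a set of positive measure exhaust the group up to a null set, so that a
domination of `ν` on such a set spreads to the whole group. -/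
theorem dominatedOn_univ {a : ℝ≥0∞} {B : Set G} (hB : MeasurableSet B) (hB0 : haarProb G B ≠ 0)
    (h : DominatedOn (convolutionMeasure hΦ hμ) (haarProb G) a B) :
    DominatedOn (convolutionMeasure hΦ hμ) (haarProb G) a Set.univ := by
  have hBg : ∀ g : G, DominatedOn (convolutionMeasure hΦ hμ) (haarProb G) a {x | x * g ∈ B} := by
    intro g C hC hCm
    have h1 := h {x | x * g⁻¹ ∈ C} (fun x hx => by simpa using hC hx) (measurable_mul_const _ hCm)
    rw [enorm_convolutionMeasure_mul_right hΦ hμ hCm] at h1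
    have h2 : haarProb G {x | x * g⁻¹ ∈ C} = haarProb G C :=
      measure_preimage_mul_right _ g⁻¹ C
    rwa [h2] at h1
  set b := haarProb G B with hb
  have hb1 : b ≤ 1 := prob_le_one
  have key : ∀ n : ℕ, ∃ D : Set G, MeasurableSet D ∧ haarProb G Dᶜ ≤ (1 - b) ^ n ∧
      DominatedOn (convolutionMeasure hΦ hμ) (haarProb G) a D := by
    intro n
    induction n with
    | zero =>
      refine ⟨∅, MeasurableSet.empty, by simp, fun C hC _ => ?_⟩
      rw [Set.subset_empty_iff.1 hC]
      simp
    | succ n ih =>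
      obtain ⟨D, hD, hDn, hDd⟩ := ih
      obtain ⟨g, hg⟩ := exists_mul_le_measure_inter hB hD.compl
      have hm : MeasurableSet {x | x * g ∈ B} := measurable_mul_const g hB
      refine ⟨D ∪ {x | x * g ∈ B}, hD.union hm, ?_, hDd.union hD hm (hBg g)⟩
      have h1 : (D ∪ {x | x * g ∈ B})ᶜ = Dᶜ \ ({x | x * g ∈ B} ∩ Dᶜ) := by
        ext x; simp
      rw [h1, measure_sdiff Set.inter_subset_right (hm.inter hD.compl).nullMeasurableSet
        (measure_ne_top _ _)]
      calc haarProb G Dᶜ - haarProb G ({x | x * g ∈ B} ∩ Dᶜ)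
          ≤ haarProb G Dᶜ - b * haarProb G Dᶜ := tsub_le_tsub_left hg _
        _ = (1 - b) * haarProb G Dᶜ := by
            rw [ENNReal.sub_mul (fun _ _ => measure_ne_top _ _), one_mul]
        _ ≤ (1 - b) * (1 - b) ^ n := by gcongr
        _ = (1 - b) ^ (n + 1) := by ring
  choose D hD hDn hDd using key
  have h0 : haarProb G (⋃ n, D n)ᶜ = 0 := by
    have h1 : Tendsto (fun n : ℕ => (1 - b) ^ n) atTop (𝓝 0) :=
      ENNReal.tendsto_pow_atTop_nhds_zero_of_lt_one
        (ENNReal.sub_lt_self ENNReal.one_ne_top one_ne_zero hB0)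
    refine le_antisymm (ge_of_tendsto' h1 fun n => ?_) zero_le
    exact (measure_mono (Set.compl_subset_compl.2 (Set.subset_iUnion D n))).trans (hDn n)
  have hz : DominatedOn (convolutionMeasure hΦ hμ) (haarProb G) a (⋃ n, D n)ᶜ := by
    intro C hC hCm
    rw [convolutionMeasure_eq_zero hΦ hμ (measure_mono_null hC h0)]
    simp
  have := (DominatedOn.iUnion hD hDd).union (MeasurableSet.iUnion hD)
    (MeasurableSet.iUnion hD).compl hz
  rwa [Set.union_compl_self] at this

/-- If the variation of `ν` takes a value other than `0` and `∞`, then its density on such a set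
is bounded on a smaller set of positive measure. -/
theorem exists_dominatedOn_of_variation {A : Set G} (hA : MeasurableSet A)
    (h0 : (convolutionMeasure hΦ hμ).variation A ≠ 0)
    (h1 : (convolutionMeasure hΦ hμ).variation A ≠ ∞) :
    ∃ a : ℝ≥0∞, a ≠ ∞ ∧ DominatedOn (convolutionMeasure hΦ hμ) (haarProb G) a Set.univ := by
  set ν := convolutionMeasure hΦ hμ with hν
  have : IsFiniteMeasure (ν.variation.restrict A) := ⟨by simpa using h1.lt_top⟩
  have hac' : ν.variation ≪ haarProb G := by
    refine Measure.AbsolutelyContinuous.mk fun s hs hs0 => ?_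
    rw [VectorMeasure.variation_apply_eq_zero hs]
    exact fun t hts _ => convolutionMeasure_eq_zero hΦ hμ (measure_mono_null hts hs0)
  have hac : ν.variation.restrict A ≪ haarProb G :=
    Measure.absolutelyContinuous_of_le Measure.restrict_le_self |>.trans hac'
  set w := (ν.variation.restrict A).rnDeriv (haarProb G) with hw
  have hwm : Measurable w := Measure.measurable_rnDeriv _ _
  have hwd : (haarProb G).withDensity w = ν.variation.restrict A :=
    Measure.withDensity_rnDeriv_eq _ _ hac
  have hpos : haarProb G A ≠ 0 := fun h => h0 (hac' h)
  have hU : A ⊆ (⋃ n : ℕ, A ∩ {x | w x ≤ n}) ∪ {x | w x = ∞} := by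
    intro x hx
    by_cases hxt : w x = ∞
    · exact Or.inr hxt
    · obtain ⟨n, hn⟩ := ENNReal.exists_nat_gt hxt
      exact Or.inl (Set.mem_iUnion.2 ⟨n, hx, hn.le⟩)
  have htop : haarProb G {x | w x = ∞} = 0 := by
    have := Measure.rnDeriv_lt_top (ν.variation.restrict A) (haarProb G)
    rw [ae_iff] at this
    simpa using this
  obtain ⟨n, hn⟩ : ∃ n : ℕ, haarProb G (A ∩ {x | w x ≤ n}) ≠ 0 := by
    by_contra hcon
    push Not at hcon
    exact hpos (measure_mono_null hU (measure_union_null (measure_iUnion_null hcon) htop))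
  have hBm : MeasurableSet (A ∩ {x | w x ≤ n}) := hA.inter (measurableSet_le hwm measurable_const)
  refine ⟨n, ENNReal.natCast_ne_top n, dominatedOn_univ hΦ hμ hBm hn fun C hC hCm => ?_⟩
  calc ‖ν C‖ₑ ≤ ν.variation C := VectorMeasure.enorm_measure_le_variation _ _
    _ = ν.variation.restrict A C := by
        rw [Measure.restrict_apply hCm,
          Set.inter_eq_self_of_subset_left (hC.trans Set.inter_subset_left)]
    _ = ∫⁻ x in C, w x ∂haarProb G := by rw [← hwd, withDensity_apply _ hCm]
    _ ≤ ∫⁻ _ in C, n ∂haarProb G :=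
        setLIntegral_mono measurable_const fun x hx => (hC hx).2
    _ = n * haarProb G C := by simp

/-- The indefinite Pettis integral of `F` is bounded by `n m` on the measurable hull of
`{‖F‖ ≤ n}`; no measurability of `‖F‖` is needed. -/
theorem exists_dominatedOn_of_pettis {F : G → OrliczSpace Φ (haarProb G)}
    (hF : IsPettisIntegrable (haarProb G) F)
    (h : ∀ A : Set G, MeasurableSet A →
      HasPettisIntegral (haarProb G) F A (convolutionMeasure hΦ hμ A)) :
    ∃ a : ℝ≥0∞, a ≠ ∞ ∧ DominatedOn (convolutionMeasure hΦ hμ) (haarProb G) a Set.univ := by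
  set S : ℕ → Set G := fun n => {x | ‖F x‖ ≤ n} with hS
  have hU : (⋃ n, S n) = Set.univ := by
    refine Set.eq_univ_of_forall fun x => ?_
    obtain ⟨n, hn⟩ := exists_nat_ge ‖F x‖
    exact Set.mem_iUnion.2 ⟨n, hn⟩
  obtain ⟨n, hn⟩ : ∃ n, haarProb G (S n) ≠ 0 := by
    by_contra hcon
    push Not at hcon
    have := measure_iUnion_null hcon
    rw [hU, measure_univ] at this
    exact one_ne_zero this
  set B := toMeasurable (haarProb G) (S n) with hB
  have hBm : MeasurableSet B := measurableSet_toMeasurable _ _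
  refine ⟨n, ENNReal.natCast_ne_top n, dominatedOn_univ hΦ hμ hBm
    (by rwa [hB, measure_toMeasurable]) fun C hC hCm => ?_⟩
  have hbd : ∀ x' : StrongDual ℂ (OrliczSpace Φ (haarProb G)), ‖x'‖ ≤ 1 →
      ∀ᵐ t ∂(haarProb G).restrict C, ‖x' (F t)‖ ≤ n := by
    intro x' hx'
    have hnull : NullMeasurableSet {t | ‖x' (F t)‖ ≤ n} (haarProb G) :=
      nullMeasurableSet_le (hF.1 x').aestronglyMeasurable.norm.aemeasurable aemeasurable_const
    have hsub : S n ⊆ {t | ‖x' (F t)‖ ≤ n} := fun t ht =>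
      (x'.le_opNorm (F t)).trans ((mul_le_of_le_one_left (norm_nonneg _) hx').trans ht)
    -- the measurable hull of `S n` is almost contained in every null measurable set containing it
    have h1 : haarProb G (B \ {t | ‖x' (F t)‖ ≤ n}) = 0 := by
      have h2 : haarProb G (B ∩ {t | ‖x' (F t)‖ ≤ n}) = haarProb G B := by
        refine le_antisymm (measure_mono Set.inter_subset_left) ?_
        rw [hB, measure_toMeasurable]
        exact measure_mono (Set.subset_inter (subset_toMeasurable _ _) hsub)
      have h3 := measure_inter_add_sdiff₀ B hnull
      rw [h2] at h3
      have h4 : haarProb G B + haarProb G (B \ {t | ‖x' (F t)‖ ≤ n}) = haarProb G B + 0 := by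
        rw [h3, add_zero]
      exact (ENNReal.add_right_inj (measure_ne_top _ _)).1 h4
    rw [ae_restrict_iff' hCm, ae_iff]
    refine measure_mono_null (fun t ht => ?_) h1
    simp only [Set.mem_ofPred_eq, Classical.not_imp] at ht
    exact ⟨hC ht.1, ht.2⟩
  obtain ⟨x', hx', hx⟩ := exists_dual_vector'' ℂ (convolutionMeasure hΦ hμ C)
  have h1 : ‖∫ t in C, x' (F t) ∂haarProb G‖ ≤ n * (haarProb G).real C :=
    norm_setIntegral_le_of_norm_le_const_ae (measure_lt_top _ _)
      (hbd x' hx')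
  rw [h C hCm x', hx] at h1
  have h2 : ‖convolutionMeasure hΦ hμ C‖ ≤ n * (haarProb G).real C := by simpa using h1
  rw [← _root_.ofReal_norm]
  refine (ENNReal.ofReal_le_ofReal h2).trans (le_of_eq ?_)
  rw [ENNReal.ofReal_mul (Nat.cast_nonneg n), ENNReal.ofReal_natCast]
  simp [Measure.real]

end CompactGroup

/-! ### Compactness of the integration operator implies finite variation -/

namespace VectorIntegration

variable {Ω : Type*} [MeasurableSpace Ω] {X : Type*} [NormedAddCommGroup X] [NormedSpace ℂ X]
  {ν : VectorMeasure Ω X}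

instance isFiniteMeasure_variation (σ : ComplexMeasure Ω) : IsFiniteMeasure σ.variation :=
  ⟨(complexMeasure_variation_univ_ne_top σ).lt_top⟩

theorem scalarMeasure_apply (ν : VectorMeasure Ω X) (x' : StrongDual ℂ X) (A : Set Ω) :
    scalarMeasure ν x' A = x' (ν A) := rfl

theorem hasVectorIntegral_indicator {A B : Set Ω} (hA : MeasurableSet A) (hB : MeasurableSet B) :
    HasVectorIntegral ν (A.indicator 1) B (ν (A ∩ B)) := by
  intro x'
  have h := VectorMeasure.integral_indicator_const (μ := (scalarMeasure ν x').restrict B)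
    (B := ContinuousLinearMap.mul ℝ ℂ) (1 : ℂ) hA
  rw [ContinuousLinearMap.mul_apply', one_mul, VectorMeasure.restrict_apply _ hB hA] at h
  exact h

theorem isVectorIntegrable_indicator {A : Set Ω} (hA : MeasurableSet A) :
    IsVectorIntegrable ν (A.indicator 1) where
  measurable := measurable_one.indicator hA
  weakly _ := (integrable_const (1 : ℂ)).indicator hA
  existsUnique _ hB := ⟨_, hasVectorIntegral_indicator hA hB,
    fun _ hy => HasVectorIntegral.unique hy (hasVectorIntegral_indicator hA hB)⟩

theorem lintegral_enorm_indicator_one (m : Measure Ω) {A : Set Ω} (hA : MeasurableSet A) :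
    ∫⁻ ω, ‖A.indicator (1 : Ω → ℂ) ω‖ₑ ∂m = m A := by
  rw [← lintegral_indicator_one hA]
  refine lintegral_congr fun ω => ?_
  by_cases h : ω ∈ A <;> simp [h]

theorem vectorL1Norm_indicator {A : Set Ω} (hA : MeasurableSet A) :
    vectorL1Norm ν (A.indicator 1) =
      ⨆ x' : {x' : StrongDual ℂ X // ‖x'‖ ≤ 1}, (scalarMeasure ν x').variation A := by
  simp only [vectorL1Norm, lintegral_enorm_indicator_one _ hA]

/-- The indicator of a measurable set as an element of the space of `ν`-integrable functions. -/
noncomputable def PreL1.indicator (ν : VectorMeasure Ω X) {A : Set Ω} (hA : MeasurableSet A) :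
    PreL1 ν :=
  ⟨A.indicator 1, isVectorIntegrable_indicator hA⟩

theorem PreL1.integral_indicator {A : Set Ω} (hA : MeasurableSet A) :
    PreL1.integral (PreL1.indicator ν hA) = ν A := by
  have h := PreL1.hasVectorIntegral_integral (PreL1.indicator ν hA)
  have h' := hasVectorIntegral_indicator (ν := ν) hA MeasurableSet.univ
  rw [Set.inter_univ] at h'
  exact h.unique h'

/-- On a relatively compact set, finitely many functionals of the dual unit ball approximate all of
them. -/
theorem exists_finite_dual_net {K : Set X} (hK : TotallyBounded K) {δ : ℝ} (hδ : 0 < δ) :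
    ∃ T : Set (StrongDual ℂ X), T.Finite ∧
      ∀ x' : StrongDual ℂ X, ‖x'‖ ≤ 1 → ∃ z ∈ T, ∀ y ∈ K, ‖(x' - z) y‖ ≤ 3 * δ := by
  obtain ⟨t, ht, hKt⟩ := Metric.totallyBounded_iff.1 hK δ hδ
  have := ht.fintype
  set e : StrongDual ℂ X → (t → ℂ) := fun x' y => x' y with he
  set s : Set (StrongDual ℂ X) := Metric.closedBall 0 1 with hs
  have hb : Bornology.IsBounded (e '' s) := by
    refine isBounded_iff_forall_norm_le.2 ⟨∑ y : t, ‖(y : X)‖, ?_⟩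
    rintro _ ⟨x', hx', rfl⟩
    refine (pi_norm_le_iff_of_nonneg (by positivity)).2 fun y => ?_
    have h1 : ‖x'‖ ≤ 1 := by simpa [hs] using hx'
    refine (x'.le_opNorm y).trans ((mul_le_of_le_one_left (norm_nonneg _) h1).trans ?_)
    exact Finset.single_le_sum (f := fun y : t => ‖(y : X)‖) (fun _ _ => norm_nonneg _)
      (Finset.mem_univ y)
  have htb : TotallyBounded (e '' s) := hb.isCompact_closure.totallyBounded.subset subset_closure
  obtain ⟨u, hu, huf, hcov⟩ := Metric.finite_approx_of_totallyBounded htb δ hδ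
  obtain ⟨T, hTs, hTf, rfl⟩ := (Set.exists_subset_image_finite_and (f := e) (s := s)
    (p := fun v => v = u)).1 ⟨u, hu, huf, rfl⟩
  refine ⟨T, hTf, fun x' hx' => ?_⟩
  have h1 := hcov ⟨x', by simpa [hs] using hx', rfl⟩
  simp only [Set.mem_iUnion, Set.mem_image, exists_prop] at h1
  obtain ⟨_, ⟨z, hzT, rfl⟩, hz⟩ := h1
  refine ⟨z, hzT, fun y hy => ?_⟩
  have h2 := hKt hy
  simp only [Set.mem_iUnion, exists_prop] at h2
  obtain ⟨y₀, hy₀, hyy⟩ := h2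
  have h3 : ‖(x' - z) y₀‖ ≤ δ := by
    have h4 := (dist_le_pi_dist (e x') (e z) ⟨y₀, hy₀⟩).trans (Metric.mem_ball.1 hz).le
    rwa [dist_eq_norm] at h4
  have h5 : ‖x' - z‖ ≤ 2 := by
    have h6 : ‖z‖ ≤ 1 := by simpa [hs] using hTs hzT
    linarith [norm_sub_le x' z]
  have h7 : ‖y - y₀‖ ≤ δ := by
    rw [← dist_eq_norm]; exact (Metric.mem_ball.1 hyy).le
  have h8 : (x' - z) y = (x' - z) (y - y₀) + (x' - z) y₀ := by rw [map_sub]; ring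
  rw [h8]
  have h9 := (x' - z).le_opNorm (y - y₀)
  have h10 : ‖x' - z‖ * ‖y - y₀‖ ≤ 2 * δ := by gcongr
  linarith [norm_add_le ((x' - z) (y - y₀)) ((x' - z) y₀)]

/-- If the integration operator is compact, then finitely many functionals almost norm the
integrals of all functions of the unit ball of `L¹(ν)`. Hence `‖χ_A‖_ν` is at most twice the sum of
the variations of finitely many scalar measures `⟨ν, z⟩`. -/
theorem variation_lt_top_of_isCompactOperator
    (h : IsCompactOperator (integrationOperator ν)) : ν.variation Set.univ < ∞ := by
  obtain ⟨K, hK, hKI⟩ := h.image_closedBall_subset_compact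
    (f := (integrationOperator ν : L1 ν →ₗ[ℂ] X)) 1
  -- variations are controlled by suprema only up to a factor `4`, and `4 * (3 * δ) ≤ 1 / 2` is
  -- what the absorption argument below needs
  obtain ⟨T, hTf, hT⟩ := exists_finite_dual_net hK.totallyBounded
    (δ := 1 / 72) (by norm_num)
  have hball : ∀ f : PreL1 ν, ‖f‖ ≤ 1 → PreL1.integral f ∈ K := by
    intro f hf
    refine hKI ⟨SeparationQuotient.mk f, ?_, rfl⟩
    simpa using hf
  have hnet : ∀ x' : StrongDual ℂ X, ‖x'‖ ≤ 1 → ∃ z ∈ T, ∀ f : PreL1 ν,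
      ‖(x' - z) (PreL1.integral f)‖ ≤ 1 / 24 * ‖f‖ := by
    intro x' hx'
    obtain ⟨z, hz, hzK⟩ := hT x' hx'
    refine ⟨z, hz, fun f => ?_⟩
    by_cases hf : ‖f‖ = 0
    · have h1 := PreL1.norm_integral_le f
      rw [hf] at h1
      rw [norm_le_zero_iff.1 h1]
      simp [hf]
    · have h2 : PreL1.integral (((‖f‖⁻¹ : ℝ) : ℂ) • f) = ((‖f‖⁻¹ : ℝ) : ℂ) • PreL1.integral f :=
        map_smul (PreL1.integralCLM ν) _ f
      have hfpos : 0 < ‖f‖ := lt_of_le_of_ne (norm_nonneg _) (Ne.symm hf)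
      have h3 := hzK _ (hball (((‖f‖⁻¹ : ℝ) : ℂ) • f) (by
        rw [norm_smul]
        simp [hf]))
      rw [h2, map_smul, norm_smul] at h3
      simp only [Complex.norm_real, norm_inv, norm_norm] at h3
      rw [inv_mul_le_iff₀ hfpos] at h3
      linarith
  set κ : Measure Ω := ∑ z ∈ hTf.toFinset, (scalarMeasure ν z).variation with hκ
  have hκu : κ Set.univ ≠ ∞ := by
    rw [hκ, Measure.finsetSum_apply]
    exact ENNReal.sum_ne_top.2 fun z _ => measure_ne_top _ _
  have key : ∀ A, MeasurableSet A → ‖ν A‖ₑ ≤ ((2 : ℝ≥0∞) • κ) A := by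
    intro A hA
    set N := vectorL1Norm ν (A.indicator 1) with hN
    have hNtop : N ≠ ∞ := vectorL1Norm_ne_top (isVectorIntegrable_indicator hA)
    have hx : ∀ x' : StrongDual ℂ X, ‖x'‖ ≤ 1 →
        (scalarMeasure ν x').variation A ≤ κ A + N / 2 := by
      intro x' hx'
      obtain ⟨z, hz, hzf⟩ := hnet x' hx'
      have h1 : (scalarMeasure ν (x' - z)).variation A ≤ N / 2 := by
        have h2 : ∀ C, MeasurableSet C →
            ‖((scalarMeasure ν (x' - z)).restrict A) C‖ₑ ≤ ENNReal.ofReal (1 / 24) * N := by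
          intro C hC
          have hCA := hC.inter hA
          rw [VectorMeasure.restrict_apply _ hA hC, scalarMeasure_apply,
            ← PreL1.integral_indicator hCA, ← _root_.ofReal_norm]
          refine (ENNReal.ofReal_le_ofReal (hzf _)).trans ?_
          rw [ENNReal.ofReal_mul (by norm_num)]
          gcongr
          change ENNReal.ofReal (vectorL1Norm ν ((C ∩ A).indicator 1)).toReal ≤ N
          rw [ENNReal.ofReal_toReal (vectorL1Norm_ne_top (isVectorIntegrable_indicator hCA)), hN,
            vectorL1Norm_indicator hA, vectorL1Norm_indicator hCA]
          exact iSup_mono fun _ => measure_mono Set.inter_subset_right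
        have h3 := complex_variation_univ_le h2
        rw [VectorMeasure.variation_restrict hA, Measure.restrict_apply_univ] at h3
        refine h3.trans ?_
        clear_value N
        lift N to ℝ≥0 using hNtop
        rw [show ENNReal.ofReal (1 / 24) = ((1 / 24 : ℝ≥0) : ℝ≥0∞) by
          rw [ENNReal.ofReal]; congr 1; ext; simp]
        rw [show (N : ℝ≥0∞) / 2 = ((N / 2 : ℝ≥0) : ℝ≥0∞) by simp]
        norm_cast
        rw [← NNReal.coe_le_coe]
        push_cast
        have := N.2
        change (0 : ℝ) ≤ (N : ℝ) at this
        linarith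
      have h4 : scalarMeasure ν x' = scalarMeasure ν z + scalarMeasure ν (x' - z) := by
        ext C _
        change x' (ν C) = z (ν C) + (x' - z) (ν C)
        simp
      rw [h4]
      refine (VectorMeasure.variation_add_le A).trans ?_
      rw [Measure.add_apply]
      refine add_le_add ?_ h1
      rw [hκ, Measure.finsetSum_apply]
      exact Finset.single_le_sum (f := fun z => (scalarMeasure ν z).variation A)
        (fun _ _ => zero_le) (hTf.mem_toFinset.2 hz)
    -- the supremum over `x'` bounds `N` by itself, and `N / 2` is finite, so it can be absorbed
    have h5 : N ≤ κ A + N / 2 := by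
      conv_lhs => rw [hN, vectorL1Norm_indicator hA]
      exact iSup_le fun x' => hx x' x'.2
    have h6 : N / 2 ≤ κ A := by
      have h7 : N / 2 ≠ ∞ := ENNReal.div_ne_top hNtop (by norm_num)
      refine (ENNReal.add_le_add_iff_right h7).1 ?_
      rwa [ENNReal.add_halves]
    have h8 : ‖ν A‖ₑ ≤ N := by
      obtain ⟨x', hx', hxn⟩ := exists_dual_vector'' ℂ (ν A)
      have h9 : ‖ν A‖ₑ ≤ (scalarMeasure ν x').variation A := by
        refine le_trans (le_of_eq ?_) (VectorMeasure.enorm_measure_le_variation _ A)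
        rw [scalarMeasure_apply, hxn]
        simp [← _root_.ofReal_norm]
      rw [hN, vectorL1Norm_indicator hA]
      exact h9.trans (le_iSup (fun x' : {x' : StrongDual ℂ X // ‖x'‖ ≤ 1} =>
        (scalarMeasure ν x').variation A) ⟨x', hx'⟩)
    calc ‖ν A‖ₑ ≤ N := h8
      _ = 2 * (N / 2) := (ENNReal.mul_div_cancel (by norm_num) (by norm_num)).symm
      _ ≤ 2 * κ A := by gcongr
      _ = ((2 : ℝ≥0∞) • κ) A := by simp
  refine (VectorMeasure.variation_le_of_forall_enorm_le key Set.univ).trans_lt ?_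
  rw [Measure.smul_apply, smul_eq_mul]
  exact (ENNReal.mul_ne_top (by norm_num) hκu).lt_top

end VectorIntegration

/-! ### Young's inequality and Fatou's lemma for the Luxemburg functional; averaging -/

/-- Young's inequality. -/
theorem YoungFunction.mul_le_add (Φ : YoungFunction) (x y : ℝ≥0∞) :
    x * y ≤ Φ x + Φ.complementary y := by
  by_cases hx : x = ∞
  · rw [hx, Φ.map_top]; simp
  lift x to ℝ≥0 using hx
  rw [add_comm]
  exact tsub_le_iff_right.1 (le_iSup (fun x : ℝ≥0 => ((x : ℝ≥0∞) * y - Φ x)) x)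

/-- Bounded sets of the Orlicz space are uniformly integrable, with an explicit modulus. -/
theorem luxemburg.mul_setLIntegral_le {α : Type*} [MeasurableSpace α] {Φ : YoungFunction}
    {m : Measure α} {w : α → ℝ≥0∞} {k : ℝ≥0∞} (hk : luxemburg Φ m w < k) (hk' : k ≠ ∞)
    (R : ℝ≥0) (V : Set α) :
    R * ∫⁻ x in V, w x ∂m ≤ k * (1 + Φ.complementary R * m V) := by
  have hk0 : k ≠ 0 := (zero_le.trans_lt hk).ne'
  have h1 : ∫⁻ x in V, w x / k * R ∂m ≤ 1 + Φ.complementary R * m V := by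
    calc ∫⁻ x in V, w x / k * R ∂m
        ≤ ∫⁻ x in V, (Φ (w x / k) + Φ.complementary R) ∂m :=
          lintegral_mono fun x => Φ.mul_le_add _ _
      _ = ∫⁻ x in V, Φ (w x / k) ∂m + Φ.complementary R * m V := by
          rw [lintegral_add_right _ measurable_const]; simp
      _ ≤ 1 + Φ.complementary R * m V := by
          gcongr
          exact (setLIntegral_le_lintegral _ _).trans (luxemburg.lintegral_le_one hk)
  have h2 : ∀ x, (R : ℝ≥0∞) * w x = k * (w x / k * R) := fun x => by
    rw [← mul_assoc, ENNReal.mul_div_cancel hk0 hk', mul_comm]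
  rw [← lintegral_const_mul' _ _ ENNReal.coe_ne_top]
  simp_rw [h2]
  rw [lintegral_const_mul' _ _ hk']
  gcongr

/-- Fatou's lemma for the Luxemburg functional. -/
theorem luxemburg.le_of_tendsto_ae {α : Type*} [MeasurableSpace α] {Φ : YoungFunction}
    {m : Measure α} {w : ℕ → α → ℝ≥0∞} {v : α → ℝ≥0∞} (hw : ∀ n, AEMeasurable (w n) m)
    (hv : ∀ᵐ x ∂m, Tendsto (fun n => w n x) atTop (𝓝 (v x))) {C : ℝ≥0∞}
    (hC : ∀ n, luxemburg Φ m (w n) ≤ C) : luxemburg Φ m v ≤ C := by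
  have h1 : luxemburg Φ m (fun x => ⨆ n, ⨅ k : ℕ, w (k + n) x) ≤ C := by
    refine luxemburg.iSup_le_of_monotone (w := fun n x => ⨅ k : ℕ, w (k + n) x)
      (fun n => AEMeasurable.iInf fun k => hw _) (fun x i j hij => ?_) (fun n => ?_)
    · refine le_iInf fun k => ?_
      have h2 := iInf_le (fun k : ℕ => w (k + i) x) (k + (j - i))
      rwa [show k + (j - i) + i = k + j by omega] at h2
    · refine (luxemburg.mono_ae (Eventually.of_forall fun x => ?_)).trans (hC n)
      have h2 := iInf_le (fun k : ℕ => w (k + n) x) 0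
      rwa [zero_add] at h2
  refine le_of_eq_of_le (luxemburg.congr_ae ?_) h1
  filter_upwards [hv] with x hx
  rw [← hx.liminf_eq, liminf_eq_iSup_iInf_of_nat']

namespace CompactGroup

variable {G : Type*} [Group G] [TopologicalSpace G] [IsTopologicalGroup G] [CompactSpace G]
  [MeasurableSpace G] [BorelSpace G]

/-- The Borel `σ`-algebra of `G × G` may be larger than the product of the Borel `σ`-algebras, but
`1` has a basis of neighbourhoods `U` for which `s⁻¹ t ∈ U` is a product measurable relation:
superlevel sets of continuous functions. -/
theorem exists_nhds_one_measurableSet_prod [T2Space G] {W : Set G} (hW : W ∈ 𝓝 (1 : G)) :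
    ∃ U ⊆ W, U ∈ 𝓝 (1 : G) ∧ MeasurableSet U ∧ MeasurableSet {p : G × G | p.1⁻¹ * p.2 ∈ U} := by
  obtain ⟨e, he0, he1, -⟩ := exists_continuous_zero_one_of_isClosed
    (s := (interior W)ᶜ) (t := {(1 : G)}) isOpen_interior.isClosed_compl isClosed_singleton
    (by simpa using mem_interior_iff_mem_nhds.2 hW)
  have hU : IsOpen {x : G | 1 / 2 < e x} := isOpen_lt continuous_const e.continuous
  refine ⟨{x | 1 / 2 < e x}, fun x hx => ?_, hU.mem_nhds ?_, hU.measurableSet, ?_⟩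
  · by_contra hxW
    have h1 : e x = 0 := he0 fun h => hxW (interior_subset h)
    rw [Set.mem_ofPred_eq, h1] at hx
    norm_num at hx
  · have h1 : e 1 = 1 := he1 rfl
    rw [Set.mem_ofPred_eq, h1]
    norm_num
  · have hc : Continuous fun p : G × G => e (p.1⁻¹ * p.2) :=
      e.continuous.comp (continuous_fst.inv.mul continuous_snd)
    have hm := HasCompactSupport.measurable_of_prod hc (HasCompactSupport.of_compactSpace _)
    exact measurableSet_lt measurable_const hm

/-- Tonelli's theorem for the relation `s⁻¹ t ∈ U`. -/
theorem setLIntegral_translate {q : Measure G} [IsFiniteMeasure q] {U V : Set G}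
    (hU : MeasurableSet U) (hU2 : MeasurableSet {p : G × G | p.1⁻¹ * p.2 ∈ U}) :
    ∫⁻ t in V, q {s : G | s⁻¹ * t ∈ U} ∂haarProb G =
      ∫⁻ s, haarProb G ({t : G | s⁻¹ * t ∈ U} ∩ V) ∂q := by
  have h1 : ∀ t, q {s : G | s⁻¹ * t ∈ U} =
      ∫⁻ s, {p : G × G | p.1⁻¹ * p.2 ∈ U}.indicator (1 : G × G → ℝ≥0∞) (s, t) ∂q := fun t => by
    rw [← lintegral_indicator_one (measurableSet_translate hU t)]
    rfl
  have h2 : ∀ s, haarProb G ({t : G | s⁻¹ * t ∈ U} ∩ V) =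
      ∫⁻ t in V, {p : G × G | p.1⁻¹ * p.2 ∈ U}.indicator (1 : G × G → ℝ≥0∞) (s, t)
        ∂haarProb G := fun s => by
    have hm : MeasurableSet {t : G | s⁻¹ * t ∈ U} := measurable_const_mul s⁻¹ hU
    rw [← Measure.restrict_apply hm, ← lintegral_indicator_one hm]
    rfl
  simp_rw [h1, h2]
  exact lintegral_lintegral_swap
    (measurable_one.indicator (measurable_swap hU2)).aemeasurable

theorem haarProb_translate {U : Set G} (t : G) :
    haarProb G {s : G | s⁻¹ * t ∈ U} = haarProb G U := by
  have h1 : {s : G | s⁻¹ * t ∈ U} = ((fun s => s * t) ⁻¹' U)⁻¹ := by ext s; simp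
  rw [h1, Measure.measure_inv, measure_preimage_mul_right]

theorem lintegral_translate_of_measurableSet_prod {q : Measure G} [IsFiniteMeasure q] {U : Set G}
    (hU : MeasurableSet U) (hU2 : MeasurableSet {p : G × G | p.1⁻¹ * p.2 ∈ U}) :
    ∫⁻ t, q {s : G | s⁻¹ * t ∈ U} ∂haarProb G = haarProb G U * q Set.univ := by
  have h := setLIntegral_translate (q := q) (V := Set.univ) hU hU2
  rw [Measure.restrict_univ] at h
  rw [h]
  have : ∀ s : G, haarProb G ({t : G | s⁻¹ * t ∈ U} ∩ Set.univ) = haarProb G U := fun s => by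
    rw [Set.inter_univ]
    exact measure_preimage_mul _ s⁻¹ U
  simp_rw [this, lintegral_const]

end CompactGroup

/-! ### Dominated convolution measures come from measures without singular part -/

namespace CompactGroup

variable {G : Type*} [Group G] [TopologicalSpace G] [IsTopologicalGroup G] [CompactSpace G]
  [MeasurableSpace G] [BorelSpace G]

/-- If `K U ⊆ V` and `V U⁻¹ ⊆ W`, then averaging the measures `q (t U⁻¹)` over `t ∈ V` gives
something between `q K` and `q W`. -/
theorem setLIntegral_translate_mem_Icc {q : Measure G} [IsFiniteMeasure q] {K U V W : Set G}
    (hU : MeasurableSet U) (hU2 : MeasurableSet {p : G × G | p.1⁻¹ * p.2 ∈ U})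
    (hK : MeasurableSet K) (hW : MeasurableSet W)
    (hKV : ∀ s ∈ K, ∀ t, s⁻¹ * t ∈ U → t ∈ V) (hVW : ∀ t ∈ V, ∀ s, s⁻¹ * t ∈ U → s ∈ W) :
    ∫⁻ t in V, q {s : G | s⁻¹ * t ∈ U} ∂haarProb G ∈
      Set.Icc (haarProb G U * q K) (haarProb G U * q W) := by
  rw [setLIntegral_translate hU hU2]
  have hsU : ∀ s : G, haarProb G {t : G | s⁻¹ * t ∈ U} = haarProb G U := fun s =>
    measure_preimage_mul _ s⁻¹ U
  constructor
  · rw [← setLIntegral_const, ← lintegral_indicator hK]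
    refine lintegral_mono fun s => ?_
    by_cases hs : s ∈ K
    · rw [Set.indicator_of_mem hs, ← hsU s]
      exact measure_mono fun t ht => ⟨ht, hKV s hs t ht⟩
    · simp [hs]
  · rw [← setLIntegral_const, ← lintegral_indicator hW]
    refine lintegral_mono fun s => ?_
    by_cases hs : s ∈ W
    · rw [Set.indicator_of_mem hs, ← hsU s]
      exact measure_mono Set.inter_subset_left
    · have : {t : G | s⁻¹ * t ∈ U} ∩ V = ∅ := by
        ext t
        simp only [Set.mem_inter_iff, Set.mem_ofPred_eq, Set.mem_empty_iff_false, iff_false,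
          not_and]
        exact fun h1 h2 => hs (hVW t h2 s h1)
      simp [this]

/-- The average of `σ (t U⁻¹)` over `t ∈ V` differs from `σ K` by at most the mass of `W \ K`. This
follows from the bounds for the positive and the negative part of `σ`. -/
theorem enorm_signed_le_of_translate {μ : ComplexMeasure G} (hμ : μ.variation.Regular)
    {σ : SignedMeasure G} (hσ : σ.variation ≤ μ.variation)
    {K U V W : Set G} (hU : MeasurableSet U)
    (hU2 : MeasurableSet {p : G × G | p.1⁻¹ * p.2 ∈ U})
    (hK : MeasurableSet K) (hW : MeasurableSet W) (hKW : K ⊆ W)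
    (hKV : ∀ s ∈ K, ∀ t, s⁻¹ * t ∈ U → t ∈ V) (hVW : ∀ t ∈ V, ∀ s, s⁻¹ * t ∈ U → s ∈ W) :
    haarProb G U * ‖σ K‖ₑ ≤ ∫⁻ t in V, ‖σ {s : G | s⁻¹ * t ∈ U}‖ₑ ∂haarProb G +
      haarProb G U * μ.variation (W \ K) := by
  have hμf : IsFiniteMeasure μ.variation := ⟨(complexMeasure_variation_univ_ne_top μ).lt_top⟩
  set p := σ.toJordanDecomposition.posPart with hp
  set n := σ.toJordanDecomposition.negPart with hn
  have htv : p + n ≤ μ.variation := by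
    rw [← SignedMeasure.totalVariation_eq_variation] at hσ
    exact hσ
  have hpμ : p ≤ μ.variation := (Measure.le_add_right le_rfl).trans htv
  have hnμ : n ≤ μ.variation := (Measure.le_add_left le_rfl).trans htv
  have hσA : ∀ A, MeasurableSet A → σ A = p.real A - n.real A := fun A hA =>
    σ.apply_eq_posPart_real_sub_negPart_real hA
  set c := (haarProb G).real U with hc
  have hc0 : 0 ≤ c := measureReal_nonneg
  have hcU : haarProb G U = ENNReal.ofReal c := (ofReal_measureReal).symm
  set v := μ.variation.real (W \ K) with hv
  have hpart : ∀ q : Measure G, IsFiniteMeasure q → q ≤ μ.variation →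
      c * q.real K ≤ (∫⁻ t in V, q {s : G | s⁻¹ * t ∈ U} ∂haarProb G).toReal ∧
      (∫⁻ t in V, q {s : G | s⁻¹ * t ∈ U} ∂haarProb G).toReal ≤ c * q.real K + c * v := by
    intro q hq hqμ
    obtain ⟨h1, h2⟩ := setLIntegral_translate_mem_Icc (q := q) hU hU2 hK hW hKV hVW
    have htop : haarProb G U * q W ≠ ∞ := ENNReal.mul_ne_top (measure_ne_top _ _)
      (measure_ne_top _ _)
    have h3 := ENNReal.toReal_mono (ne_top_of_le_ne_top htop h2) h1
    have h4 := ENNReal.toReal_mono htop h2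
    rw [ENNReal.toReal_mul] at h3 h4
    refine ⟨h3, h4.trans ?_⟩
    have h5 : q.real W = q.real K + q.real (W \ K) := by
      rw [measureReal_sdiff hKW hK]; ring
    have h6 : q.real (W \ K) ≤ v :=
      ENNReal.toReal_mono (measure_ne_top _ _) (hqμ _)
    change c * q.real W ≤ _
    rw [h5, mul_add]
    gcongr
  obtain ⟨hp1, hp2⟩ := hpart p inferInstance hpμ
  obtain ⟨hn1, hn2⟩ := hpart n inferInstance hnμ
  have hfin : ∀ q : Measure G, IsFiniteMeasure q → q ≤ μ.variation →
      Integrable (fun t => q.real {s : G | s⁻¹ * t ∈ U}) ((haarProb G).restrict V) ∧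
      ∫ t in V, q.real {s : G | s⁻¹ * t ∈ U} ∂haarProb G =
        (∫⁻ t in V, q {s : G | s⁻¹ * t ∈ U} ∂haarProb G).toReal := by
    intro q hq hqμ
    have hm := measurable_translate hμ hqμ hU
    have hi := integral_toReal (μ := (haarProb G).restrict V) hm.aemeasurable
      (Eventually.of_forall fun t => measure_lt_top _ _)
    refine ⟨Integrable.of_bound hm.ennreal_toReal.aestronglyMeasurable (q.real Set.univ)
      (Eventually.of_forall fun t => ?_), hi⟩
    rw [Real.norm_of_nonneg measureReal_nonneg]
    exact measureReal_mono (Set.subset_univ _)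
  obtain ⟨hpi, hpe⟩ := hfin p inferInstance hpμ
  obtain ⟨hni, hne⟩ := hfin n inferInstance hnμ
  have hint : ‖∫ t in V, σ {s : G | s⁻¹ * t ∈ U} ∂haarProb G‖ₑ ≤
      ∫⁻ t in V, ‖σ {s : G | s⁻¹ * t ∈ U}‖ₑ ∂haarProb G := enorm_integral_le_lintegral_enorm _
  simp_rw [hσA _ (measurableSet_translate hU _)] at hint ⊢
  rw [integral_sub hpi hni, hpe, hne] at hint
  refine le_trans ?_ (add_le_add_left hint _)
  have hvU : μ.variation (W \ K) = ENNReal.ofReal v := (ofReal_measureReal).symm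
  rw [hσA K hK, hcU, hvU, ← _root_.ofReal_norm, ← _root_.ofReal_norm, ← ENNReal.ofReal_mul hc0,
    ← ENNReal.ofReal_mul hc0, ← ENNReal.ofReal_add (norm_nonneg _)
      (mul_nonneg hc0 measureReal_nonneg), Real.norm_eq_abs, Real.norm_eq_abs]
  refine ENNReal.ofReal_le_ofReal ?_
  rw [← abs_of_nonneg hc0, ← abs_mul, abs_of_nonneg hc0, abs_le, mul_sub]
  generalize (∫⁻ t in V, p {s : G | s⁻¹ * t ∈ U} ∂haarProb G).toReal = P at *
  generalize (∫⁻ t in V, n {s : G | s⁻¹ * t ∈ U} ∂haarProb G).toReal = N at *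
  constructor
  · linarith [neg_abs_le (P - N)]
  · linarith [le_abs_self (P - N)]

variable {Φ : YoungFunction} (hΦ : IsDeltaTwo Φ) {μ : ComplexMeasure G}
  (hμ : μ.variation.Regular)

open scoped Pointwise in
/-- A domination `‖ν C‖ ≤ a m(C)` makes the averages `(1 / m U) μ (t U⁻¹)`, for `U` shrinking to
`1`, uniformly integrable. Hence `μ` cannot charge a compact null set. -/
theorem signed_apply_eq_zero_of_isCompact [T2Space G]
    (hΨ : ∀ x : ℝ≥0, Φ.complementary x ≠ ∞) {a : ℝ≥0∞} (ha : a ≠ ∞)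
    (hd : DominatedOn (convolutionMeasure hΦ hμ) (haarProb G) a Set.univ)
    {σ : SignedMeasure G} (hσ : σ.variation ≤ μ.variation)
    (hσμ : ∀ A, ‖σ A‖ₑ ≤ ‖μ A‖ₑ) {K : Set G} (hK : IsCompact K) (hK0 : haarProb G K = 0) :
    σ K = 0 := by
  have hμf : IsFiniteMeasure μ.variation := ⟨(complexMeasure_variation_univ_ne_top μ).lt_top⟩
  have hKm : MeasurableSet K := hK.measurableSet
  have key : ∀ R : ℝ≥0, R ≠ 0 → ‖σ K‖ₑ ≤ (a + 1) * 2 / R + 1 / R := by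
    intro R hR
    have hR' : (R : ℝ≥0∞) ≠ 0 := by simpa using hR
    set L := Φ.complementary R with hL
    have hLt : L ≠ ∞ := hΨ R
    -- `W` is so small that `Ψ(R) m(W) ≤ 1`, and that `|μ|` hardly charges `W \ K`
    obtain ⟨W₁, hKW₁, hW₁, hmW₁⟩ := K.exists_isOpen_lt_of_lt (μ := haarProb G) ((L + 1)⁻¹)
      (by rw [hK0]; exact ENNReal.inv_pos.2 (by finiteness))
    obtain ⟨W₂, hKW₂, hW₂, hmW₂⟩ := K.exists_isOpen_lt_add (μ := μ.variation)
      (measure_ne_top _ _) (ε := 1 / R) (ENNReal.div_pos one_ne_zero ENNReal.coe_ne_top).ne'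
    set W := W₁ ∩ W₂ with hW
    have hWo : IsOpen W := hW₁.inter hW₂
    have hKW : K ⊆ W := Set.subset_inter hKW₁ hKW₂
    have hWK : μ.variation (W \ K) ≤ 1 / R := by
      rw [measure_sdiff hKW hKm.nullMeasurableSet (measure_ne_top _ _)]
      exact tsub_le_iff_left.2 ((measure_mono Set.inter_subset_right).trans hmW₂.le)
    obtain ⟨O, hO, hKO⟩ := compact_open_separated_mul_right hK hWo hKW
    obtain ⟨O', hO'n, hO'O⟩ := exists_nhds_split_inv hO
    have hO'1 : (1 : G) ∈ O' := mem_of_mem_nhds hO'n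
    obtain ⟨U, hUO, hU1, hUm, hU2⟩ := exists_nhds_one_measurableSet_prod hO'n
    have hU0 : haarProb G U ≠ 0 := (Measure.measure_pos_of_mem_nhds _ hU1).ne'
    set V := K * O' with hV
    have hKV : ∀ s ∈ K, ∀ t, s⁻¹ * t ∈ U → t ∈ V := fun s hs t ht =>
      ⟨s, hs, s⁻¹ * t, hUO ht, by group⟩
    have hVW : ∀ t ∈ V, ∀ s, s⁻¹ * t ∈ U → s ∈ W := by
      rintro _ ⟨k, hk, x, hx, rfl⟩ s hs
      refine hKO ⟨k, hk, x / (s⁻¹ * (k * x)), hO'O x hx _ (hUO hs), ?_⟩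
      simp [div_eq_mul_inv, mul_assoc]
    have hVW' : V ⊆ W := by
      rintro _ ⟨k, hk, x, hx, rfl⟩
      exact hKO ⟨k, hk, x / 1, hO'O x hx 1 hO'1, by simp⟩
    have h1 := enorm_signed_le_of_translate hμ hσ hUm hU2 hKm hWo.measurableSet hKW hKV hVW
    have h2 : luxemburg Φ (haarProb G) (fun t => ‖μ {s : G | s⁻¹ * t ∈ U}‖ₑ) <
        (a + 1) * haarProb G U := by
      rw [← enorm_convolutionMeasure hΦ hμ hUm]
      refine (hd U (Set.subset_univ _) hUm).trans_lt ?_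
      rw [add_mul, one_mul]
      exact ENNReal.lt_add_right (ENNReal.mul_ne_top ha (measure_ne_top _ _)) hU0
    have h3 := luxemburg.mul_setLIntegral_le h2
      (ENNReal.mul_ne_top (by finiteness) (measure_ne_top _ _)) R V
    have h4 : L * haarProb G V ≤ 1 := by
      calc L * haarProb G V ≤ (L + 1) * (L + 1)⁻¹ := by
            gcongr
            · exact le_self_add
            · exact ((measure_mono hVW').trans (measure_mono Set.inter_subset_left)).trans hmW₁.le
        _ = 1 := ENNReal.mul_inv_cancel (by simp) (by finiteness)
    have h5 : ∫⁻ t in V, ‖σ {s : G | s⁻¹ * t ∈ U}‖ₑ ∂haarProb G ≤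
        haarProb G U * ((a + 1) * 2 / R) := by
      calc ∫⁻ t in V, ‖σ {s : G | s⁻¹ * t ∈ U}‖ₑ ∂haarProb G
          ≤ ∫⁻ t in V, ‖μ {s : G | s⁻¹ * t ∈ U}‖ₑ ∂haarProb G :=
            lintegral_mono fun t => hσμ _
        _ ≤ ((a + 1) * haarProb G U * 2) / R := by
            rw [ENNReal.le_div_iff_mul_le (Or.inl hR') (Or.inl ENNReal.coe_ne_top), mul_comm]
            refine h3.trans ?_
            gcongr
            calc 1 + L * haarProb G V ≤ 1 + 1 := by gcongr
              _ = 2 := by norm_num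
        _ = haarProb G U * ((a + 1) * 2 / R) := by
            rw [← mul_div_assoc]; congr 1; ring
    have h6 : haarProb G U * ‖σ K‖ₑ ≤ haarProb G U * ((a + 1) * 2 / R + 1 / R) := by
      rw [mul_add]
      exact h1.trans (add_le_add h5 (by gcongr))
    exact (ENNReal.mul_le_mul_iff_right hU0 (measure_ne_top _ _)).1 h6
  have hlim : Tendsto (fun n : ℕ => (a + 1) * 2 / ((n + 1 : ℕ) : ℝ≥0∞) + 1 / ((n + 1 : ℕ) : ℝ≥0∞))
      atTop (𝓝 (0 + 0)) := by
    have h1 : Tendsto (fun n : ℕ => (((n + 1 : ℕ) : ℝ≥0∞))⁻¹) atTop (𝓝 0) :=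
      ENNReal.tendsto_inv_nat_nhds_zero.comp (tendsto_add_atTop_nat 1)
    have h2 : ∀ b : ℝ≥0∞, b ≠ ∞ → Tendsto (fun n : ℕ => b / ((n + 1 : ℕ) : ℝ≥0∞)) atTop (𝓝 0) := by
      intro b hb
      have := ENNReal.Tendsto.const_mul (a := b) h1 (Or.inr hb)
      simpa [div_eq_mul_inv] using this
    exact (h2 _ (by finiteness)).add (h2 _ (by finiteness))
  rw [add_zero] at hlim
  have h0 : ‖σ K‖ₑ ≤ 0 := ge_of_tendsto' hlim fun n => by
    have := key ((n + 1 : ℕ) : ℝ≥0) (by positivity)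
    simpa using this
  exact enorm_eq_zero.1 (le_antisymm h0 zero_le)

/-- By inner regularity of `|μ|`, the vanishing on compact null sets extends to all null sets. -/
theorem signed_apply_eq_zero [T2Space G]
    (hΨ : ∀ x : ℝ≥0, Φ.complementary x ≠ ∞) {a : ℝ≥0∞} (ha : a ≠ ∞)
    (hd : DominatedOn (convolutionMeasure hΦ hμ) (haarProb G) a Set.univ)
    {σ : SignedMeasure G} (hσ : σ.variation ≤ μ.variation)
    (hσμ : ∀ A, ‖σ A‖ₑ ≤ ‖μ A‖ₑ) {N : Set G} (hN0 : haarProb G N = 0) :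
    σ N = 0 := by
  by_cases hN : MeasurableSet N
  swap
  · exact σ.not_measurable hN
  have hμf : IsFiniteMeasure μ.variation := ⟨(complexMeasure_variation_univ_ne_top μ).lt_top⟩
  refine enorm_eq_zero.1 (le_antisymm (ENNReal.le_of_forall_pos_le_add fun ε hε _ => ?_) zero_le)
  obtain ⟨K, hKN, hK, hlt⟩ := hN.exists_isCompact_lt_add (μ := μ.variation) (measure_ne_top _ _)
    (ε := ε) (by simpa using hε.ne')
  have h1 := signed_apply_eq_zero_of_isCompact hΦ hμ hΨ ha hd hσ hσμ hK (measure_mono_null hKN hN0)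
  have h2 : σ N = σ (N \ K) := by
    rw [VectorMeasure.of_sdiff hK.measurableSet hN hKN, h1, sub_zero]
  rw [h2, zero_add]
  calc ‖σ (N \ K)‖ₑ ≤ μ.variation (N \ K) :=
        (VectorMeasure.enorm_measure_le_variation _ _).trans (hσ _)
    _ ≤ ε := by
        rw [measure_sdiff hKN hK.measurableSet.nullMeasurableSet (measure_ne_top _ _)]
        exact tsub_le_iff_left.2 hlt.le

end CompactGroup

/-! ### The density of a measure with dominated convolution measure -/

/-- Radon–Nikodym theorem for complex measures, with absolute continuity stated for the real and the
imaginary part. -/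
theorem complexMeasure_exists_density {Ω : Type*} [MeasurableSpace Ω] {m : Measure Ω}
    [IsFiniteMeasure m] {μ : ComplexMeasure Ω}
    (hre : ∀ N, m N = 0 → ComplexMeasure.re μ N = 0)
    (him : ∀ N, m N = 0 → ComplexMeasure.im μ N = 0) :
    ∃ f : Ω → ℂ, Integrable f m ∧ ∀ A, MeasurableSet A → μ A = ∫ x in A, f x ∂m := by
  have hi := ComplexMeasure.integrable_rnDeriv μ m
  refine ⟨μ.rnDeriv m, hi, fun A hA => ?_⟩
  have key : ∀ σ : SignedMeasure Ω, (∀ N, m N = 0 → σ N = 0) →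
      σ A = ∫ x in A, σ.rnDeriv m x ∂m := by
    intro σ hσ
    have h1 : σ ≪ᵥ m.toENNRealVectorMeasure := by
      refine VectorMeasure.AbsolutelyContinuous.mk fun N hN h => hσ N ?_
      rwa [Measure.toENNRealVectorMeasure_apply_measurable hN] at h
    have h2 := (SignedMeasure.absolutelyContinuous_iff_withDensityᵥ_rnDeriv_eq σ m).1 h1
    conv_lhs => rw [← h2]
    exact withDensityᵥ_apply (SignedMeasure.integrable_rnDeriv _ _) hA
  refine Complex.ext ?_ ?_
  · exact (key _ hre).trans (Complex.reCLM.integral_comp_comm hi.integrableOn)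
  · exact (key _ him).trans (Complex.imCLM.integral_comp_comm hi.integrableOn)

namespace CompactGroup

variable {G : Type*} [Group G] [TopologicalSpace G] [IsTopologicalGroup G] [CompactSpace G]
  [MeasurableSpace G] [BorelSpace G]

/-- The averages `(1 / m U) ∫_{t U⁻¹} f dm` converge to `f` in `L¹` as `U` shrinks to `1`. -/
theorem exists_nhds_lintegral_average_sub_le {f : G → ℂ} (hf : Integrable f (haarProb G))
    {ε : ℝ≥0} (hε : ε ≠ 0) :
    ∃ W ∈ 𝓝 (1 : G), ∀ U ⊆ W, MeasurableSet U → MeasurableSet {p : G × G | p.1⁻¹ * p.2 ∈ U} →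
      ∫⁻ t, ‖∫ s in {s : G | s⁻¹ * t ∈ U}, f s ∂haarProb G -
        (haarProb G).real U * f t‖ₑ ∂haarProb G ≤ haarProb G U * (3 * ε) := by
  obtain ⟨h, hh, hhi⟩ := hf.exists_boundedContinuous_lintegral_sub_le (ε := ε) (by simpa using hε)
  have hW : ∀ᶠ u : G in 𝓝 1, ∀ s ∈ (Set.univ : Set G), ‖h s - h (s * u)‖ < ε := by
    refine isCompact_univ.eventually_forall_of_forall_eventually fun s _ => ?_
    have hc : Continuous fun z : G × G => ‖h z.2 - h (z.2 * z.1)‖ :=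
      ((h.continuous.comp continuous_snd).sub
        (h.continuous.comp (continuous_snd.mul continuous_fst))).norm
    refine hc.continuousAt.eventually_lt continuousAt_const ?_
    simpa using pos_iff_ne_zero.2 hε
  refine ⟨_, hW, fun U hUW hU hU2 => ?_⟩
  have hg : Integrable (fun s => f s - h s) (haarProb G) := hf.sub hhi
  have hgm : AEMeasurable (fun s => ‖f s - h s‖ₑ) (haarProb G) := hg.aestronglyMeasurable.enorm
  set q : Measure G := (haarProb G).withDensity (fun s => ‖f s - h s‖ₑ) with hq
  have hqu : q Set.univ = ∫⁻ s, ‖f s - h s‖ₑ ∂haarProb G := by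
    rw [hq, withDensity_apply _ MeasurableSet.univ, Measure.restrict_univ]
  have hqf : IsFiniteMeasure q := ⟨by rw [hqu]; exact hg.2⟩
  have hpt : ∀ t, ‖∫ s in {s : G | s⁻¹ * t ∈ U}, f s ∂haarProb G -
      (haarProb G).real U * f t‖ₑ ≤ q {s : G | s⁻¹ * t ∈ U} +
        (haarProb G U * ε + haarProb G U * ‖f t - h t‖ₑ) := by
    intro t
    set S := {s : G | s⁻¹ * t ∈ U} with hS
    have hSm : MeasurableSet S := measurableSet_translate hU t
    have hSU : haarProb G S = haarProb G U := haarProb_translate t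
    have hSr : (haarProb G).real S = (haarProb G).real U := by rw [Measure.real, hSU]; rfl
    have h1 : ∫ s in S, f s ∂haarProb G - (haarProb G).real U * f t =
        ∫ s in S, (f s - h s) ∂haarProb G + (∫ s in S, (h s - h t) ∂haarProb G +
          -((haarProb G).real U * (f t - h t))) := by
      rw [integral_sub hf.integrableOn hhi.integrableOn,
        integral_sub hhi.integrableOn (integrable_const _), setIntegral_const, hSr,
        Complex.real_smul]
      ring
    rw [h1]
    refine (enorm_add_le _ _).trans (add_le_add ?_ ((enorm_add_le _ _).trans (add_le_add ?_ ?_)))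
    · rw [hq, withDensity_apply _ hSm]
      exact enorm_integral_le_lintegral_enorm _
    · refine (enorm_integral_le_lintegral_enorm _).trans ?_
      rw [← hSU, mul_comm, ← setLIntegral_const]
      refine setLIntegral_mono measurable_const fun s hs => ?_
      have h2 := hUW hs s (Set.mem_univ s)
      rw [mul_inv_cancel_left] at h2
      rw [enorm_eq_nnnorm]
      exact_mod_cast h2.le
    · rw [enorm_neg, enorm_mul]
      refine le_of_eq ?_
      congr 1
      rw [← _root_.ofReal_norm, Complex.norm_real, Real.norm_of_nonneg measureReal_nonneg,
        ofReal_measureReal]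
  have hqm : ∫⁻ t, q {s : G | s⁻¹ * t ∈ U} ∂haarProb G = haarProb G U * q Set.univ :=
    lintegral_translate_of_measurableSet_prod hU hU2
  have hbm : AEMeasurable (fun t => haarProb G U * ε + haarProb G U * ‖f t - h t‖ₑ)
      (haarProb G) := aemeasurable_const.add (hgm.const_mul _)
  calc _ ≤ ∫⁻ t, (q {s : G | s⁻¹ * t ∈ U} +
        (haarProb G U * ε + haarProb G U * ‖f t - h t‖ₑ)) ∂haarProb G := lintegral_mono hpt
    _ = haarProb G U * q Set.univ + (haarProb G U * ε + haarProb G U * q Set.univ) := by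
        rw [lintegral_add_right' _ hbm, hqm,
          lintegral_add_left measurable_const, lintegral_const,
          measure_univ (μ := haarProb G), mul_one, lintegral_const_mul' _ _ (measure_ne_top _ _),
          hqu]
    _ ≤ haarProb G U * ε + (haarProb G U * ε + haarProb G U * ε) := by
        rw [hqu]; gcongr
    _ = haarProb G U * (3 * ε) := by ring

variable {Φ : YoungFunction} (hΦ : IsDeltaTwo Φ) {μ : ComplexMeasure G}
  (hμ : μ.variation.Regular)

/-- A domination `‖ν C‖ ≤ a m(C)` forces `μ` to have a density of norm at most `a` in the Orlicz
space. -/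
theorem exists_density_of_dominatedOn [T2Space G] (hΨ : ∀ x : ℝ≥0, Φ.complementary x ≠ ∞)
    {a : ℝ≥0∞} (ha : a ≠ ∞)
    (hd : DominatedOn (convolutionMeasure hΦ hμ) (haarProb G) a Set.univ) :
    ∃ f : OrliczSpace Φ (haarProb G), ‖f‖ₑ ≤ a ∧
      Integrable (f : G →ₘ[haarProb G] ℂ) (haarProb G) ∧
      ∀ A : Set G, MeasurableSet A →
        μ A = ∫ t in A, (f : G →ₘ[haarProb G] ℂ) t ∂haarProb G := by
  obtain ⟨f, hf, hfμ⟩ := complexMeasure_exists_density (m := haarProb G) (μ := μ)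
    (fun N hN => signed_apply_eq_zero hΦ hμ hΨ ha hd (signedMeasure_variation_le μ).1 (fun A => by
      rw [← _root_.ofReal_norm, ← _root_.ofReal_norm]
      exact ENNReal.ofReal_le_ofReal (Complex.abs_re_le_norm _)) hN)
    (fun N hN => signed_apply_eq_zero hΦ hμ hΨ ha hd (signedMeasure_variation_le μ).2 (fun A => by
      rw [← _root_.ofReal_norm, ← _root_.ofReal_norm]
      exact ENNReal.ofReal_le_ofReal (Complex.abs_im_le_norm _)) hN)
  have hseq : ∀ n : ℕ, ∃ U : Set G, MeasurableSet U ∧ haarProb G U ≠ 0 ∧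
      ∫⁻ t, ‖μ {s : G | s⁻¹ * t ∈ U} - (haarProb G).real U * f t‖ₑ ∂haarProb G ≤
        haarProb G U * (3 * ((n + 1 : ℝ≥0)⁻¹ : ℝ≥0)) := by
    intro n
    obtain ⟨W, hW, hWU⟩ := exists_nhds_lintegral_average_sub_le hf (ε := (n + 1 : ℝ≥0)⁻¹)
      (by positivity)
    obtain ⟨U, hUW, hU1, hUm, hU2⟩ := exists_nhds_one_measurableSet_prod hW
    refine ⟨U, hUm, (Measure.measure_pos_of_mem_nhds _ hU1).ne', ?_⟩
    simp_rw [hfμ _ (measurableSet_translate hUm _)]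
    exact hWU U hUW hUm hU2
  choose U hU hU0 hUf using hseq
  set c : ℕ → ℝ := fun n => (haarProb G).real (U n) with hc
  have hcpos : ∀ n, 0 < c n := fun n => ENNReal.toReal_pos (hU0 n) (measure_ne_top _ _)
  have hcU : ∀ n, haarProb G (U n) = ‖((c n : ℝ) : ℂ)‖ₑ := fun n => by
    rw [← _root_.ofReal_norm, Complex.norm_real, Real.norm_of_nonneg measureReal_nonneg,
      ofReal_measureReal]
  set g : ℕ → G → ℂ := fun n t => ((c n : ℝ) : ℂ)⁻¹ * μ {s : G | s⁻¹ * t ∈ U n} with hg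
  have hmm : ∀ n, Measurable fun t => μ {s : G | s⁻¹ * t ∈ U n} := fun n => by
    have := measurable_convolution_indicator hμ (hU n)
    rwa [show convolution μ ((U n).indicator 1) = fun t => μ {s : G | s⁻¹ * t ∈ U n} from
      funext (convolution_indicator μ (hU n))] at this
  have hgm : ∀ n, Measurable (g n) := fun n => (hmm n).const_mul _
  have hgf : ∀ n, eLpNorm (g n - f) 1 (haarProb G) ≤ 3 * ((n + 1 : ℝ≥0)⁻¹ : ℝ≥0) := by
    intro n
    have hne : ((c n : ℝ) : ℂ) ≠ 0 := by exact_mod_cast (hcpos n).ne'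
    rw [eLpNorm_one_eq_lintegral_enorm]
    have h1 : ∀ t, ‖(g n - f) t‖ₑ = ‖((c n : ℝ) : ℂ)‖ₑ⁻¹ *
        ‖μ {s : G | s⁻¹ * t ∈ U n} - (c n : ℝ) * f t‖ₑ := fun t => by
      rw [← enorm_inv hne, ← enorm_mul, mul_sub, inv_mul_cancel_left₀ hne]
      rfl
    simp_rw [h1]
    rw [lintegral_const_mul' _ _ (by simp [hne])]
    rw [← hcU, mul_comm, ← div_eq_mul_inv]
    exact ENNReal.div_le_of_le_mul' (hUf n)
  have hlim : Tendsto (fun n => eLpNorm (g n - f) 1 (haarProb G)) atTop (𝓝 0) := by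
    refine tendsto_of_tendsto_of_tendsto_of_le_of_le tendsto_const_nhds ?_ (fun _ => zero_le) hgf
    have h1 : Tendsto (fun n : ℕ => (((n + 1 : ℕ) : ℝ≥0∞))⁻¹) atTop (𝓝 0) :=
      ENNReal.tendsto_inv_nat_nhds_zero.comp (tendsto_add_atTop_nat 1)
    have h2 := ENNReal.Tendsto.const_mul (a := 3) h1 (Or.inr (by norm_num))
    rw [mul_zero] at h2
    refine h2.congr fun n => ?_
    congr 1
    rw [ENNReal.coe_inv (by positivity)]
    push_cast
    rfl
  obtain ⟨ns, -, hns⟩ := (tendstoInMeasure_of_tendsto_eLpNorm one_ne_zero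
    (fun n => (hgm n).aestronglyMeasurable) hf.aestronglyMeasurable hlim).exists_seq_tendsto_ae
  have hlux : luxemburg Φ (haarProb G) (fun t => ‖f t‖ₑ) ≤ a := by
    refine luxemburg.le_of_tendsto_ae (w := fun n t => ‖g (ns n) t‖ₑ)
      (fun n => (hgm _).enorm.aemeasurable) ?_ (fun n => ?_)
    · filter_upwards [hns] with t ht
      exact ht.enorm
    · have hne : ((c (ns n) : ℝ) : ℂ) ≠ 0 := by exact_mod_cast (hcpos (ns n)).ne'
      simp only [hg, enorm_mul]
      have h1 := luxemburg.const_mul (Φ := Φ) (m := haarProb G)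
        (u := fun t => ‖μ {s : G | s⁻¹ * t ∈ U (ns n)}‖ₑ) ‖((c (ns n) : ℝ) : ℂ)⁻¹‖₊
      rw [enorm_eq_nnnorm, h1, ← enorm_convolutionMeasure hΦ hμ (hU _), ← enorm_eq_nnnorm,
        enorm_inv hne, ← hcU, mul_comm, ← div_eq_mul_inv]
      exact ENNReal.div_le_of_le_mul (hd _ (Set.subset_univ _) (hU _))
  have hfin : luxemburg Φ (haarProb G) (fun t => ‖f t‖ₑ) ≠ ∞ := ne_top_of_le_ne_top ha hlux
  have hmk := OrliczSpace.coe_mk f hf.aestronglyMeasurable hfin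
  refine ⟨OrliczSpace.mk f hf.aestronglyMeasurable hfin, ?_, hf.congr hmk.symm, fun A hA => ?_⟩
  · rw [OrliczSpace.enorm_eq]
    refine (luxemburg.mono_ae ?_).trans hlux
    filter_upwards [hmk] with t ht
    rw [ht]
  · rw [hfμ A hA]
    refine setIntegral_congr_ae hA ?_
    filter_upwards [hmk] with t ht _
    rw [ht]

end CompactGroup

/-! ### The `Δ₂`-condition and density of continuous functions -/

/-- The `Δ₂`-condition makes `∫ Φ (c |v|)` finite for every `c` as soon as it is finite for one. -/
theorem IsDeltaTwo.lintegral_ne_top {α : Type*} [MeasurableSpace α] {Φ : YoungFunction}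
    (hΦ : IsDeltaTwo Φ) {m : Measure α} [IsFiniteMeasure m] {v : α → ℝ≥0∞}
    (h : luxemburg Φ m v ≠ ∞) {c : ℝ≥0∞} (hc : c ≠ ∞) : ∫⁻ x, Φ (c * v x) ∂m ≠ ∞ := by
  obtain ⟨K, x₀, hK, -, hdbl⟩ := hΦ.doubling
  obtain ⟨k, ⟨hk0, hk1, hk⟩, -⟩ := sInf_lt_iff.1 (lt_top_iff_ne_top.2 h)
  have hle : ∀ x : ℝ≥0∞, Φ (2 * x) ≤ K * Φ x + Φ (2 * x₀ : ℝ≥0) := by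
    intro x
    by_cases hx : x = ∞
    · rw [hx, Φ.map_top, ENNReal.mul_top (a := (K : ℝ≥0∞)) (by simpa using hK.ne'), top_add]
      exact le_top
    lift x to ℝ≥0 using hx
    rcases le_total x₀ x with h1 | h1
    · exact (hdbl x h1).trans le_self_add
    · refine le_trans (Φ.mono ?_) le_add_self
      push_cast
      gcongr
  have hpow : ∀ j : ℕ, ∫⁻ x, Φ (2 ^ j * (v x / k)) ∂m ≠ ∞ := by
    intro j
    induction j with
    | zero => simpa using ne_top_of_le_ne_top ENNReal.one_ne_top hk
    | succ j ih =>
      have h1 : ∫⁻ x, Φ (2 ^ (j + 1) * (v x / k)) ∂m ≤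
          ∫⁻ x, (K * Φ (2 ^ j * (v x / k)) + Φ (2 * x₀ : ℝ≥0)) ∂m := by
        refine lintegral_mono fun x => ?_
        have := hle (2 ^ j * (v x / k))
        rwa [← mul_assoc, ← pow_succ'] at this
      rw [lintegral_add_right _ measurable_const, lintegral_const_mul' _ _ ENNReal.coe_ne_top,
        lintegral_const] at h1
      exact ne_top_of_le_ne_top (ENNReal.add_ne_top.2 ⟨ENNReal.mul_ne_top ENNReal.coe_ne_top ih,
        ENNReal.mul_ne_top (hΦ.finite _) (measure_ne_top _ _)⟩) h1
  obtain ⟨n, hn⟩ := ENNReal.exists_nat_gt (ENNReal.mul_ne_top hc hk1)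
  refine ne_top_of_le_ne_top (hpow n) (lintegral_mono fun x => Φ.mono ?_)
  have h2 : c * k ≤ 2 ^ n := hn.le.trans (by exact_mod_cast (Nat.lt_two_pow_self (n := n)).le)
  calc c * v x = c * (k * (v x / k)) := by rw [ENNReal.mul_div_cancel hk0.ne' hk1]
    _ = c * k * (v x / k) := by ring
    _ ≤ 2 ^ n * (v x / k) := by gcongr

/-- Dominated convergence for the Luxemburg functional. -/
theorem luxemburg.tendsto_zero_of_dominated {α : Type*} [MeasurableSpace α] {Φ : YoungFunction}
    (hΦ : IsDeltaTwo Φ) {m : Measure α} [IsFiniteMeasure m] {u : ℕ → α → ℝ≥0∞} {v : α → ℝ≥0∞}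
    (hv : luxemburg Φ m v ≠ ∞) (hm : ∀ i, AEMeasurable (u i) m) (hu : ∀ i, u i ≤ᵐ[m] v)
    (hlim : ∀ᵐ x ∂m, Tendsto (fun i => u i x) atTop (𝓝 0)) :
    Tendsto (fun i => luxemburg Φ m (u i)) atTop (𝓝 0) := by
  rw [ENNReal.tendsto_nhds_zero]
  intro ε' hε'
  set ε := min ε' 1 with hε
  have hε0 : 0 < ε := lt_min hε' one_pos
  have hε1 : ε ≠ ∞ := ne_top_of_le_ne_top ENNReal.one_ne_top (min_le_right _ _)
  have h1 : Tendsto (fun i => ∫⁻ x, Φ (u i x / ε) ∂m) atTop (𝓝 (∫⁻ _, 0 ∂m)) := by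
    refine tendsto_lintegral_of_dominated_convergence' (fun x => Φ (ε⁻¹ * v x))
      (fun i => luxemburg.aemeasurable_comp_div (hm i) ε) (fun i => ?_)
      (hΦ.lintegral_ne_top hv (ENNReal.inv_ne_top.2 hε0.ne')) ?_
    · filter_upwards [hu i] with x hx
      refine Φ.mono ?_
      rw [div_eq_mul_inv, mul_comm]
      gcongr
    · filter_upwards [hlim] with x hx
      have h2 : Tendsto (fun i => u i x / ε) atTop (𝓝 0) := by
        have := ENNReal.Tendsto.div_const (b := ε) hx (Or.inr hε0.ne')
        rwa [ENNReal.zero_div] at this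
      exact (Φ.tendsto_zero ⟨1, one_pos, hΦ.finite 1⟩).comp h2
  rw [lintegral_zero] at h1
  filter_upwards [h1.eventually (eventually_lt_nhds one_pos)] with i hi
  exact (luxemburg.le_of_lintegral hε0 hε1 hi.le).trans (min_le_left _ _)

theorem OrliczSpace.enorm_sub_le {α : Type*} [MeasurableSpace α] {Φ : YoungFunction}
    {m : Measure α} {f g : OrliczSpace Φ m} {w : α → ℝ≥0∞}
    (h : ∀ᵐ x ∂m, ‖(f : α →ₘ[m] ℂ) x - (g : α →ₘ[m] ℂ) x‖ₑ ≤ w x) :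
    ‖f - g‖ₑ ≤ luxemburg Φ m w := by
  rw [← _root_.ofReal_norm]
  exact OrliczSpace.ofReal_norm_sub_le h

theorem OrliczSpace.ext_ae {α : Type*} [MeasurableSpace α] {Φ : YoungFunction}
    {m : Measure α} {f g : OrliczSpace Φ m}
    (h : (f : α →ₘ[m] ℂ) =ᵐ[m] (g : α →ₘ[m] ℂ)) : f = g :=
  Subtype.ext (AEEqFun.ext h)

/-- The Orlicz space over a probability space is continuously included in `L¹`. -/
theorem OrliczSpace.lintegral_enorm_le {α : Type*} [MeasurableSpace α] {Φ : YoungFunction}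
    {m : Measure α} [IsProbabilityMeasure m] (f : OrliczSpace Φ m) {k : ℝ≥0∞} (hk : ‖f‖ₑ < k)
    (hk' : k ≠ ∞) :
    ∫⁻ x, ‖(f : α →ₘ[m] ℂ) x‖ₑ ∂m ≤ k * (1 + Φ.complementary 1) := by
  rw [OrliczSpace.enorm_eq] at hk
  simpa using luxemburg.mul_setLIntegral_le hk hk' 1 Set.univ

namespace CompactGroup

variable {G : Type*} [Group G] [TopologicalSpace G] [IsTopologicalGroup G] [CompactSpace G]
  [MeasurableSpace G] [BorelSpace G] {Φ : YoungFunction} (hΦ : IsDeltaTwo Φ)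

theorem luxemburg_one_ne_top (hΦ : IsDeltaTwo Φ) : luxemburg Φ (haarProb G) (fun _ => 1) ≠ ∞ :=
  luxemburg.ne_top_of_bounded hΦ ENNReal.one_ne_top fun _ => le_rfl

theorem luxemburg_const (c : ℝ≥0) :
    luxemburg Φ (haarProb G) (fun _ => (c : ℝ≥0∞)) =
      c * luxemburg Φ (haarProb G) (fun _ => 1) := by
  simpa using luxemburg.const_mul (Φ := Φ) (m := haarProb G) (u := fun _ => 1) c

/-- The class in the Orlicz space of a continuous function. -/
noncomputable def ofContinuousFun (h : C(G, ℂ)) : OrliczSpace Φ (haarProb G) :=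
  OrliczSpace.mk h (h.continuous.stronglyMeasurable_of_hasCompactSupport
      (HasCompactSupport.of_compactSpace _)).aestronglyMeasurable
    (luxemburg.ne_top_of_bounded hΦ (M := ‖h‖ₑ) enorm_ne_top fun t => by
      rw [← _root_.ofReal_norm, ← _root_.ofReal_norm]
      exact ENNReal.ofReal_le_ofReal (h.norm_coe_le_norm t))

theorem coe_ofContinuousFun (h : C(G, ℂ)) :
    ((ofContinuousFun hΦ h : OrliczSpace Φ (haarProb G)) : G →ₘ[haarProb G] ℂ)
      =ᵐ[haarProb G] h :=
  OrliczSpace.coe_mk _ _ _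

/-- The inclusion of `C(G)` into the Orlicz space. -/
noncomputable def ofContinuous : C(G, ℂ) →L[ℂ] OrliczSpace Φ (haarProb G) :=
  LinearMap.mkContinuous
    { toFun := ofContinuousFun hΦ
      map_add' := fun h k => OrliczSpace.ext_ae (by
        filter_upwards [coe_ofContinuousFun hΦ (h + k), coe_ofContinuousFun hΦ h,
          coe_ofContinuousFun hΦ k, AEEqFun.coeFn_add (ofContinuousFun hΦ h).1
            (ofContinuousFun hΦ k).1] with t h1 h2 h3 h4
        rw [Submodule.coe_add, h1, h4, Pi.add_apply, h2, h3]
        rfl)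
      map_smul' := fun c h => OrliczSpace.ext_ae (by
        filter_upwards [coe_ofContinuousFun hΦ (c • h), coe_ofContinuousFun hΦ h,
          AEEqFun.coeFn_smul c (ofContinuousFun hΦ h).1] with t h1 h2 h3
        rw [RingHom.id_apply, Submodule.coe_smul, h1, h3, Pi.smul_apply, h2]
        rfl) }
    (luxemburg Φ (haarProb G) (fun _ => 1)).toReal
    (fun h => by
      have h1 : ‖ofContinuousFun hΦ h‖ₑ ≤ ‖h‖₊ * luxemburg Φ (haarProb G) (fun _ => 1) := by
        rw [← luxemburg_const, OrliczSpace.enorm_eq]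
        refine luxemburg.mono_ae ?_
        filter_upwards [coe_ofContinuousFun hΦ h] with t ht
        rw [ht, enorm_eq_nnnorm]
        exact_mod_cast h.norm_coe_le_norm t
      have h2 := ENNReal.toReal_mono (ENNReal.mul_ne_top ENNReal.coe_ne_top
        (luxemburg_one_ne_top hΦ)) h1
      rw [toReal_enorm, ENNReal.toReal_mul, mul_comm] at h2
      exact h2)

theorem coe_ofContinuous (h : C(G, ℂ)) :
    ((ofContinuous hΦ h : OrliczSpace Φ (haarProb G)) : G →ₘ[haarProb G] ℂ)
      =ᵐ[haarProb G] h :=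
  coe_ofContinuousFun hΦ h

/-- The radial retraction of `ℂ` onto the closed ball of radius `n`. -/
noncomputable def radialRetraction (n : ℝ) (z : ℂ) : ℂ := ((n / max n ‖z‖ : ℝ) : ℂ) * z

theorem continuous_radialRetraction {n : ℝ} (hn : 0 < n) : Continuous (radialRetraction n) := by
  unfold radialRetraction
  have : ∀ z : ℂ, max n ‖z‖ ≠ 0 := fun z => (lt_max_of_lt_left hn).ne'
  fun_prop (disch := assumption)

theorem norm_radialRetraction_le {n : ℝ} (hn : 0 < n) (z : ℂ) : ‖radialRetraction n z‖ ≤ n := by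
  have h0 : 0 < max n ‖z‖ := lt_max_of_lt_left hn
  rw [radialRetraction, norm_mul, Complex.norm_real, Real.norm_of_nonneg (by positivity),
    div_mul_eq_mul_div, div_le_iff₀ h0]
  gcongr
  exact le_max_right _ _

theorem radialRetraction_of_norm_le {n : ℝ} (hn : 0 < n) {z : ℂ} (hz : ‖z‖ ≤ n) :
    radialRetraction n z = z := by
  rw [radialRetraction, max_eq_left hz, div_self hn.ne', Complex.ofReal_one, one_mul]

theorem norm_radialRetraction_le_norm {n : ℝ} (hn : 0 < n) (z : ℂ) :
    ‖radialRetraction n z‖ ≤ ‖z‖ := by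
  have h0 : 0 < max n ‖z‖ := lt_max_of_lt_left hn
  rw [radialRetraction, norm_mul, Complex.norm_real, Real.norm_of_nonneg (by positivity)]
  exact mul_le_of_le_one_left (norm_nonneg _) ((div_le_one h0).2 (le_max_left _ _))

/-- Continuous functions are dense in the Orlicz space, because of the `Δ₂`-condition. -/
theorem exists_continuous_enorm_sub_lt (f : OrliczSpace Φ (haarProb G)) {ε : ℝ≥0∞} (hε : 0 < ε) :
    ∃ h : C(G, ℂ), ‖f - ofContinuous hΦ h‖ₑ < ε := by
  set φ : G → ℂ := fun t => (f : G →ₘ[haarProb G] ℂ) t with hφ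
  have hφm : AEStronglyMeasurable φ (haarProb G) := (f : G →ₘ[haarProb G] ℂ).aestronglyMeasurable
  have hε2 : 0 < ε / 2 := ENNReal.half_pos hε.ne'
  -- truncation at a large height
  obtain ⟨n, hn⟩ : ∃ n : ℕ, luxemburg Φ (haarProb G)
      (fun t => ‖φ t - radialRetraction (n + 1 : ℝ) (φ t)‖ₑ) < ε / 2 := by
    have hlim : Tendsto (fun n : ℕ => luxemburg Φ (haarProb G)
        (fun t => ‖φ t - radialRetraction (n + 1 : ℝ) (φ t)‖ₑ)) atTop (𝓝 0) := by
      refine luxemburg.tendsto_zero_of_dominated hΦ (v := fun t => (2 : ℝ≥0) * ‖φ t‖ₑ) ?_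
        (fun n => ?_) (fun n => Eventually.of_forall fun t => ?_)
        (Eventually.of_forall fun t => ?_)
      · rw [luxemburg.const_mul]
        exact ENNReal.mul_ne_top ENNReal.coe_ne_top f.2
      · exact (hφm.sub ((continuous_radialRetraction
          (by positivity)).comp_aestronglyMeasurable hφm)).enorm
      · refine enorm_sub_le.trans ?_
        have h1 : ‖radialRetraction (n + 1 : ℝ) (φ t)‖ₑ ≤ ‖φ t‖ₑ := by
          rw [← _root_.ofReal_norm, ← _root_.ofReal_norm]
          exact ENNReal.ofReal_le_ofReal (norm_radialRetraction_le_norm (by positivity) _)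
        calc ‖φ t‖ₑ + ‖radialRetraction (n + 1 : ℝ) (φ t)‖ₑ ≤ ‖φ t‖ₑ + ‖φ t‖ₑ := by gcongr
          _ = (2 : ℝ≥0) * ‖φ t‖ₑ := by push_cast; ring
      · obtain ⟨N, hN⟩ := exists_nat_ge ‖φ t‖
        refine tendsto_const_nhds.congr' ?_
        filter_upwards [eventually_ge_atTop N] with n hNn
        have h2 : ‖φ t‖ ≤ (n + 1 : ℝ) := by
          have : (N : ℝ) ≤ n := by exact_mod_cast hNn
          linarith
        rw [radialRetraction_of_norm_le (by positivity) h2]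
        simp
    exact ((hlim.eventually (eventually_lt_nhds hε2)).exists)
  set r : ℝ := n + 1 with hr
  have hr0 : 0 < r := by positivity
  set ψ : G → ℂ := fun t => radialRetraction r (φ t) with hψ
  have hψm : AEStronglyMeasurable ψ (haarProb G) :=
    (continuous_radialRetraction hr0).comp_aestronglyMeasurable hφm
  have hψi : Integrable ψ (haarProb G) := Integrable.of_bound hψm r
    (Eventually.of_forall fun t => norm_radialRetraction_le hr0 _)
  -- approximation of the truncation by continuous functions with the same bound
  have hex : ∀ k : ℕ, ∃ h : BoundedContinuousFunction G ℂ,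
      ∫⁻ t, ‖ψ t - h t‖ₑ ∂haarProb G ≤ ((k + 1 : ℕ) : ℝ≥0∞)⁻¹ := fun k => by
    obtain ⟨h, hh, -⟩ := hψi.exists_boundedContinuous_lintegral_sub_le
      (ε := ((k + 1 : ℕ) : ℝ≥0∞)⁻¹) (by simp)
    exact ⟨h, hh⟩
  choose h hh using hex
  have hhm : ∀ k, AEStronglyMeasurable (h k) (haarProb G) := fun k =>
    ((h k).continuous.stronglyMeasurable_of_hasCompactSupport
      (HasCompactSupport.of_compactSpace _)).aestronglyMeasurable
  have hL1 : Tendsto (fun k => eLpNorm ((h k : G → ℂ) - ψ) 1 (haarProb G)) atTop (𝓝 0) := by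
    refine tendsto_of_tendsto_of_tendsto_of_le_of_le tendsto_const_nhds
      (ENNReal.tendsto_inv_nat_nhds_zero.comp (tendsto_add_atTop_nat 1)) (fun _ => zero_le)
      (fun k => ?_)
    rw [eLpNorm_one_eq_lintegral_enorm]
    refine le_trans (le_of_eq (lintegral_congr fun t => ?_)) (hh k)
    rw [Pi.sub_apply, enorm_sub_rev]
  obtain ⟨ns, -, hns⟩ := (tendstoInMeasure_of_tendsto_eLpNorm one_ne_zero hhm hψm
    hL1).exists_seq_tendsto_ae
  set H : ℕ → C(G, ℂ) := fun k =>
    ⟨fun t => radialRetraction r (h (ns k) t),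
      (continuous_radialRetraction hr0).comp (h (ns k)).continuous⟩ with hH
  have hHm : ∀ k, AEStronglyMeasurable (H k) (haarProb G) := fun k =>
    (continuous_radialRetraction hr0).comp_aestronglyMeasurable (hhm (ns k))
  have hlim2 : Tendsto (fun k => luxemburg Φ (haarProb G) (fun t => ‖ψ t - H k t‖ₑ))
      atTop (𝓝 0) := by
    refine luxemburg.tendsto_zero_of_dominated hΦ (v := fun _ => ENNReal.ofReal r +
      ENNReal.ofReal r) ?_ (fun k => (hψm.sub (hHm k)).enorm)
      (fun k => Eventually.of_forall fun t => ?_) ?_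
    · exact luxemburg.ne_top_of_bounded hΦ (M := ENNReal.ofReal r + ENNReal.ofReal r)
        (by finiteness) fun _ => le_rfl
    · refine enorm_sub_le.trans (add_le_add ?_ ?_)
      · rw [← _root_.ofReal_norm]
        exact ENNReal.ofReal_le_ofReal (norm_radialRetraction_le hr0 _)
      · rw [← _root_.ofReal_norm]
        exact ENNReal.ofReal_le_ofReal (norm_radialRetraction_le hr0 _)
    · filter_upwards [hns] with t ht
      have h1 := ((continuous_radialRetraction hr0).tendsto (ψ t)).comp ht
      rw [radialRetraction_of_norm_le hr0 (norm_radialRetraction_le hr0 _)] at h1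
      have h2 := (tendsto_const_nhds (x := ψ t)).sub h1
      rw [sub_self] at h2
      simpa [hH] using h2.enorm
  obtain ⟨k, hk⟩ := (hlim2.eventually (eventually_lt_nhds hε2)).exists
  refine ⟨H k, ?_⟩
  have h3 : ‖f - ofContinuous hΦ (H k)‖ₑ ≤ luxemburg Φ (haarProb G)
      (fun t => ‖φ t - ψ t‖ₑ + ‖ψ t - H k t‖ₑ) := by
    refine OrliczSpace.enorm_sub_le ?_
    filter_upwards [coe_ofContinuous hΦ (H k)] with t ht
    rw [ht, show (f : G →ₘ[haarProb G] ℂ) t - H k t = (φ t - ψ t) + (ψ t - H k t) by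
      simp [hφ]]
    exact enorm_add_le _ _
  calc ‖f - ofContinuous hΦ (H k)‖ₑ ≤ _ := h3
    _ ≤ luxemburg Φ (haarProb G) (fun t => ‖φ t - ψ t‖ₑ) +
        luxemburg Φ (haarProb G) (fun t => ‖ψ t - H k t‖ₑ) :=
      luxemburg.add_le (hφm.sub hψm).enorm
    _ < ε / 2 + ε / 2 := ENNReal.add_lt_add hn hk
    _ = ε := ENNReal.add_halves ε

end CompactGroup

/-! ### Translations in the Orlicz space -/

namespace CompactGroup

variable {G : Type*} [Group G] [TopologicalSpace G] [IsTopologicalGroup G] [CompactSpace G]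
  [MeasurableSpace G] [BorelSpace G] {Φ : YoungFunction}

theorem measurePreserving_mul_right_haarProb (u : G) :
    MeasurePreserving (· * u) (haarProb G) (haarProb G) :=
  measurePreserving_mul_right (haarProb G) u

/-- The right translate `t ↦ f (t u⁻¹)` of an element of the Orlicz space. -/
noncomputable def translate (f : OrliczSpace Φ (haarProb G)) (u : G) :
    OrliczSpace Φ (haarProb G) :=
  OrliczSpace.mk (fun t => (f : G →ₘ[haarProb G] ℂ) (t * u⁻¹))
    ((f : G →ₘ[haarProb G] ℂ).aestronglyMeasurable.comp_measurePreserving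
      (measurePreserving_mul_right_haarProb u⁻¹))
    (by
      rw [luxemburg_mul_right Φ (fun t => ‖(f : G →ₘ[haarProb G] ℂ) t‖ₑ)]
      exact f.2)

theorem coe_translate (f : OrliczSpace Φ (haarProb G)) (u : G) :
    ((translate f u : OrliczSpace Φ (haarProb G)) : G →ₘ[haarProb G] ℂ) =ᵐ[haarProb G]
      fun t => (f : G →ₘ[haarProb G] ℂ) (t * u⁻¹) :=
  OrliczSpace.coe_mk _ _ _

theorem enorm_translate (f : OrliczSpace Φ (haarProb G)) (u : G) : ‖translate f u‖ₑ = ‖f‖ₑ := by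
  rw [OrliczSpace.enorm_eq, OrliczSpace.enorm_eq,
    ← luxemburg_mul_right Φ (fun t => ‖(f : G →ₘ[haarProb G] ℂ) t‖ₑ) u⁻¹]
  refine luxemburg.congr_ae ?_
  filter_upwards [coe_translate f u] with t ht
  rw [ht]

theorem translate_sub (f g : OrliczSpace Φ (haarProb G)) (u : G) :
    translate f u - translate g u = translate (f - g) u := by
  refine OrliczSpace.ext_ae ?_
  have h1 := (measurePreserving_mul_right_haarProb u⁻¹).quasiMeasurePreserving.ae
    (AEEqFun.coeFn_sub (f : G →ₘ[haarProb G] ℂ) (g : G →ₘ[haarProb G] ℂ))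
  filter_upwards [h1, coe_translate f u, coe_translate g u, coe_translate (f - g) u,
    AEEqFun.coeFn_sub (translate f u).1 (translate g u).1] with t h1 h2 h3 h4 h5
  rw [Submodule.coe_sub, h5, Pi.sub_apply, h2, h3, h4, Submodule.coe_sub, h1, Pi.sub_apply]

/-- The translates of a continuous function, as a continuous map into `C(G)`. -/
noncomputable def translateContinuous (h : C(G, ℂ)) : C(G, C(G, ℂ)) :=
  ContinuousMap.curry ⟨fun p : G × G => h (p.2 * p.1⁻¹), by fun_prop⟩

variable (hΦ : IsDeltaTwo Φ)

theorem translate_ofContinuous (h : C(G, ℂ)) (u : G) :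
    translate (ofContinuous hΦ h) u = ofContinuous hΦ (translateContinuous h u) := by
  refine OrliczSpace.ext_ae ?_
  have h1 := (measurePreserving_mul_right_haarProb u⁻¹).quasiMeasurePreserving.ae
    (coe_ofContinuous hΦ h)
  filter_upwards [h1, coe_translate (ofContinuous hΦ h) u,
    coe_ofContinuous hΦ (translateContinuous h u)] with t h1 h2 h3
  rw [h2, h3, h1]
  rfl

/-- Translation is continuous in the Orlicz norm, since `C(G)` is dense and translations are
isometries. -/
theorem continuous_translate (hΦ : IsDeltaTwo Φ) (f : OrliczSpace Φ (haarProb G)) :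
    Continuous (translate f) := by
  refine continuous_of_uniform_approx_of_continuous fun s hs => ?_
  obtain ⟨ε, hε, hεs⟩ := Metric.mem_uniformity_dist.1 hs
  obtain ⟨h, hh⟩ := exists_continuous_enorm_sub_lt hΦ f (ε := ENNReal.ofReal ε) (by simpa using hε)
  refine ⟨fun u => translate (ofContinuous hΦ h) u, ?_, fun u => hεs ?_⟩
  · simp_rw [translate_ofContinuous]
    exact (ofContinuous hΦ).continuous.comp (translateContinuous h).continuous
  · rw [← enorm_translate _ u, ← translate_sub, ← _root_.ofReal_norm, ← dist_eq_norm] at hh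
    exact (ENNReal.ofReal_lt_ofReal_iff hε).1 hh

theorem integrable_translate (hΦ : IsDeltaTwo Φ) (f : OrliczSpace Φ (haarProb G)) :
    Integrable (translate f) (haarProb G) :=
  (continuous_translate hΦ f).integrable_of_hasCompactSupport (HasCompactSupport.of_compactSpace _)

/-- The change of variables `s = t u⁻¹`. -/
theorem setIntegral_translate (f : G → ℂ) (A : Set G) (t : G) :
    ∫ s in {s : G | s⁻¹ * t ∈ A}, f s ∂haarProb G = ∫ u in A, f (t * u⁻¹) ∂haarProb G := by
  have h1 : MeasurePreserving (fun u : G => t * u⁻¹) (haarProb G) (haarProb G) :=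
    (measurePreserving_mul_left (haarProb G) t).comp (Measure.measurePreserving_inv (haarProb G))
  have h2 : MeasurableEmbedding (fun u : G => t * u⁻¹) :=
    ((Homeomorph.inv G).trans (Homeomorph.mulLeft t)).measurableEmbedding
  have h3 := h1.setIntegral_preimage_emb h2 f {s : G | s⁻¹ * t ∈ A}
  rw [← h3]
  congr 2
  ext u
  simp

variable {μ : ComplexMeasure G} (hμ : μ.variation.Regular)

/-- If `μ` has density `f` in the Orlicz space, then `ν` has the continuous density of right
translates of `f`. -/
theorem convolutionMeasure_eq_integral_translate (hΨ : ∀ x : ℝ≥0, Φ.complementary x ≠ ∞)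
    {f : OrliczSpace Φ (haarProb G)}
    (hfi : Integrable (f : G →ₘ[haarProb G] ℂ) (haarProb G))
    (hf : ∀ A : Set G, MeasurableSet A →
      μ A = ∫ t in A, (f : G →ₘ[haarProb G] ℂ) t ∂haarProb G) {A : Set G} (hA : MeasurableSet A) :
    convolutionMeasure hΦ hμ A = ∫ u in A, translate f u ∂haarProb G := by
  set L := luxemburg Φ (haarProb G) (fun _ => 1) with hL
  have hLt : L ≠ ∞ := luxemburg_one_ne_top hΦ
  set C := (1 + Φ.complementary 1) * L + 1 with hC
  have hCt : C ≠ ∞ := ENNReal.add_ne_top.2 ⟨ENNReal.mul_ne_top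
    (ENNReal.add_ne_top.2 ⟨ENNReal.one_ne_top, by simpa using hΨ 1⟩) hLt, ENNReal.one_ne_top⟩
  -- for continuous densities both sides are `C(G)`-valued integrals; approximate `f` by such
  have key : ∀ δ : ℝ≥0, 0 < δ → ‖convolutionMeasure hΦ hμ A -
      ∫ u in A, translate f u ∂haarProb G‖ₑ ≤ δ * C := by
    intro δ hδ
    obtain ⟨h, hh⟩ := exists_continuous_enorm_sub_lt hΦ f (ε := δ) (by simpa using hδ)
    set H : C(G, ℂ) := ∫ u in A, translateContinuous h u ∂haarProb G with hH
    have hti : Integrable (translateContinuous h) ((haarProb G).restrict A) :=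
      ((translateContinuous h).continuous.integrable_of_hasCompactSupport
        (HasCompactSupport.of_compactSpace _)).integrableOn
    have hHι : ofContinuous hΦ H = ∫ u in A, translate (ofContinuous hΦ h) u ∂haarProb G := by
      simp_rw [translate_ofContinuous]
      exact ((ofContinuous hΦ).integral_comp_comm hti).symm
    have hhi : Integrable h (haarProb G) :=
      h.continuous.integrable_of_hasCompactSupport (HasCompactSupport.of_compactSpace _)
    have hHt : ∀ t, H t = ∫ s in {s : G | s⁻¹ * t ∈ A}, h s ∂haarProb G := by
      intro t
      rw [setIntegral_translate]
      exact ((ContinuousMap.evalCLM ℂ t).integral_comp_comm hti).symm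
    have hL1 : ∫⁻ t, ‖(f : G →ₘ[haarProb G] ℂ) t - h t‖ₑ ∂haarProb G ≤
        δ * (1 + Φ.complementary 1) := by
      refine le_trans (le_of_eq (lintegral_congr_ae ?_))
        (OrliczSpace.lintegral_enorm_le _ hh ENNReal.coe_ne_top)
      filter_upwards [AEEqFun.coeFn_sub (f : G →ₘ[haarProb G] ℂ) (ofContinuous hΦ h).1,
        coe_ofContinuous hΦ h] with t h1 h2
      rw [Submodule.coe_sub, h1, Pi.sub_apply, h2]
    set D := ∫⁻ t, ‖(f : G →ₘ[haarProb G] ℂ) t - h t‖ₑ ∂haarProb G with hD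
    have hDt : D ≠ ∞ := (hfi.sub hhi).2.ne
    have h1 : ‖convolutionMeasure hΦ hμ A - ofContinuous hΦ H‖ₑ ≤ D * L := by
      have h2 := luxemburg_const (G := G) (Φ := Φ) D.toNNReal
      rw [ENNReal.coe_toNNReal hDt] at h2
      rw [hL, ← h2]
      refine OrliczSpace.enorm_sub_le ?_
      filter_upwards [coe_convolutionMeasure hΦ hμ hA, coe_ofContinuous hΦ H] with t h3 h4
      rw [h3, h4, hHt, hf _ (measurableSet_translate hA t),
        ← integral_sub hfi.integrableOn hhi.integrableOn]
      exact (enorm_integral_le_lintegral_enorm _).trans (setLIntegral_le_lintegral _ _)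
    have h2 : ‖ofContinuous hΦ H - ∫ u in A, translate f u ∂haarProb G‖ₑ ≤ δ := by
      rw [hHι, ← integral_sub (integrable_translate hΦ _).integrableOn
        (integrable_translate hΦ f).integrableOn]
      refine (enorm_integral_le_lintegral_enorm _).trans
        ((setLIntegral_le_lintegral _ _).trans ?_)
      calc ∫⁻ u, ‖translate (ofContinuous hΦ h) u - translate f u‖ₑ ∂haarProb G
          ≤ ∫⁻ _, δ ∂haarProb G := lintegral_mono fun u => by
            rw [translate_sub, enorm_translate, enorm_sub_rev]
            exact hh.le
        _ = δ := by simp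
    calc ‖convolutionMeasure hΦ hμ A - ∫ u in A, translate f u ∂haarProb G‖ₑ
        ≤ ‖convolutionMeasure hΦ hμ A - ofContinuous hΦ H‖ₑ +
          ‖ofContinuous hΦ H - ∫ u in A, translate f u ∂haarProb G‖ₑ := by
          rw [← sub_add_sub_cancel _ (ofContinuous hΦ H)]
          exact enorm_add_le _ _
      _ ≤ δ * (1 + Φ.complementary 1) * L + δ := by
          refine add_le_add (h1.trans ?_) h2
          gcongr
      _ = δ * C := by rw [hC]; ring
  have h0 : ‖convolutionMeasure hΦ hμ A - ∫ u in A, translate f u ∂haarProb G‖ₑ ≤ 0 := by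
    have hlim : Tendsto (fun n : ℕ => (((n + 1 : ℕ) : ℝ≥0∞))⁻¹ * C) atTop (𝓝 (0 * C)) :=
      ENNReal.Tendsto.mul_const (ENNReal.tendsto_inv_nat_nhds_zero.comp
        (tendsto_add_atTop_nat 1)) (Or.inr hCt)
    rw [zero_mul] at hlim
    refine ge_of_tendsto' hlim fun n => ?_
    have := key ((n + 1 : ℕ) : ℝ≥0)⁻¹ (by positivity)
    rwa [ENNReal.coe_inv (by positivity), ENNReal.coe_natCast] at this
  exact sub_eq_zero.1 (enorm_eq_zero.1 (le_antisymm h0 zero_le))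

end CompactGroup

/-! ### Vector measures with a continuous density -/

namespace VectorIntegration

variable {Ω : Type*} [TopologicalSpace Ω] [CompactSpace Ω] [MeasurableSpace Ω]
  [OpensMeasurableSpace Ω] {m : Measure Ω} [IsFiniteMeasure m] {X : Type*} [NormedAddCommGroup X]
  [NormedSpace ℂ X] [CompleteSpace X] {ν : VectorMeasure Ω X} {F : Ω → X}

theorem lintegral_variation_scalarMeasure (hF : Continuous F)
    (hν : ∀ A, MeasurableSet A → ν A = ∫ ω in A, F ω ∂m) (x' : StrongDual ℂ X) {g : Ω → ℂ}
    (hg : Measurable g) :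
    ∫⁻ ω, ‖g ω‖ₑ ∂(scalarMeasure ν x').variation = ∫⁻ ω, ‖x' (F ω)‖ₑ * ‖g ω‖ₑ ∂m := by
  have hFi : Integrable F m :=
    hF.integrable_of_hasCompactSupport (HasCompactSupport.of_compactSpace _)
  have hx : Continuous fun ω => x' (F ω) := x'.continuous.comp hF
  have hxi : Integrable (fun ω => x' (F ω)) m := x'.integrable_comp hFi
  have h1 : scalarMeasure ν x' = m.withDensityᵥ fun ω => x' (F ω) := by
    ext A hA
    · rw [scalarMeasure_apply, withDensityᵥ_apply hxi hA, hν A hA,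
        x'.integral_comp_comm hFi.integrableOn]
  rw [h1, Measure.variation_withDensityᵥ hxi,
    lintegral_withDensity_eq_lintegral_mul _ hx.measurable.enorm hg.enorm]
  rfl

/-- By compactness, finitely many functionals of the dual unit ball keep away from `0` along a
nowhere vanishing continuous density, so the `L¹(ν)`-norm dominates the `L¹(m)`-norm. -/
theorem exists_lintegral_le_vectorL1Norm (hF : Continuous F) (hF0 : ∀ ω, F ω ≠ 0)
    (hν : ∀ A, MeasurableSet A → ν A = ∫ ω in A, F ω ∂m) :
    ∃ C : ℝ≥0, ∀ g : Ω → ℂ, Measurable g → ∫⁻ ω, ‖g ω‖ₑ ∂m ≤ C * vectorL1Norm ν g := by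
  choose φ hφ1 hφ using fun v => exists_dual_vector'' ℂ (F v)
  have hpos : ∀ v, 0 < ‖F v‖₊ := fun v => by simpa using hF0 v
  have hcont : ∀ v, Continuous fun ω => ‖φ v (F ω)‖₊ := fun v =>
    ((φ v).continuous.comp hF).nnnorm
  obtain ⟨t, ht⟩ := isCompact_univ.elim_finite_subcover
    (fun v => {ω | ‖F v‖₊ / 2 < ‖φ v (F ω)‖₊})
    (fun v => isOpen_lt continuous_const (hcont v))
    (fun v _ => Set.mem_iUnion.2 ⟨v, by
      have h1 : ‖φ v (F v)‖₊ = ‖F v‖₊ := by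
        rw [hφ v]
        ext
        simp
      change ‖F v‖₊ / 2 < ‖φ v (F v)‖₊
      rw [h1]
      exact half_lt_self (hpos v)⟩)
  refine ⟨∑ v ∈ t, 2 / ‖F v‖₊, fun g hg => ?_⟩
  have hone : ∀ ω, (1 : ℝ≥0∞) ≤ ∑ v ∈ t, ((2 / ‖F v‖₊ : ℝ≥0) : ℝ≥0∞) * ‖φ v (F ω)‖ₑ := by
    intro ω
    obtain ⟨v, hv, hω⟩ := Set.mem_iUnion₂.1 (ht (Set.mem_univ ω))
    refine le_trans ?_ (Finset.single_le_sum
      (f := fun v => ((2 / ‖F v‖₊ : ℝ≥0) : ℝ≥0∞) * ‖φ v (F ω)‖ₑ) (fun _ _ => zero_le) hv)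
    change (1 : ℝ≥0∞) ≤ ((2 / ‖F v‖₊ : ℝ≥0) : ℝ≥0∞) * (‖φ v (F ω)‖₊ : ℝ≥0∞)
    have h1 : ‖F v‖₊ / 2 < ‖φ v (F ω)‖₊ := hω
    have h2 : (2 / ‖F v‖₊) * (‖F v‖₊ / 2) = 1 := by
      have := (hpos v).ne'
      field_simp
    have h3 : (1 : ℝ≥0) ≤ 2 / ‖F v‖₊ * ‖φ v (F ω)‖₊ := by
      rw [← h2]
      gcongr
    exact_mod_cast h3
  calc ∫⁻ ω, ‖g ω‖ₑ ∂m
      ≤ ∫⁻ ω, ∑ v ∈ t, ((2 / ‖F v‖₊ : ℝ≥0) : ℝ≥0∞) * (‖φ v (F ω)‖ₑ * ‖g ω‖ₑ) ∂m := by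
        refine lintegral_mono fun ω => ?_
        simp_rw [← mul_assoc, ← Finset.sum_mul]
        calc ‖g ω‖ₑ = 1 * ‖g ω‖ₑ := (one_mul _).symm
          _ ≤ _ := by gcongr; exact hone ω
    _ = ∑ v ∈ t, ((2 / ‖F v‖₊ : ℝ≥0) : ℝ≥0∞) *
          ∫⁻ ω, ‖g ω‖ₑ ∂(scalarMeasure ν (φ v)).variation := by
        rw [lintegral_finsetSum]
        · refine Finset.sum_congr rfl fun v _ => ?_
          rw [lintegral_const_mul' _ _ ENNReal.coe_ne_top,
            lintegral_variation_scalarMeasure hF hν (φ v) hg]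
        · intro v _
          exact (((φ v).continuous.comp hF).measurable.enorm.mul hg.enorm).const_mul _
    _ ≤ ∑ v ∈ t, ((2 / ‖F v‖₊ : ℝ≥0) : ℝ≥0∞) * vectorL1Norm ν g := by
        gcongr with v
        exact le_iSup (fun x' : {x' : StrongDual ℂ X // ‖x'‖ ≤ 1} =>
          ∫⁻ ω, ‖g ω‖ₑ ∂(scalarMeasure ν x').variation) ⟨φ v, hφ1 v⟩
    _ = _ := by rw [← Finset.sum_mul]; push_cast; rfl

/-- The integrals over the unit ball of `L¹(ν)` stay in the closed convex hull of the compact set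
of all `z • F ω` with `|z| ≤ C`: otherwise a functional would separate one of them from this set,
which the bound on the `L¹(m)`-norms forbids. -/
theorem isCompactOperator_integrationOperator [Nonempty Ω] (hF : Continuous F) (hF0 : ∀ ω, F ω ≠ 0)
    (hν : ∀ A, MeasurableSet A → ν A = ∫ ω in A, F ω ∂m) :
    IsCompactOperator (integrationOperator ν) := by
  obtain ⟨C, hC⟩ := exists_lintegral_le_vectorL1Norm hF hF0 hν
  set K : Set X := (fun p : ℂ × Ω => p.1 • F p.2) '' (Metric.closedBall 0 C ×ˢ Set.univ) with hK
  have hKc : IsCompact K :=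
    ((isCompact_closedBall (0 : ℂ) (C : ℝ)).prod isCompact_univ).image (by fun_prop)
  have hS : IsCompact (closure (convexHull ℝ K)) :=
    hKc.totallyBounded.convexHull.closure.isCompact_of_isClosed isClosed_closure
  refine (isCompactOperator_iff_image_closedBall_subset_compact
    (f := (integrationOperator ν : L1 ν →ₗ[ℂ] X)) zero_lt_one).2 ⟨_, hS, ?_⟩
  rintro _ ⟨g, hg, rfl⟩
  obtain ⟨g, rfl⟩ := SeparationQuotient.surjective_mk g
  change PreL1.integral g ∈ closure (convexHull ℝ K)
  have hg1 : ‖g‖ ≤ 1 := by simpa using hg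
  have hgC : ∫⁻ ω, ‖g.1 ω‖ₑ ∂m ≤ C := by
    refine (hC g.1 g.2.measurable).trans ?_
    have h1 : vectorL1Norm ν g.1 ≤ 1 := by
      rw [← ENNReal.ofReal_toReal (vectorL1Norm_ne_top g.2)]
      exact ENNReal.ofReal_le_one.2 hg1
    calc (C : ℝ≥0∞) * vectorL1Norm ν g.1 ≤ C * 1 := by gcongr
      _ = C := mul_one _
  by_contra hmem
  obtain ⟨x', r, hr, hrx⟩ := RCLike.geometric_hahn_banach_closed_point (𝕜 := ℂ)
    (convex_convexHull ℝ K).closure isClosed_closure hmem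
  have hsub : K ⊆ closure (convexHull ℝ K) := (subset_convexHull ℝ K).trans subset_closure
  have hbd : ∀ ω, C * ‖x' (F ω)‖ < r := by
    intro ω
    obtain ⟨z, hz, hzx⟩ : ∃ z : ℂ, ‖z‖ ≤ 1 ∧ z * x' (F ω) = ‖x' (F ω)‖ := by
      obtain ⟨z, hz, hzx⟩ := Complex.exists_norm_eq_mul_self (x' (F ω))
      exact ⟨z, hz.le, hzx.symm⟩
    have h1 := hr _ (hsub ⟨((C : ℝ) * z, ω), ⟨by
      rw [mem_closedBall_zero_iff, norm_mul, Complex.norm_real, NNReal.norm_eq]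
      exact mul_le_of_le_one_right C.2 hz, Set.mem_univ _⟩, rfl⟩)
    simp only [map_smul, smul_eq_mul] at h1
    rw [mul_assoc, hzx, ← Complex.ofReal_mul] at h1
    exact h1
  have hle : ‖x' (PreL1.integral g)‖ₑ ≤ ENNReal.ofReal r := by
    rw [← PreL1.hasVectorIntegral_integral g x']
    refine (enorm_complexIntegral_le _ _).trans ?_
    rw [VectorMeasure.restrict_univ,
      lintegral_variation_scalarMeasure hF hν x' g.2.measurable]
    by_cases hC0 : (C : ℝ≥0∞) = 0
    · rw [hC0] at hgC
      have h1 := (lintegral_eq_zero_iff g.2.measurable.enorm).1 (le_antisymm hgC zero_le)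
      rw [lintegral_congr_ae (g := fun _ => 0) (by
        filter_upwards [h1] with ω hω
        rw [hω]
        simp)]
      simp
    calc ∫⁻ ω, ‖x' (F ω)‖ₑ * ‖g.1 ω‖ₑ ∂m
        ≤ ∫⁻ ω, ENNReal.ofReal r / C * ‖g.1 ω‖ₑ ∂m := by
          refine lintegral_mono fun ω => ?_
          gcongr
          rw [ENNReal.le_div_iff_mul_le (Or.inl hC0) (Or.inl ENNReal.coe_ne_top), mul_comm,
            ← _root_.ofReal_norm, ← ENNReal.ofReal_coe_nnreal, ← ENNReal.ofReal_mul C.coe_nonneg]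
          exact ENNReal.ofReal_le_ofReal (hbd ω).le
      _ = ENNReal.ofReal r / C * ∫⁻ ω, ‖g.1 ω‖ₑ ∂m := lintegral_const_mul _ g.2.measurable.enorm
      _ ≤ ENNReal.ofReal r / C * C := by gcongr
      _ = ENNReal.ofReal r := ENNReal.div_mul_cancel hC0 ENNReal.coe_ne_top
  have hr0 : 0 ≤ r := by
    obtain ⟨ω⟩ := ‹Nonempty Ω›
    exact (mul_nonneg C.2 (norm_nonneg _)).trans (hbd ω).le
  rw [← _root_.ofReal_norm, ENNReal.ofReal_le_ofReal_iff hr0] at hle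
  exact absurd (hrx.trans_le ((Complex.re_le_norm _).trans hle)) (lt_irrefl r)

end VectorIntegration

/-! ### The equivalences -/

theorem MeasureTheory.Integrable.isPettisIntegrable {Ω X : Type*} [MeasurableSpace Ω]
    [NormedAddCommGroup X] [NormedSpace ℂ X] [CompleteSpace X] {m : Measure Ω} {F : Ω → X}
    (hF : Integrable F m) :
    IsPettisIntegrable m F := by
  refine ⟨fun x' => x'.integrable_comp hF, fun A _ => ⟨∫ ω in A, F ω ∂m,
    fun x' => x'.integral_comp_comm hF.integrableOn, fun y hy => ?_⟩⟩
  refine (SeparatingDual.eq_iff_forall_dual_eq (R := ℂ)).2 fun x' => ?_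
  rw [← hy x', x'.integral_comp_comm hF.integrableOn]

namespace CompactGroup

variable {G : Type*} [Group G] [TopologicalSpace G] [IsTopologicalGroup G] [CompactSpace G]
  [MeasurableSpace G] [BorelSpace G] {Φ : YoungFunction} {μ : ComplexMeasure G}

theorem ne_zero_of_density (hμ0 : μ ≠ 0) {f : OrliczSpace Φ (haarProb G)}
    (hf : ∀ A : Set G, MeasurableSet A →
      μ A = ∫ t in A, (f : G →ₘ[haarProb G] ℂ) t ∂haarProb G) : f ≠ 0 := by
  rintro rfl
  refine hμ0 (VectorMeasure.ext fun A hA => ?_)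
  rw [hf A hA, _root_.zero_apply]
  refine integral_eq_zero_of_ae (ae_restrict_of_ae ?_)
  exact AEEqFun.coeFn_zero

theorem variation_convolutionMeasure_univ_ne_zero [T2Space G] (hΦ : IsDeltaTwo Φ)
    (hΨ : ∀ x : ℝ≥0, Φ.complementary x ≠ ∞) (hμ : μ.variation.Regular) (hμ0 : μ ≠ 0) :
    (convolutionMeasure hΦ hμ).variation Set.univ ≠ 0 := by
  intro h
  have hd : DominatedOn (convolutionMeasure hΦ hμ) (haarProb G) 0 Set.univ := fun C _ _ => by
    rw [zero_mul, ← h]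
    exact (VectorMeasure.enorm_measure_le_variation _ C).trans (measure_mono (Set.subset_univ C))
  obtain ⟨f, hf0, -, hf⟩ := exists_density_of_dominatedOn hΦ hμ hΨ ENNReal.zero_ne_top hd
  exact ne_zero_of_density hμ0 hf (enorm_eq_zero.1 (le_antisymm hf0 zero_le))

end CompactGroup

theorem mainTheorem1 {G : Type*} [Group G] [TopologicalSpace G] [IsTopologicalGroup G]
    [CompactSpace G] [T2Space G] [MeasurableSpace G] [BorelSpace G]
    (Φ : YoungFunction) (hΦ : IsDeltaTwo Φ) (hΨ : IsDeltaTwo Φ.complementary)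
    (μ : ComplexMeasure G) (hμ : μ.variation.Regular) (hμ0 : μ ≠ 0) :
    List.TFAE
      [IsCompactOperator
          (VectorIntegration.integrationOperator (CompactGroup.convolutionMeasure hΦ hμ)),
        (CompactGroup.convolutionMeasure hΦ hμ).variation Set.univ < ∞,
        ∃ F₁ : G → OrliczSpace Φ (CompactGroup.haarProb G),
          Integrable F₁ (CompactGroup.haarProb G) ∧
          ∀ A : Set G, MeasurableSet A →
            CompactGroup.convolutionMeasure hΦ hμ A = ∫ t in A, F₁ t ∂CompactGroup.haarProb G,
        ∃ F₂ : G → OrliczSpace Φ (CompactGroup.haarProb G),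
          IsPettisIntegrable (CompactGroup.haarProb G) F₂ ∧
          ∀ A : Set G, MeasurableSet A →
            HasPettisIntegral (CompactGroup.haarProb G) F₂ A
              (CompactGroup.convolutionMeasure hΦ hμ A),
        ∃ A : Set G, MeasurableSet A ∧
          (CompactGroup.convolutionMeasure hΦ hμ).variation A ≠ 0 ∧
          (CompactGroup.convolutionMeasure hΦ hμ).variation A ≠ ∞,
        ∃ f : OrliczSpace Φ (CompactGroup.haarProb G),
          Integrable (f : G →ₘ[CompactGroup.haarProb G] ℂ) (CompactGroup.haarProb G) ∧
          ∀ A : Set G, MeasurableSet A →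
            μ A = ∫ t in A, (f : G →ₘ[CompactGroup.haarProb G] ℂ) t ∂CompactGroup.haarProb G] := by
  tfae_have 1 → 2 := VectorIntegration.variation_lt_top_of_isCompactOperator
  tfae_have 2 → 5 := fun h => ⟨Set.univ, MeasurableSet.univ,
    CompactGroup.variation_convolutionMeasure_univ_ne_zero hΦ hΨ.finite hμ hμ0, h.ne⟩
  tfae_have 5 → 6 := fun ⟨_, hA, h0, h1⟩ => by
    obtain ⟨a, ha, hd⟩ := CompactGroup.exists_dominatedOn_of_variation hΦ hμ hA h0 h1
    obtain ⟨f, -, hf⟩ := CompactGroup.exists_density_of_dominatedOn hΦ hμ hΨ.finite ha hd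
    exact ⟨f, hf⟩
  tfae_have 6 → 3 := fun ⟨f, hfi, hf⟩ => ⟨CompactGroup.translate f,
    CompactGroup.integrable_translate hΦ f,
    fun _ hA => CompactGroup.convolutionMeasure_eq_integral_translate hΦ hμ hΨ.finite hfi hf hA⟩
  tfae_have 3 → 4 := fun ⟨F, hF, h⟩ => ⟨F, hF.isPettisIntegrable, fun A hA x' => by
    rw [h A hA, x'.integral_comp_comm hF.integrableOn]⟩
  tfae_have 4 → 6 := fun ⟨_, hF, h⟩ => by
    obtain ⟨a, ha, hd⟩ := CompactGroup.exists_dominatedOn_of_pettis hΦ hμ hF h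
    obtain ⟨f, -, hf⟩ := CompactGroup.exists_density_of_dominatedOn hΦ hμ hΨ.finite ha hd
    exact ⟨f, hf⟩
  tfae_have 6 → 1 := fun ⟨f, hfi, hf⟩ => by
    refine VectorIntegration.isCompactOperator_integrationOperator
      (CompactGroup.continuous_translate hΦ f) (fun u h => ?_)
      (fun _ hA => CompactGroup.convolutionMeasure_eq_integral_translate hΦ hμ hΨ.finite hfi hf hA)
    have h1 := CompactGroup.enorm_translate f u
    rw [h, enorm_zero] at h1
    exact CompactGroup.ne_zero_of_density hμ0 hf (enorm_eq_zero.1 h1.symm)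
  tfae_finish
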